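/- **Setting.** Let $k=\mathbb F_q\subset K$ be finite fields of characteristic $\neq 2,3$, $[K:k]=d$, $\theta_1,\dots,\theta_d$ a (published) basis of $K/k$, $\bar k$ an algebraic closure of $K$, $\tau_a(x)=x^{q^a}$. Let $n\ge 1$. *Basic blinding maps.* Parameters $(\delta,A_i,B_i,p_i,q_i : 1\le i\le n)$ consist of $\delta\in GL_{3n}$, $A_i,B_i\in GL_3$, and polynomials $p_i(x)$, $q_i(x,y)$ of degree exactly $2$. Put $\lambda_i=B_i\circ\lambda_{p_i,q_i}\circ A_i$ with $\lambda_{p,q}(x,y,z)=(x,y+p(x),z+q(x,y))$, write $\delta=(\delta_i)_i$ with $\delta_i:\bar k^{3n}\to\bar k^3$, and $\lambda_i\circ\delta_i=(F_{i1},F_{i2},F_{i3})$. The blinding space is $W=\{F_{i2}=F_{i3},\ 1\le i\le n\}\subset\bar k^{3n}$ and the basic blinding map is $\rho=(\rho_i)_i:W\to\bar k^{2n}$, $\rho_i=(F_{i1},F_{i2})$. *The trilinear map.* Let $E:y^2=x^3+ax+b$ be an elliptic curve over $K$, $\ell$ a prime with $E[\ell]\subset E(K)$. For each $i$ let $E_i$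 be the image of $E$ under $P\mapsto\jmath(M_iP)$, where $\jmath(x,y)=(x^{-1},y^{-1})$ and $M_i\in GL_2(K)$ has neither both diagonal nor both off-diagonal entries zero. Fix secret blinding parameters over $K$, with blinding space $W$ and map $\rho$, and exponents $0\le a_i<d$; let $\tau\rho=(\tau_{a_i}\circ\rho_i)_i$ and $\hat E=\{x\in W:\tau\rho(x)\in\prod_iE_i\}$. Let $\varphi_1,\dots,\varphi_N$ be maps $\prod E_i\to\prod E_i$ whose $r$-th component is the sum, under $E_r\simeq E$, of two components with given distinct indices. The maps $m$ (addition), doubling, and $\varphi_t$ are blinded to $\hat\varphi=(\tau\rho)^{-1}\circ\varphi\circ\tau\rho$. Each of the $3n$ coordinates of a blinded map is a sum of $3n$ semi-local functions $w_{ij}v_j$, where $(w_{ij})=\delta^{-1}$ and $(v_{3r-2},v_{3r-1},v_{3r})$ is the point of $\bar k^3$ with $\lambda_r(v)=(u,u',u')$, $\tau_{a_r}(u,u')$ being the $r$-th component of the value of $\varphi$. The pairing functions are $\hat g=\prod_i g(\rho_i,\rho_i,\rho_i)$, $\hat h=\prod_i h(\rho_i,\rho_i)$ (with $\rho$ twisted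 by $\tau$), where $g(P_1,P_2,Q)$ and $h(P_1,Q)$ are $(y-\lambda x-\nu)/(x-x_3)$ at $Q=(x,y)$, for the line $y=\lambda x+\nu$ through $P_1,P_2$ (tangent at $P_1$) and $x_3=x(P_1+P_2)$ (resp. $x(2P_1)$). A *local function* is represented by a pair (numerator, denominator) of polynomials in $2c$ variables ($c\le3$ blocks of two), with degree in each block bounded by the degree of the defining formulas ($8$ for coordinates of $m,\varphi_t$ and $14$ for doubling on the $E_i$; $8$ times that for the $w_{ij}v_j$; $(6,6,2)$ for $g$; $(10,2)$ for $h$). Its *type* consists of these degrees, the points and indices $i$ on which it depends, and the Frobenius exponents with which the components $\rho_i$ enter. *Descent.* Polynomials in $x_1,\dots,x_{3n}$ are written in descent form, $x_s=\sum_jx_{sj}\theta_j$, where $\tau_a\circ F$ is replaced by the descent of $F$ with coefficients raised to the power $q^a$. Rational functions of $R$ points of $\hat E$ are compared on the $R$-th power of the descent (Weil restriction) of $\hat E$ in $\bar k^{3nd}$; denominators must not be zero divisors there. *Publication.* A sum $\sum_j f_j$ of semi-local functions is published as the fractions $G_j/G'_j$ obtained from $f_j+\frac{\ell_{j,1}}{\ell_{j,2}}-\frac{\ell_{j+1,1}}{\ell_{j+1,2}}$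 with secret linear forms (cyclic in $j$), and a product $\prod f_j$ as fractions obtained from $f_j\,\ell_j/\ell_{j+1}$; numerators and denominators are changed by arbitrary elements of the ideal generated by the (Frobenius conjugates of the) descents of $F_{i2}-F_{i3}$, of degree exceeding that of the original by at most $2$ (resp. $1$). Published are these fractions for $\hat m$, the doubling map, $\hat\varphi_1,\dots,\hat\varphi_N$, $\hat g$, $\hat h$, and points $\hat\alpha,\hat\beta\in\hat E[\ell]$, which belong to a finite set $\mathcal P\subset\hat E(K)$ at which the blinded maps can be evaluated (where the secret formulas are defined). *Conditions.* The unknowns are the coefficients of numerators and denominators of the local functions ($w_{ij}v_j$, factors of $\hat g,\hat h$, and coordinates of the local maps $m$, doubling, $\varphi_t$), the coefficients of the descents of quadratic polynomials $H_{ij}$ ($1\le i\le n$, $j=1,2$) that define some basic blinding map with blinding space $W$ (parameters in $\bar k$), and the coefficients of the descents of the linear forms. The conditions are: equality of each masked hidden fraction with the corresponding published fraction, on the descent of $\hat E$; and, for each evaluation $\hat\varphi(x)=y$ at points of $\mathcal P$, $\varphi(\tau\rho(x))=\tau\rho(y)$ for the unknown $\varphi,\rho$. Denominators occurring are required to be admissible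 (nonzero at the evaluated points). Let $\tilde V_{\mathcal T}$ be the set of solutions, and $\tilde V_{\langle\mathcal T\rangle}$ the set of solutions when the $H_{ij}$ are expressed by blinding parameters over $\bar k$ with blinding space $W$, which replace their coefficients as unknowns. *Systems and triple confusion.* A system $S$ consists of semi-local functions on the descent of $\hat E$ and of partial maps $\Phi$ from powers of $\hat E$ to $W$. A decomposition of $S$ of the given type consists of local functions and a basic blinding map $\rho$ on $W$ such that each function of $S$ is $f\circ\tau\circ\rho$ and each $\Phi$ satisfies $\varphi\circ\tau\rho=\tau\rho\circ\Phi$ on its domain, $\varphi$ being defined there. $\tilde V_S$ (resp. $\tilde V_{\langle S\rangle}$) is the set of all decompositions of $S$ (local coefficients together with the descents of the $H_{ij}$, resp. with blinding parameters). Any point of $\tilde V_{\mathcal T}$ or $\tilde V_{\langle\mathcal T\rangle}$ determines, through its local and blinding coordinates, a system $S$; let $S_0$ be the system given by the secret data. $\tilde V_S$ (resp. $\tilde V_{\langle S\rangle}$) is *triply confusing* if 1. around every point, $\bar k^{2n^2}$ (resp. $\bar k^{n}$) embeds by an injective morphism that changes only the polynomials (resp. parameters) presenting $\rho$, not $\rho$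 itself nor the local part; 2. around every point, $\bar k$ embeds by an injective morphism changing only the polynomials that represent one local function $f$, for every $f$ such that for some block of $f$ the degree bound is at least the minimal degree of a nonzero polynomial vanishing on the corresponding (twisted) component $\tau_e\rho_i(\hat E)$; 3. the diagonal matrices $D\in GL_{2n}(\bar k)$ act on it, by $[f]\circ[\tau]\circ[\rho]\mapsto[f\circ(D^{\tau})^{-1}]\circ[\tau]\circ[D\rho]$ (and $\varphi\mapsto D^{\tau}\varphi(D^{\tau})^{-1}$ for local maps). **Theorem.** For every constant $C_0$ there is a constant $C$ such that for every trilinear map as above with $N\le C_0n^2$, $d\le C_0n$, $|\mathcal P|\le C_0n^{C_0}$ the following holds, both for $\tilde V_{\mathcal T}$ and for $\tilde V_{\langle\mathcal T\rangle}$. * The number $m$ of unknowns satisfies $n^2\le m\le Cn^C$. There are at most $Cn^C$ conditions, and each is equivalent, for vectors of unknowns whose blinding part and denominators are admissible, to at most $Cn^C$ polynomial equations in the unknowns. The secret data (local functions, blinding map, linear forms) are a solution. * $\tilde V_{S_0}$ (resp. $\tilde V_{\langle S_0\rangle}$) is triply confusing, of dimension at least $2n^2$ (resp. $n$), and every secret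 local function satisfies the degree condition in 2 at the secret blinding map. * For every point of $\tilde V_{\mathcal T}$ (resp. $\tilde V_{\langle\mathcal T\rangle}$), the system $S$ it determines, of the same type as $S_0$, has $\tilde V_S$ (resp. $\tilde V_{\langle S\rangle}$) triply confusing of dimension at least $2n^2$ (resp. $n$), and there is an injective morphism $\tilde V_S\to\tilde V_{\mathcal T}$ (resp. $\tilde V_{\langle S\rangle}\to\tilde V_{\langle\mathcal T\rangle}$) whose image contains the point. -/

import Mathlib

noncomputable section

open MvPolynomial

namespace Blinding

/-! ### Affine spaces, morphisms, dimension -/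

/-- The polynomial map of affine spaces given by a tuple of polynomials. -/
def polyMap {F σ τ : Type*} [Field F] (φ : τ → MvPolynomial σ F) (x : σ → F) : τ → F :=
  fun t => eval x (φ t)

/-- Dimension of a subset of affine space: the Krull dimension of its coordinate ring
(the dimension of its Zariski closure). It is `⊥` exactly for the empty set. -/
def zdim {F σ : Type*} [Field F] (V : Set (σ → F)) : WithBot ℕ∞ :=
  ringKrullDim (MvPolynomial σ F ⧸ vanishingIdeal F V)

/-- `U` is locally embedded around the point `α` of `V`: there is an injective morphism
`U → V` whose image contains `α`. -/
def LocallyEmbedded {F σ τ : Type*} [Field F] (U : Set (σ → F)) (V : Set (τ → F))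
    (α : τ → F) : Prop :=
  ∃ φ : τ → MvPolynomial σ F,
    Set.MapsTo (polyMap φ) U V ∧ Set.InjOn (polyMap φ) U ∧ α ∈ polyMap φ '' U

/-- A polynomial vanishes on `X`. -/
def VanishesOn {F σ : Type*} [Field F] (X : Set (σ → F)) (P : MvPolynomial σ F) : Prop :=
  ∀ x ∈ X, eval x P = 0

/-- `D` is not a zero divisor in the coordinate ring of `X`, so that it is allowed as the
denominator of a rational function on `X`. -/
def RegularOn {F σ : Type*} [Field F] (X : Set (σ → F)) (D : MvPolynomial σ F) : Prop :=
  ∀ P : MvPolynomial σ F, VanishesOn X (P * D) → VanishesOn X P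

/-- Exponents of monomials of degree at most `D` in finitely many variables. -/
abbrev Mono (σ : Type) [Fintype σ] (D : ℕ) : Type :=
  {e : σ → Fin (D + 1) // ∑ s, (e s : ℕ) ≤ D}

/-- The exponent vector as a finitely supported function. -/
def Mono.exp {σ : Type} [Fintype σ] {D : ℕ} (e : Mono σ D) : σ →₀ ℕ :=
  Finsupp.equivFunOnFinite.symm fun s => (e.1 s : ℕ)

/-- The polynomial of degree at most `D` with given coefficients. -/
def polyOf {F : Type*} {σ : Type} [Field F] [Fintype σ] [DecidableEq σ] {D : ℕ} (c : Mono σ D → F) :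
    MvPolynomial σ F :=
  ∑ e, monomial e.exp (c e)

/-- Frobenius `x ↦ x ^ (q ^ a)`, where `q` is the order of `k`. -/
def frob (k : Type*) {F : Type*} [Field k] [Fintype k] [Field F] [Algebra k F] (a : ℕ) :
    F →+* F :=
  ((FiniteField.frobeniusAlgHom k F) ^ a : F →ₐ[k] F)

/-! ### Basic blinding maps -/

/-- The `3n` coordinates, in `n` groups of three. -/
abbrev Var (n : ℕ) : Type := Fin n × Fin 3

/-- The `3nd` coordinates after descent. -/
abbrev DVar (n d : ℕ) : Type := Var n × Fin d

/-- The coordinates of the blinding parameters: the matrix `δ`, and, for each `i`, the matrices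
`A_i`, `B_i`, the three coefficients of `p_i` and the six coefficients of `q_i`. -/
abbrev ParIdx (n : ℕ) : Type :=
  (Var n × Var n) ⊕ (Fin n × ((Fin 3 × Fin 3) ⊕ (Fin 3 × Fin 3) ⊕ Fin 3 ⊕ Fin 6))

section Params

variable {n : ℕ} {F : Type*} [Field F]

def parδ (c : ParIdx n → F) : Matrix (Var n) (Var n) F :=
  Matrix.of fun s t => c (.inl (s, t))

def parA (c : ParIdx n → F) (i : Fin n) : Matrix (Fin 3) (Fin 3) F :=
  Matrix.of fun s t => c (.inr (i, .inl (s, t)))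

def parB (c : ParIdx n → F) (i : Fin n) : Matrix (Fin 3) (Fin 3) F :=
  Matrix.of fun s t => c (.inr (i, .inr (.inl (s, t))))

/-- `p_i(x) = p 0 + p 1 x + p 2 x²`. -/
def parp (c : ParIdx n → F) (i : Fin n) (r : Fin 3) : F :=
  c (.inr (i, .inr (.inr (.inl r))))

/-- `q_i(x,y) = q 0 + q 1 x + q 2 y + q 3 x² + q 4 xy + q 5 y²`. -/
def parq (c : ParIdx n → F) (i : Fin n) (r : Fin 6) : F :=
  c (.inr (i, .inr (.inr (.inr r))))

/-- The matrices are invertible, and `p_i`, `q_i` have degree exactly two. -/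
def ValidPar (c : ParIdx n → F) : Prop :=
  (parδ c).det ≠ 0 ∧ ∀ i, (parA c i).det ≠ 0 ∧ (parB c i).det ≠ 0 ∧ parp c i 2 ≠ 0 ∧
    (parq c i 3 ≠ 0 ∨ parq c i 4 ≠ 0 ∨ parq c i 5 ≠ 0)

/-- The local quadratic isomorphism `λ_i = B_i ∘ λ_{p_i,q_i} ∘ A_i` with
`λ_{p,q}(x,y,z) = (x, y + p(x), z + q(x,y))`, over any algebra. -/
def lam {R : Type*} [CommRing R] [Algebra F R] (c : ParIdx n → F) (i : Fin n)
    (x : Fin 3 → R) : Fin 3 → R :=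
  let a : Fin 3 → R := fun r => ∑ t, parA c i r t • x t
  let b : Fin 3 → R :=
    ![a 0,
      a 1 + (parp c i 0 • 1 + parp c i 1 • a 0 + parp c i 2 • a 0 ^ 2),
      a 2 + (parq c i 0 • 1 + parq c i 1 • a 0 + parq c i 2 • a 1 + parq c i 3 • a 0 ^ 2
        + parq c i 4 • (a 0 * a 1) + parq c i 5 • a 1 ^ 2)]
  fun r => ∑ t, parB c i r t • b t

/-- The quadratic polynomials `F_{i1}, F_{i2}, F_{i3}` with `λ_i ∘ δ_i = (F_{i1}, F_{i2}, F_{i3})`;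
the third index is `0, 1, 2` here. -/
def quad3 (c : ParIdx n → F) (i : Fin n) (r : Fin 3) : MvPolynomial (Var n) F :=
  lam c i (fun t => ∑ s, parδ c (i, t) s • X s) r

/-- The pair `ρ_i = (F_{i1}, F_{i2})`. -/
def quad (c : ParIdx n → F) (i : Fin n) (s : Fin 2) : MvPolynomial (Var n) F :=
  quad3 c i s.castSucc

/-- The blinding space, the common zero set of the `F_{i2} - F_{i3}`. -/
def space (c : ParIdx n → F) : Set (Var n → F) :=
  {x | ∀ i, eval x (quad3 c i 1) = eval x (quad3 c i 2)}

end Params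

/-- Coordinates of a tuple of `2n` quadratic polynomials `(H_{ij})`. -/
abbrev BlindIdx (n : ℕ) (σ : Type) [Fintype σ] : Type := Fin n × Fin 2 × Mono σ 2

/-- The tuple of quadratic polynomials with given coefficients. -/
def blindPoly {n : ℕ} {F : Type*} {σ : Type} [Field F] [Fintype σ] [DecidableEq σ]
    (c : BlindIdx n σ → F)
    (i : Fin n) (s : Fin 2) : MvPolynomial σ F :=
  polyOf fun e => c (i, s, e)

/-- Two tuples of polynomials define the same map on `W`. -/
def SameOn {n : ℕ} {F : Type*} [Field F] (W : Set (Var n → F))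
    (H H' : Fin n → Fin 2 → MvPolynomial (Var n) F) : Prop :=
  ∀ x ∈ W, ∀ i s, eval x (H i s) = eval x (H' i s)

/-- The tuple defines a basic blinding map with blinding space `W`
(parameters in the algebraically closed field `F`). -/
def IsBlinding {n : ℕ} {F : Type*} [Field F] (W : Set (Var n → F))
    (H : Fin n → Fin 2 → MvPolynomial (Var n) F) : Prop :=
  ∃ c : ParIdx n → F, ValidPar c ∧ space c = W ∧ SameOn W H (quad c)

/-! ### Descent -/

/-- The descent of a polynomial: substitute `x_s = ∑_j x_{sj} θ_j`. -/
def desc {n d : ℕ} {F : Type*} [Field F] (θ : Fin d → F) :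
    MvPolynomial (Var n) F →ₐ[F] MvPolynomial (DVar n d) F :=
  aeval fun s => ∑ j, C (θ j) * X (s, j)

/-- Where everything takes place: the blinding space `W`, the blinded algebraic set `V ⊆ W`, and
the basis `θ` used for descent. -/
structure Scene (n d : ℕ) (F : Type*) where
  W : Set (Var n → F)
  V : Set (Var n → F)
  θ : Fin d → F

/-- The descent (Weil restriction) of `V`, in the coordinates given by `θ`: all the
Frobenius conjugates `(∑_j x_{sj} θ_j^{q^a})_s`, `a < d`, lie on the corresponding conjugates
of `V`. Its points with coordinates in `k` are the `K`-points of `V`. -/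
def Scene.res (k : Type*) {n d : ℕ} {F : Type*} [Field k] [Fintype k] [Field F] [Algebra k F]
    (sc : Scene n d F) : Set (DVar n d → F) :=
  {x | ∀ a < d, ∃ z ∈ sc.V, ∀ s, ∑ j, x (s, j) * frob k a (sc.θ j) = frob k a (z s)}

/-- The `R`-fold product of the descent of `V`, on which functions of `R` points live. -/
def Scene.dom (k : Type*) {n d : ℕ} {F : Type*} [Field k] [Fintype k] [Field F] [Algebra k F]
    (sc : Scene n d F) (R : ℕ) : Set (Fin R × DVar n d → F) :=
  {x | ∀ r, (fun s => x (r, s)) ∈ sc.res k}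

/-! ### Types of semi-local functions -/

/-- The type of a semi-local function of `R` points of `V`: its locality and its degrees.
The function depends, for `b < arity`, on the local component number `pos b` of the blinding map,
twisted by the Frobenius power `twist b`, at the `arg b`-th point. The degree of numerator and
denominator in the two variables of block `b` is at most `deg b`. -/
structure Shape (n R : ℕ) where
  arity : ℕ
  arg : Fin arity → Fin R
  pos : Fin arity → Fin n
  twist : Fin arity → ℕ
  deg : Fin arity → ℕ

/-- The `2c` variables of a local function. -/
abbrev Shape.LVar {n R : ℕ} (sh : Shape n R) : Type := Fin sh.arity × Fin 2

/-- Exponents of monomials whose degree in block `b` is at most `deg b`, for all `b`. -/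
abbrev Shape.BMono {n R : ℕ} (sh : Shape n R) : Type :=
  {e : (b : Fin sh.arity) → Fin 2 → Fin (sh.deg b + 1) // ∀ b, ∑ s, (e b s : ℕ) ≤ sh.deg b}

/-- The local polynomial with given coefficients. -/
def localPoly {F : Type*} [Field F] {n R : ℕ} {sh : Shape n R} (c : sh.BMono → F) :
    MvPolynomial sh.LVar F :=
  ∑ e : sh.BMono, monomial (Finsupp.equivFunOnFinite.symm fun bs => (e.1 bs.1 bs.2 : ℕ)) (c e)

/-- The type of a finite system of semi-local functions `g = f ∘ τ ∘ ρ` and semi-local maps `Φ`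
from tuples of points of `V` to `W`. For a map, the type lists those of the `2n` coordinates of
`τ ∘ ρ ∘ Φ`, where the `i`-th local component of `ρ` is followed by the
Frobenius power `outTwist i`. -/
structure SysType (n : ℕ) where
  Fun : Type
  Map : Type
  [finFun : Fintype Fun]
  [finMap : Fintype Map]
  fArgs : Fun → ℕ
  fShape : (f : Fun) → Shape n (fArgs f)
  mArgs : Map → ℕ
  mShape : (q : Map) → Fin n → Fin 2 → Shape n (mArgs q)
  outTwist : Fin n → ℕ

attribute [instance] SysType.finFun SysType.finMap

/-- The coordinates of the local parts: the coefficients of numerator (`true`) and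
denominator (`false`) of each local function. -/
abbrev LocIdx {n : ℕ} (Y : SysType n) : Type :=
  (Σ f : Y.Fun, Bool × (Y.fShape f).BMono) ⊕
    (Σ c : Y.Map × Fin n × Fin 2, Bool × (Y.mShape c.1 c.2.1 c.2.2).BMono)

section Systems

variable {n d : ℕ} {F : Type*} [Field F] (Y : SysType n)

/-- Numerator or denominator of the local function number `f`. -/
def fLoc (h : LocIdx Y → F) (f : Y.Fun) (b : Bool) : MvPolynomial (Y.fShape f).LVar F :=
  localPoly fun e => h (.inl ⟨f, b, e⟩)

/-- Numerator or denominator of the coordinate `(i,s)` of the local map number `q`. -/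
def mLoc (h : LocIdx Y → F) (q : Y.Map) (i : Fin n) (s : Fin 2) (b : Bool) :
    MvPolynomial (Y.mShape q i s).LVar F :=
  localPoly fun e => h (.inr ⟨(q, i, s), b, e⟩)

variable (k : Type*) [Field k] [Fintype k] [Algebra k F]

/-- The twisted blinding components `τ_a ∘ H_{ij}`, in descent form. Modulo the polynomials
`x^q - x` (that is, up to replacing powers `x_{sj}^{q^a}` of variables by `x_{sj}`), `τ_a` only acts
on the coefficients of the descent of `H_{ij}`. -/
def blockPoly (θ : Fin d → F) (H : Fin n → Fin 2 → MvPolynomial (Var n) F) {R : ℕ}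
    (sh : Shape n R) (bs : sh.LVar) : MvPolynomial (Fin R × DVar n d) F :=
  rename (Prod.mk (sh.arg bs.1)) (map (frob k (sh.twist bs.1)) (desc θ (H (sh.pos bs.1) bs.2)))

/-- A local polynomial composed with the twisted blinding map, in descent form. -/
def compose (θ : Fin d → F) (H : Fin n → Fin 2 → MvPolynomial (Var n) F) {R : ℕ}
    {sh : Shape n R} (P : MvPolynomial sh.LVar F) : MvPolynomial (Fin R × DVar n d) F :=
  bind₁ (blockPoly k θ H sh) P

/-- The arguments that a local function of type `sh` receives from the twisted blinding map at
a tuple of points of `V`. -/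
def blockVal (H : Fin n → Fin 2 → MvPolynomial (Var n) F) {R : ℕ} (sh : Shape n R)
    (x : Fin R → Var n → F) (bs : sh.LVar) : F :=
  frob k (sh.twist bs.1) (eval (x (sh.arg bs.1)) (H (sh.pos bs.1) bs.2))

/-- A system of rational functions on powers of the descent of `V`, and of partially defined
maps (given by their graphs) from powers of `V` to `W`. -/
structure SemiSys (n d : ℕ) (F : Type*) [Field F] (Y : SysType n) where
  num : (f : Y.Fun) → MvPolynomial (Fin (Y.fArgs f) × DVar n d) F
  den : (f : Y.Fun) → MvPolynomial (Fin (Y.fArgs f) × DVar n d) F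
  graph : (q : Y.Map) → Set ((Fin (Y.mArgs q) → Var n → F) × (Var n → F))

/-- Semi-local decomposition: local part `h` and blinding part `H`, of the prescribed type, define
every rational function of the system on the descent of `V`, and for every map `Φ` of the system
the local map `φ` given by `h` satisfies `φ ∘ (τ ∘ ρ) = (τ ∘ ρ) ∘ Φ` where `Φ` is defined. -/
def IsDecomp (sc : Scene n d F) (S : SemiSys n d F Y) (h : LocIdx Y → F)
    (H : Fin n → Fin 2 → MvPolynomial (Var n) F) : Prop :=
  (∀ f, RegularOn (sc.dom k (Y.fArgs f)) (compose k sc.θ H (fLoc Y h f false)) ∧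
    VanishesOn (sc.dom k (Y.fArgs f))
      (compose k sc.θ H (fLoc Y h f true) * S.den f
        - S.num f * compose k sc.θ H (fLoc Y h f false))) ∧
  (∀ q, ∀ xy ∈ S.graph q, ∀ i s,
    eval (blockVal k H (Y.mShape q i s) xy.1) (mLoc Y h q i s false) ≠ 0 ∧
    eval (blockVal k H (Y.mShape q i s) xy.1) (mLoc Y h q i s true)
      = eval (blockVal k H (Y.mShape q i s) xy.1) (mLoc Y h q i s false)
        * frob k (Y.outTwist i) (eval xy.2 (H i s)))

/-- The system of semi-local functions and maps determined by a local part and a blinding part.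
The map `Φ` is `(τ ∘ ρ)⁻¹ ∘ φ ∘ (τ ∘ ρ)`, defined where no denominator vanishes. -/
def hiddenSys (sc : Scene n d F) (h : LocIdx Y → F)
    (H : Fin n → Fin 2 → MvPolynomial (Var n) F) : SemiSys n d F Y where
  num f := compose k sc.θ H (fLoc Y h f true)
  den f := compose k sc.θ H (fLoc Y h f false)
  graph q := {xy | (∀ r, xy.1 r ∈ sc.V) ∧ xy.2 ∈ sc.W ∧ ∀ i s,
    eval (blockVal k H (Y.mShape q i s) xy.1) (mLoc Y h q i s false) ≠ 0 ∧
    eval (blockVal k H (Y.mShape q i s) xy.1) (mLoc Y h q i s true)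
      = eval (blockVal k H (Y.mShape q i s) xy.1) (mLoc Y h q i s false)
        * frob k (Y.outTwist i) (eval xy.2 (H i s))}

end Systems

/-! ### The two ways to present the blinding part -/

/-- A way to present basic blinding maps with blinding space `W` by points of affine space:
coordinates `B`, coordinates `B'` after descent, the quadratic polynomials presented by a point,
the admissible points, and the effect of scaling the `2n` components of `ρ`. -/
structure Presentation (n : ℕ) (F : Type*) [Field F] where
  B : Type
  B' : Type
  [finB : Fintype B]
  [finB' : Fintype B']
  tilde : (B → F) → (B' → F)
  maps : (B → F) → Fin n → Fin 2 → MvPolynomial (Var n) F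
  adm : Set (B → F)
  act : (Fin n → Fin 2 → Fˣ) → (B → F) → (B → F)

attribute [instance] Presentation.finB Presentation.finB'

/-- Presentation by the coefficients of the `H_{ij}`; after descent, by the
coefficients of the descents of the `H_{ij}`. -/
def byCoeffs {n d : ℕ} {F : Type*} [Field F] (sc : Scene n d F) : Presentation n F where
  B := BlindIdx n (Var n)
  B' := BlindIdx n (DVar n d)
  tilde c := fun ise => coeff ise.2.2.exp (desc sc.θ (blindPoly c ise.1 ise.2.1))
  maps c := blindPoly c
  adm := {c | IsBlinding sc.W (blindPoly c)}
  act D c := fun ise => (D ise.1 ise.2.1 : F) * c ise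

/-- Presentation by the blinding parameters. Scaling acts by
`B_i ↦ diag(D_{i1}, D_{i2}, D_{i2}) B_i`. -/
def byParams {n d : ℕ} {F : Type*} [Field F] (sc : Scene n d F) : Presentation n F where
  B := ParIdx n
  B' := ParIdx n
  tilde c := c
  maps c := quad c
  adm := {c | ValidPar c ∧ space c = sc.W}
  act D c := fun t => match t with
    | .inr (i, .inr (.inl (r, t'))) =>
        ((![D i 0, D i 1, D i 1] r : Fˣ) : F) * c (.inr (i, .inr (.inl (r, t'))))
    | t => c t

section Sets

variable {n d : ℕ} {F : Type*} [Field F] (Y : SysType n)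
variable (k : Type*) [Field k] [Fintype k] [Algebra k F]

/-- Descent on points consisting of a local part and a blinding part. -/
def tildeS (M : Presentation n F) (v : LocIdx Y ⊕ M.B → F) : LocIdx Y ⊕ M.B' → F :=
  Sum.elim (v ∘ Sum.inl) (M.tilde (v ∘ Sum.inr))

/-- The blinding part of a point. -/
def mapsS (M : Presentation n F) (v : LocIdx Y ⊕ M.B → F) :
    Fin n → Fin 2 → MvPolynomial (Var n) F :=
  M.maps (v ∘ Sum.inr)

/-- The set of all semi-local decompositions of the given type of the system `S`. -/
def VS (sc : Scene n d F) (M : Presentation n F) (S : SemiSys n d F Y) :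
    Set (LocIdx Y ⊕ M.B → F) :=
  {v | v ∘ Sum.inr ∈ M.adm ∧ IsDecomp Y k sc S (v ∘ Sum.inl) (mapsS Y M v)}

/-- Its descent form. -/
def VSt (sc : Scene n d F) (M : Presentation n F) (S : SemiSys n d F Y) :
    Set (LocIdx Y ⊕ M.B' → F) :=
  tildeS Y M '' VS Y k sc M S

/-- The degree of the shape at block `b` is at least the minimum degree of a nonzero polynomial
in the ideal of the (twisted) local component of `V` on which block `b` depends. -/
def DegreeCond (V : Set (Var n → F)) (H : Fin n → Fin 2 → MvPolynomial (Var n) F) {R : ℕ}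
    (sh : Shape n R) (b : Fin sh.arity) : Prop :=
  ∃ P : MvPolynomial (Fin 2) F, P ≠ 0 ∧ P.totalDegree ≤ sh.deg b ∧
    ∀ x ∈ V, eval (fun s => frob k (sh.twist b) (eval x (H (sh.pos b) s))) P = 0

/-- Some block of the local function, or coordinate of a local map, satisfies the degree
condition. -/
def SlotCond (V : Set (Var n → F)) (H : Fin n → Fin 2 → MvPolynomial (Var n) F) :
    Y.Fun ⊕ (Y.Map × Fin n × Fin 2) → Prop
  | .inl f => ∃ b, DegreeCond k V H (Y.fShape f) b
  | .inr c => ∃ b, DegreeCond k V H (Y.mShape c.1 c.2.1 c.2.2) b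

/-- The local function (or coordinate of a local map) to which a coordinate belongs. -/
def slotOf : LocIdx Y → Y.Fun ⊕ (Y.Map × Fin n × Fin 2)
  | .inl e => .inl e.1
  | .inr e => .inr e.1

/-- The factor by which scaling multiplies a coefficient of a local polynomial of type `sh`,
that is, of `P ∘ (D^τ)⁻¹`. -/
def scaleFactor (D : Fin n → Fin 2 → Fˣ) {R : ℕ} (sh : Shape n R) (e : sh.BMono) : F :=
  ∏ b, ∏ s, frob k (sh.twist b) (((D (sh.pos b) s)⁻¹ : Fˣ) : F) ^ (e.1 b s : ℕ)

/-- The twisted action of the diagonal matrix `D` of `Gl_{2n}` on decompositions: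
`[f] ∘ [τ] ∘ [ρ]` becomes `[f ∘ (D^τ)⁻¹] ∘ [τ] ∘ [D ∘ ρ]`, and a local map `φ` becomes
`D^τ ∘ φ ∘ (D^τ)⁻¹`. -/
def actS (M : Presentation n F) (D : Fin n → Fin 2 → Fˣ) (v : LocIdx Y ⊕ M.B → F) :
    LocIdx Y ⊕ M.B → F :=
  Sum.elim
    (fun
      | .inl e => scaleFactor k D (Y.fShape e.1) e.2.2 * v (.inl (.inl e))
      | .inr e => (if e.2.1 then frob k (Y.outTwist e.1.2.1) (D e.1.2.1 e.1.2.2 : F) else 1)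
          * scaleFactor k D (Y.mShape e.1.1 e.1.2.1 e.1.2.2) e.2.2 * v (.inl (.inr e)))
    (M.act D (v ∘ Sum.inr))

/-- The set of decompositions of `S` is triply confusing, with blinding part of
dimension at least `|τ|`. -/
structure TriplyConfusing (τ : Type) (sc : Scene n d F) (M : Presentation n F)
    (S : SemiSys n d F Y) : Prop where
  /-- Around every point affine space of dimension `|τ|` embeds, changing only the presentation
  of the blinding map and neither the blinding map itself nor the local part. -/
  blinding : ∀ v ∈ VS Y k sc M S, ∃ φ : LocIdx Y ⊕ M.B' → MvPolynomial τ F,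
    Function.Injective (polyMap φ) ∧ tildeS Y M v ∈ Set.range (polyMap φ) ∧
    ∀ t, ∃ w ∈ VS Y k sc M S, polyMap φ t = tildeS Y M w ∧
      w ∘ Sum.inl = v ∘ Sum.inl ∧ SameOn sc.W (mapsS Y M w) (mapsS Y M v)
  /-- Around every point the affine line embeds, changing only the polynomials that represent one
  local function, for every local function that satisfies the degree condition. -/
  locals : ∀ v ∈ VS Y k sc M S, ∀ f, SlotCond Y k sc.V (mapsS Y M v) f →
    ∃ φ : LocIdx Y ⊕ M.B' → MvPolynomial Unit F,
      Function.Injective (polyMap φ) ∧ tildeS Y M v ∈ Set.range (polyMap φ) ∧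
      ∀ t, ∃ w ∈ VS Y k sc M S, polyMap φ t = tildeS Y M w ∧
        w ∘ Sum.inr = v ∘ Sum.inr ∧ ∀ e, slotOf Y e ≠ f → w (.inl e) = v (.inl e)
  /-- The diagonal matrices act. -/
  act_one : ∀ v ∈ VS Y k sc M S, actS Y k M 1 v = v
  act_mul : ∀ v ∈ VS Y k sc M S, ∀ D D',
    actS Y k M (D * D') v = actS Y k M D (actS Y k M D' v)
  act_mem : ∀ v ∈ VS Y k sc M S, ∀ D, actS Y k M D v ∈ VS Y k sc M S
  act_maps : ∀ v ∈ VS Y k sc M S, ∀ D i s,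
    mapsS Y M (actS Y k M D v) i s = C (D i s : F) * mapsS Y M v i s

end Sets

/-! ### The trilinear map -/

/-- The blinded maps: the addition map, the doubling map, and `φ_1, …, φ_N`. -/
inductive MapIx (N : ℕ) : Type
  | add
  | dbl
  | phi (t : Fin N)
  deriving DecidableEq, Fintype

/-- The two functions `g`, `h` used to compute the pairing. -/
inductive PairIx : Type
  | g
  | h
  deriving DecidableEq

instance : Fintype PairIx := ⟨{.g, .h}, by intro x; cases x <;> simp⟩

/-- Number of points on which a blinded map depends. -/
def mapArgs {N : ℕ} : MapIx N → ℕ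
  | .add => 2
  | .dbl => 1
  | .phi _ => 1

/-- Number of points on which a blinded pairing function depends. -/
def pairArgs : PairIx → ℕ
  | .g => 3
  | .h => 2

/-- Type of the local functions belonging to the `r`-th component of a local map:
`tw p` is the twist at position `p`, and `D` gives the degrees. -/
def mapShape {n N : ℕ} (rows : Fin N → Fin n → Fin 2 → Fin n) (r : Fin n) (tw : Fin n → ℕ)
    (D : MapIx N → ℕ) : (q : MapIx N) → Shape n (mapArgs q)
  | .add => ⟨2, fun b => b, fun _ => r, fun _ => tw r, fun _ => D .add⟩
  | .dbl => ⟨1, fun b => b, fun _ => r, fun _ => tw r, fun _ => D .dbl⟩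
  | .phi t => ⟨2, fun _ => (0 : Fin 1), fun b => rows t r b, fun b => tw (rows t r b),
      fun _ => D (.phi t)⟩

/-- Degree of the coordinates of the local maps, as expressed by the addition and doubling
formulas in the coordinates of the curves `E_i`. -/
def mapDeg {N : ℕ} : MapIx N → ℕ
  | .add => 8
  | .dbl => 14
  | .phi _ => 8

/-- Degree after composition with the inverse (of degree four) of a local
quadratic isomorphism. -/
def sumDeg {N : ℕ} (q : MapIx N) : ℕ := 8 * mapDeg q

/-- Type of the local functions of the pairing; the degrees are again those of the formulas. -/
def pairShape {n : ℕ} (i : Fin n) (a : ℕ) : (p : PairIx) → Shape n (pairArgs p)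
  | .g => ⟨3, fun b => b, fun _ => i, fun _ => a, ![6, 6, 2]⟩
  | .h => ⟨2, fun b => b, fun _ => i, fun _ => a, ![10, 2]⟩

/-- The secret choices: the elliptic curve, its `n` disguises `E_i`, the blinding parameters, the
Frobenius twists, the maps `φ_t` (row `r` of the `t`-th matrix has its two entries `1` in
columns `rows t r 0` and `rows t r 1`), and the published basis of `K` over `k`. -/
structure Setup (k K : Type*) [Field k] [Fintype k] [Field K] [Algebra k K]
    (Kbar : Type*) [Field Kbar] [Algebra K Kbar] [DecidableEq Kbar] (n N d : ℕ) where
  two_ne : (2 : K) ≠ 0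
  three_ne : (3 : K) ≠ 0
  θ : Module.Basis (Fin d) k K
  E : WeierstrassCurve K
  elliptic : E.IsElliptic
  short : E.a₁ = 0 ∧ E.a₂ = 0 ∧ E.a₃ = 0
  ℓ : ℕ
  prime : ℓ.Prime
  torsion : ∀ x y : Kbar, ∀ h : (E.map (algebraMap K Kbar)).toAffine.Nonsingular x y,
    ℓ • WeierstrassCurve.Affine.Point.some x y h = 0 →
      x ∈ Set.range (algebraMap K Kbar) ∧ y ∈ Set.range (algebraMap K Kbar)
  A : Fin n → Matrix (Fin 2) (Fin 2) K
  A_det : ∀ i, (A i).det ≠ 0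
  A_gen : ∀ i, ¬(A i 0 0 = 0 ∧ A i 1 1 = 0) ∧ ¬(A i 0 1 = 0 ∧ A i 1 0 = 0)
  par : ParIdx n → K
  par_valid : ValidPar par
  a : Fin n → Fin d
  rows : Fin N → Fin n → Fin 2 → Fin n
  rows_inj : ∀ t r, Function.Injective (rows t r)

namespace Setup

variable {k K : Type*} [Field k] [Fintype k] [Field K] [Algebra k K]
variable {Kbar : Type*} [Field Kbar] [Algebra K Kbar] [DecidableEq Kbar] {n N d : ℕ}
variable (T : Setup k K Kbar n N d)

/-- The points of `E` over the algebraic closure. -/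
abbrev Pt : Type _ := (T.E.map (algebraMap K Kbar)).toAffine.Point

/-- `z` is the image of the point `(x,y)` of `E` under `(x,y) ↦ 1/(A_i (x,y))`
(coordinatewise inverse). -/
def IsCoord (i : Fin n) (z : Fin 2 → Kbar) (x y : Kbar) : Prop :=
  (T.E.map (algebraMap K Kbar)).toAffine.Equation x y ∧
    ∀ s, z s ≠ 0 ∧
      algebraMap K Kbar (T.A i s 0) * x + algebraMap K Kbar (T.A i s 1) * y = (z s)⁻¹

/-- `z` is the point of `E_i` that corresponds to `P`. -/
def IsPt (i : Fin n) (z : Fin 2 → Kbar) (P : T.Pt) : Prop :=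
  ∃ x y h, P = WeierstrassCurve.Affine.Point.some x y h ∧ T.IsCoord i z x y

/-- The blinding parameters, over the algebraic closure. -/
def parBar : ParIdx n → Kbar := fun t => algebraMap K Kbar (T.par t)

variable [Algebra k Kbar]

/-- `x` lies on `Ê = (τ ∘ ρ)⁻¹ (∏ E_i) ⊆ W` and corresponds to the point `P` of `E^n`. -/
def IsHatPt (x : Var n → Kbar) (P : Fin n → T.Pt) : Prop :=
  x ∈ space T.parBar ∧
    ∀ i, T.IsPt i (fun s => frob k (T.a i) (eval x (quad T.parBar i s))) (P i)

/-- The blinding space, `Ê`, and the basis. -/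
def scene : Scene n d Kbar where
  W := space T.parBar
  V := {x | ∃ P, T.IsHatPt x P}
  θ j := algebraMap K Kbar (T.θ j)

/-- The type of the hidden system. The blinded map `q` has `3n` components; component `i` is the
sum over `j` of the semi-local functions `w_{ij} v_j`, numbered `(q,i,j)`. Its blocks are twisted
relative to the position to which `v_j` belongs. The function `ĝ` (`ĥ`) is the
product over `i` of the semi-local functions `g ∘ ρ_i` (`h ∘ ρ_i`). -/
def type : SysType n where
  Fun := (MapIx N × Var n × Var n) ⊕ (PairIx × Fin n)
  Map := MapIx N
  fArgs := Sum.elim (fun f => mapArgs f.1) (fun f => pairArgs f.1)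
  fShape := fun
    | .inl f => mapShape T.rows f.2.2.1
        (fun p => ((T.a p : ℕ) + d - T.a f.2.2.1) % d) sumDeg f.1
    | .inr f => pairShape f.2 (T.a f.2) f.1
  mArgs := mapArgs
  mShape q i _ := mapShape T.rows i (fun p => T.a p) mapDeg q
  outTwist i := T.a i

/-- `Q` is the value of the local map `q` at the points `P b` (in the general
position that the formula requires). -/
def MapRel (q : MapIx N) {c : ℕ} (P : Fin c → T.Pt) (Q : T.Pt) : Prop :=
  Function.Injective P ∧ Q = (match q with | .dbl => 2 | _ => 1 : ℕ) • ∑ b, P b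

/-- Coordinates of the masking linear forms: two forms `ℓ_{j,1}, ℓ_{j,2}` for
each term of a sum and one form for each factor of a product, in `v` variables per point. -/
abbrev LinIdx (n N : ℕ) (v : Type) : Type :=
  (Σ f : MapIx N × Var n × Var n, Fin 2 × (Fin (mapArgs f.1) × v)) ⊕
    (Σ f : PairIx × Fin n, Fin (pairArgs f.1) × v)

/-- Descent of the coefficients of linear forms. -/
def tildeLin (l : LinIdx n N (Var n) → Kbar) : LinIdx n N (DVar n d) → Kbar
  | .inl ⟨f, m, r, s, j⟩ => l (.inl ⟨f, m, r, s⟩) * T.scene.θ j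
  | .inr ⟨f, r, s, j⟩ => l (.inr ⟨f, r, s⟩) * T.scene.θ j

/-- The descent of a linear form. -/
def linPoly {R : ℕ} (l : Fin R × Var n → Kbar) : MvPolynomial (Fin R × DVar n d) Kbar :=
  ∑ r, ∑ s, ∑ j, C (l (r, s) * T.scene.θ j) * X (r, s, j)

/-- The linear form `ℓ_{j,m+1}` for the component `i` of the map `q`. -/
def sumForm (l : LinIdx n N (Var n) → Kbar) (q : MapIx N) (i j : Var n) (m : Fin 2) :
    MvPolynomial (Fin (mapArgs q) × DVar n d) Kbar :=
  T.linPoly fun rs => l (.inl ⟨(q, i, j), m, rs⟩)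

/-- The linear form `ℓ_i` for the pairing function `p`. -/
def prodForm (l : LinIdx n N (Var n) → Kbar) (p : PairIx) (i : Fin n) :
    MvPolynomial (Fin (pairArgs p) × DVar n d) Kbar :=
  T.linPoly fun rs => l (.inr ⟨(p, i), rs⟩)

/-- The cyclic successor of the index of a term. -/
def nxt (j : Var n) : Var n :=
  finProdFinEquiv.symm (finRotate (n * 3) (finProdFinEquiv j))

/-- Numerator or denominator of the hidden function number `(q,i,j)`, in descent form. -/
def hidSum (h : LocIdx T.type → Kbar) (H : Fin n → Fin 2 → MvPolynomial (Var n) Kbar)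
    (q : MapIx N) (i j : Var n) (b : Bool) : MvPolynomial (Fin (mapArgs q) × DVar n d) Kbar :=
  compose k T.scene.θ H (fLoc T.type h (.inl (q, i, j)) b)

/-- Numerator or denominator of the hidden function number `(p,i)`, in descent form. -/
def hidProd (h : LocIdx T.type → Kbar) (H : Fin n → Fin 2 → MvPolynomial (Var n) Kbar)
    (p : PairIx) (i : Fin n) (b : Bool) : MvPolynomial (Fin (pairArgs p) × DVar n d) Kbar :=
  compose k T.scene.θ H (fLoc T.type h (.inr (p, i)) b)

/-- Numerator and denominator of the masked term
`f_j ∘ τ ∘ ρ + ℓ_{j,1}/ℓ_{j,2} - ℓ_{j+1,1}/ℓ_{j+1,2}`. -/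
def rawSum (h : LocIdx T.type → Kbar) (H : Fin n → Fin 2 → MvPolynomial (Var n) Kbar)
    (l : LinIdx n N (Var n) → Kbar) (q : MapIx N) (i j : Var n) :
    Bool → MvPolynomial (Fin (mapArgs q) × DVar n d) Kbar
  | true =>
      T.hidSum h H q i j true * T.sumForm l q i j 1 * T.sumForm l q i (nxt j) 1
        + T.sumForm l q i j 0 * T.hidSum h H q i j false * T.sumForm l q i (nxt j) 1
        - T.sumForm l q i (nxt j) 0 * T.hidSum h H q i j false * T.sumForm l q i j 1
  | false => T.hidSum h H q i j false * T.sumForm l q i j 1 * T.sumForm l q i (nxt j) 1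

/-- Numerator and denominator of the masked factor `(f_i ∘ τ ∘ ρ) ℓ_i / ℓ_{i+1}`. -/
def rawProd (h : LocIdx T.type → Kbar) (H : Fin n → Fin 2 → MvPolynomial (Var n) Kbar)
    (l : LinIdx n N (Var n) → Kbar) (p : PairIx) (i : Fin n) :
    Bool → MvPolynomial (Fin (pairArgs p) × DVar n d) Kbar
  | true => T.hidProd h H p i true * T.prodForm l p i
  | false => T.hidProd h H p i false * T.prodForm l p (finRotate n i)

/-- Numerator and denominator of all masked terms and factors. -/
def raw (h : LocIdx T.type → Kbar) (H : Fin n → Fin 2 → MvPolynomial (Var n) Kbar)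
    (l : LinIdx n N (Var n) → Kbar) : (f : T.type.Fun) → Bool →
      MvPolynomial (Fin (T.type.fArgs f) × DVar n d) Kbar
  | .inl f => T.rawSum h H l f.1 f.2.1 f.2.2
  | .inr f => T.rawProd h H l f.1 f.2

/-- The denominators occurring in a rational condition are admissible. -/
def FormsRegular (l : LinIdx n N (Var n) → Kbar) : Prop :=
  (∀ q i j, RegularOn (T.scene.dom k (mapArgs q)) (T.sumForm l q i j 1)) ∧
    ∀ p i, RegularOn (T.scene.dom k (pairArgs p)) (T.prodForm l p i)

/-- The part in degree at most `e` of the ideal of ambivalence in descent form: it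
is spanned by the products of monomials with the Frobenius conjugates of the descents of the
polynomials `F_{i2} - F_{i3}`. -/
def ambiv (R e : ℕ) : Submodule Kbar (MvPolynomial (Fin R × DVar n d) Kbar) :=
  Submodule.span Kbar
    {P | ∃ (m : Fin R × DVar n d →₀ ℕ) (r : Fin R) (a : Fin d) (i : Fin n),
      m.degree + 2 ≤ e ∧
      P = monomial m 1 * rename (Prod.mk r) (map (frob k (a : ℕ))
        (desc T.scene.θ (quad3 T.parBar i 1 - quad3 T.parBar i 2)))}

/-- The additional degree allowed in the random choice modulo the ideal of ambivalence. -/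
def extra : T.type.Fun → ℕ
  | .inl _ => 2
  | .inr _ => 1

end Setup

/-- A trilinear map with its public specification. -/
structure Spec (k K : Type*) [Field k] [Fintype k] [Field K] [Algebra k K]
    (Kbar : Type*) [Field Kbar] [Algebra K Kbar] [Algebra k Kbar] [DecidableEq Kbar]
    (n N d : ℕ) extends Setup k K Kbar n N d where
  /-- The hidden polynomials representing the local functions. -/
  loc : LocIdx toSetup.type → Kbar
  /-- The hidden linear forms. -/
  lin : Setup.LinIdx n N (Var n) → Kbar
  loc_den : ∀ f, RegularOn (toSetup.scene.dom k (toSetup.type.fArgs f))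
    (compose k toSetup.scene.θ (quad toSetup.parBar) (fLoc toSetup.type loc f false))
  lin_den : toSetup.FormsRegular lin
  /-- The coordinates of the local map `q` are those of the sum of the points. -/
  map_spec : ∀ q i s (z : Fin (toSetup.type.mShape q i s).arity × Fin 2 → Kbar)
    (P : Fin (toSetup.type.mShape q i s).arity → toSetup.Pt) (Q : toSetup.Pt) (y : Fin 2 → Kbar),
    (∀ b, toSetup.IsPt ((toSetup.type.mShape q i s).pos b) (fun t => z (b, t)) (P b)) →
    toSetup.MapRel q P Q → toSetup.IsPt i y Q →
    eval z (mLoc toSetup.type loc q i s true) = eval z (mLoc toSetup.type loc q i s false) * y s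
  /-- The local function number `(q,i,j)`, `j = (r,t)`, is `w_{ij} v_j`, where `(w_{ij})` is the
  inverse of `δ`, and `(v_{(r,0)}, v_{(r,1)}, v_{(r,2)})` is the point of `W_r` which `τ ∘ pr ∘ λ_r`
  maps to the sum of the points, on `E_r`. -/
  sum_spec : ∀ q i j (z : Fin (toSetup.type.fShape (.inl (q, i, j))).arity × Fin 2 → Kbar)
    (P : Fin (toSetup.type.fShape (.inl (q, i, j))).arity → toSetup.Pt) (Q : toSetup.Pt)
    (v : Fin 3 → Kbar),
    (∀ b, toSetup.IsPt ((toSetup.type.fShape (.inl (q, i, j))).pos b)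
      (fun t => frob k (toSetup.a j.1) (z (b, t))) (P b)) →
    toSetup.MapRel q P Q →
    lam toSetup.parBar j.1 v 1 = lam toSetup.parBar j.1 v 2 →
    toSetup.IsPt j.1
      (fun t => frob k (toSetup.a j.1) (lam toSetup.parBar j.1 v t.castSucc)) Q →
    eval z (fLoc toSetup.type loc (.inl (q, i, j)) true)
      = eval z (fLoc toSetup.type loc (.inl (q, i, j)) false)
        * (algebraMap K Kbar ((parδ toSetup.par)⁻¹ i j) * v j.2)
  /-- The function `g(P₁,P₂,Q) = (y - λx - ν)/(x - x₃)` of `Q = (x,y)`, where `y = λx + ν` is the line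
  through `P₁`, `P₂`, and `x₃` is the first coordinate of the sum of `P₁` and `P₂`. -/
  g_spec : ∀ i (z : Fin 3 × Fin 2 → Kbar) (x y : Fin 3 → Kbar),
    (∀ b, toSetup.IsCoord i (fun t => z (b, t)) (x b) (y b)) → x 0 ≠ x 1 →
    let sl := (y 1 - y 0) / (x 1 - x 0)
    let ν := (y 0 * x 1 - y 1 * x 0) / (x 1 - x 0)
    let x₃ := sl ^ 2 - x 0 - x 1
    eval z (fLoc toSetup.type loc (.inr (.g, i)) true) * (x 2 - x₃)
      = eval z (fLoc toSetup.type loc (.inr (.g, i)) false) * (y 2 - sl * x 2 - ν)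
  /-- The function `h(P₁,Q) = (y - λx - ν)/(x - x₃)` of `Q = (x,y)`, where `y = λx + ν` is the tangent
  at `P₁`, and `x₃` is the first coordinate of the double of `P₁`. -/
  h_spec : ∀ i (z : Fin 2 × Fin 2 → Kbar) (x y : Fin 2 → Kbar),
    (∀ b, toSetup.IsCoord i (fun t => z (b, t)) (x b) (y b)) → y 0 ≠ 0 →
    let α := algebraMap K Kbar toSetup.E.a₄
    let β := algebraMap K Kbar toSetup.E.a₆
    let sl := (3 * x 0 ^ 2 + α) / (2 * y 0)
    let ν := (-(x 0) ^ 3 + α * x 0 + 2 * β) / (2 * y 0)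
    let x₃ := sl ^ 2 - 2 * x 0
    eval z (fLoc toSetup.type loc (.inr (.h, i)) true) * (x 1 - x₃)
      = eval z (fLoc toSetup.type loc (.inr (.h, i)) false) * (y 1 - sl * x 1 - ν)
  /-- The published polynomials: for each term of a sum and each factor of a product a numerator
  (`true`) and a denominator (`false`), chosen modulo the ideal of ambivalence. -/
  pub : (f : toSetup.type.Fun) → Bool →
    MvPolynomial (Fin (toSetup.type.fArgs f) × DVar n d) Kbar
  pub_spec : ∀ f b,
    pub f b - toSetup.raw loc (quad toSetup.parBar) lin f b ∈
      toSetup.ambiv (toSetup.type.fArgs f)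
        ((toSetup.raw loc (quad toSetup.parBar) lin f b).totalDegree + toSetup.extra f)
  /-- The published points. -/
  αhat : Var n → K
  βhat : Var n → K
  αhat_spec : ∃ P, toSetup.IsHatPt (fun s => algebraMap K Kbar (αhat s)) P ∧
    ∀ i, toSetup.ℓ • P i = 0
  βhat_spec : ∃ P, toSetup.IsHatPt (fun s => algebraMap K Kbar (βhat s)) P ∧
    ∀ i, toSetup.ℓ • P i = 0
  /-- The publicly available points of `Ê(K)` at which the published maps are evaluated. -/
  pts : Finset (Var n → K)
  αhat_mem : αhat ∈ pts
  βhat_mem : βhat ∈ pts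
  pts_mem : ∀ x ∈ pts, (fun s => algebraMap K Kbar (x s)) ∈ toSetup.scene.V

namespace Spec

variable {k K : Type*} [Field k] [Fintype k] [Field K] [Algebra k K]
variable {Kbar : Type*} [Field Kbar] [Algebra K Kbar] [Algebra k Kbar] [DecidableEq Kbar]
variable {n N d : ℕ} (T : Spec k K Kbar n N d)

/-- `y` is the value that evaluation of the blinded map `q` at the public points `x` returns. -/
def IsEval (q : MapIx N) (x : Fin (mapArgs q) → Var n → K) (y : Var n → K) : Prop :=
  (∀ r, x r ∈ T.pts) ∧
  (∃ (P : Fin (mapArgs q) → Fin n → T.Pt) (Q : Fin n → T.Pt),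
    (∀ r, T.IsHatPt (fun s => algebraMap K Kbar (x r s)) (P r)) ∧
    T.IsHatPt (fun s => algebraMap K Kbar (y s)) Q ∧
    ∀ i s, T.MapRel q
      (fun b => P ((T.type.mShape q i s).arg b) ((T.type.mShape q i s).pos b)) (Q i)) ∧
  ∀ i s, eval (blockVal k (quad T.parBar) (T.type.mShape q i s)
    fun r s => algebraMap K Kbar (x r s)) (mLoc T.type T.loc q i s false) ≠ 0

variable (M : Presentation n Kbar)

/-- The unknowns, before and after descent: the local parts, the blinding
part, the linear forms. -/
abbrev Unk : Type := (LocIdx T.type ⊕ M.B) ⊕ Setup.LinIdx n N (Var n)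

abbrev UnkT : Type := (LocIdx T.type ⊕ M.B') ⊕ Setup.LinIdx n N (DVar n d)

/-- Descent on all unknowns. -/
def tilde (v : T.Unk M → Kbar) : T.UnkT M → Kbar :=
  Sum.elim (tildeS T.type M (v ∘ Sum.inl)) (T.tildeLin (v ∘ Sum.inr))

/-- The local part of a vector of unknowns. -/
def locOf (v : T.Unk M → Kbar) : LocIdx T.type → Kbar := fun e => v (.inl (.inl e))

/-- The blinding part of a vector of unknowns. -/
def mapsOf (v : T.Unk M → Kbar) : Fin n → Fin 2 → MvPolynomial (Var n) Kbar :=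
  mapsS T.type M (v ∘ Sum.inl)

/-- The expressions in the conditions are meaningful: the blinding part presents a basic
blinding map on `W`, and the denominators are admissible. -/
def Meaningful (v : T.Unk M → Kbar) : Prop :=
  (fun b => v (.inl (.inr b))) ∈ M.adm ∧
  (∀ f, RegularOn (T.scene.dom k (T.type.fArgs f))
    (compose k T.scene.θ (T.mapsOf M v) (fLoc T.type (T.locOf M v) f false))) ∧
  T.FormsRegular (v ∘ Sum.inr) ∧
  ∀ q x y, T.IsEval q x y → ∀ i s,
    eval (blockVal k (T.mapsOf M v) (T.type.mShape q i s)
      fun r s => algebraMap K Kbar (x r s)) (mLoc T.type (T.locOf M v) q i s false) ≠ 0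

/-- The labels of the conditions: one for each published fraction, and one for each
local coordinate of each evaluation of a blinded map at public points. -/
abbrev CondIx : Type _ :=
  T.type.Fun ⊕ {c : (q : MapIx N) × ((Fin (mapArgs q) → Var n → K) × (Var n → K)) //
    T.IsEval c.1 c.2.1 c.2.2} × Fin n × Fin 2

/-- The conditions relating the published polynomials and values to the unknowns: equality of the
masked hidden fraction and the published fraction as rational functions, and the value of the local
map at the given points. Denominators are cleared. -/
def Cond (v : T.Unk M → Kbar) : T.CondIx → Prop
  | .inl f => VanishesOn (T.scene.dom k (T.type.fArgs f))
      (T.raw (T.locOf M v) (T.mapsOf M v) (v ∘ Sum.inr) f true * T.pub f false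
        - T.pub f true * T.raw (T.locOf M v) (T.mapsOf M v) (v ∘ Sum.inr) f false)
  | .inr (c, i, s) =>
      eval (blockVal k (T.mapsOf M v) (T.type.mShape c.1.1 i s)
          fun r s => algebraMap K Kbar (c.1.2.1 r s)) (mLoc T.type (T.locOf M v) c.1.1 i s true)
        = eval (blockVal k (T.mapsOf M v) (T.type.mShape c.1.1 i s)
            fun r s => algebraMap K Kbar (c.1.2.1 r s)) (mLoc T.type (T.locOf M v) c.1.1 i s false)
          * frob k (T.a i : ℕ)
              (eval (fun t => algebraMap K Kbar (c.1.2.2 t)) (T.mapsOf M v i s))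

/-- The set of all solutions of the conditions. -/
def VT : Set (T.Unk M → Kbar) := {v | T.Meaningful M v ∧ ∀ c, T.Cond M v c}

/-- Its descent form. -/
def VTt : Set (T.UnkT M → Kbar) := T.tilde M '' T.VT M

/-- The system of semi-local functions and maps determined by a vector of unknowns. -/
def sysOf (v : T.Unk M → Kbar) : SemiSys n d Kbar T.type :=
  hiddenSys T.type k T.scene (T.locOf M v) (T.mapsOf M v)

/-- The hidden system of the trilinear map. -/
def S₀ : SemiSys n d Kbar T.type := hiddenSys T.type k T.scene T.loc (quad T.parBar)

/-- `v` consists of the secret local functions, the secret linear forms, and a presentation of the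
secret blinding map. -/
def IsSecret (v : T.Unk M → Kbar) : Prop :=
  T.locOf M v = T.loc ∧ v ∘ Sum.inr = T.lin ∧ T.mapsOf M v = quad T.parBar

/-- The assertions about one way of presenting the blinding part: `τ` indexes the coordinates of
the affine space that embeds in the blinding part, and `C` bounds the sizes. -/
structure Secure (τ : Type) [Fintype τ] (C : ℕ) : Prop where
  /-- Descent loses no information. -/
  tilde_inj : Function.Injective (T.tilde M)
  /-- There are at least `n²` and at most polynomially many unknowns. -/
  unknowns_ge : n ^ 2 ≤ Fintype.card (T.UnkT M)
  unknowns_le : Fintype.card (T.UnkT M) ≤ C * n ^ C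
  /-- There are polynomially many conditions. -/
  conds : Finite T.CondIx ∧ Nat.card T.CondIx ≤ C * n ^ C
  /-- Each of them amounts to polynomially many polynomial equations in the unknowns. -/
  algebraic : ∀ c : T.CondIx, ∃ Eqs : Finset (MvPolynomial (T.UnkT M) Kbar),
    Eqs.card ≤ C * n ^ C ∧
      ∀ v, T.Meaningful M v → (T.Cond M v c ↔ ∀ P ∈ Eqs, eval (T.tilde M v) P = 0)
  /-- The secret data satisfy the conditions. -/
  secret : ∃ v ∈ T.VT M, T.IsSecret M v
  /-- The hidden system is triply confusing, and its local functions satisfy the degree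
  condition. -/
  confusing₀ : TriplyConfusing T.type k τ T.scene M T.S₀
  local₀ : ∀ f, SlotCond T.type k T.scene.V (quad T.parBar) f
  dim₀ : (Fintype.card τ : WithBot ℕ∞) ≤ zdim (VSt T.type k T.scene M T.S₀)
  /-- Around each solution, the set of decompositions of a triply confusing system of the same type
  embeds. -/
  around : ∀ v ∈ T.VT M,
    TriplyConfusing T.type k τ T.scene M (T.sysOf M v) ∧
    (Fintype.card τ : WithBot ℕ∞) ≤ zdim (VSt T.type k T.scene M (T.sysOf M v)) ∧
    LocallyEmbedded (VSt T.type k T.scene M (T.sysOf M v)) (T.VTt M) (T.tilde M v)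

end Spec

end Blinding

end

noncomputable section

open MvPolynomial

namespace Blinding

/-! ### Polynomial functions of a parameter -/

/-! A presentation of a decomposition carries more data than the functions it presents. Each kind of
confusion is one such redundancy, and it is available at every decomposition, secret or not, of any
system whose maps take arguments in `V` and values in `W`.

The blinding part is redundant because the `n` polynomials F_{r2} - F_{r3} vanish on `W`: any
combination of them may be added to each of the 2n polynomials H_{ij}. They are linearly independent
since all F_{ij} together define a bijection of affine space (`quad3_bijective`,
`linearIndependent_quadDiff`), and descent is injective, so 2n² independent directions survive
(`coeffs_family`). In terms of parameters, a shear of `A_i` can be compensated in `q_i`, which gives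
`n` directions (`params_family`). Both families have polynomial left inverses, hence are retracts of
affine space and bound the dimension from below (`le_zdim`). A local function is redundant because a
polynomial that vanishes on the relevant twisted component of `V` may be added to its numerator
(`IsDecomp.add_numCoeffs`). For the secret map such a polynomial is a conjugate of the equation of
E_i: it has degree at most 6, and its coefficients lie in `K`, so that twists count only modulo `d`
(`degreeCond_of_twist`). Finally, a scaling of `ρ` is undone in the local part (`actS_mem_VS`).

A set of decompositions embeds into the solution set because a masked fraction is an affine-linear
function of the hidden one, with coefficients given by the linear forms. With the forms kept fixed,
only the hidden rational functions and maps matter, not their presentation (`mem_VT_of_mem_VS`). The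
secret data are a solution since the random changes of the published polynomials vanish on the
descent (`ambiv_vanishesOn`).

The conditions are polynomial because composition, descent and Frobenius depend polynomially on the
coordinates after descent (`PolyFun`, `Presentation.Lawful`). They amount to few equations because
all degrees are bounded by absolute constants, and a polynomial of bounded degree vanishes on a set
as soon as it vanishes at polynomially many suitable points of it (`exists_finset_vanishesOn`). -/

/-- The function `g` of a parameter is a polynomial in the coordinates `t` of the parameter. -/
def PolyFun {F σ ι : Type*} [Field F] (t : ι → σ → F) (g : ι → F) : Prop :=
  ∃ p : MvPolynomial σ F, ∀ v, eval (t v) p = g v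

namespace PolyFun

variable {F σ ι : Type*} [Field F] {t : ι → σ → F} {g g' : ι → F}

theorem const (a : F) : PolyFun t fun _ => a := ⟨C a, fun v => by simp⟩

theorem coord (s : σ) : PolyFun t fun v => t v s := ⟨X s, fun v => by simp⟩

theorem add (h : PolyFun t g) (h' : PolyFun t g') : PolyFun t fun v => g v + g' v := by
  obtain ⟨p, hp⟩ := h
  obtain ⟨p', hp'⟩ := h'
  exact ⟨p + p', fun v => by simp [hp, hp']⟩

theorem sub (h : PolyFun t g) (h' : PolyFun t g') : PolyFun t fun v => g v - g' v := by
  obtain ⟨p, hp⟩ := h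
  obtain ⟨p', hp'⟩ := h'
  exact ⟨p - p', fun v => by simp [hp, hp']⟩

theorem mul (h : PolyFun t g) (h' : PolyFun t g') : PolyFun t fun v => g v * g' v := by
  obtain ⟨p, hp⟩ := h
  obtain ⟨p', hp'⟩ := h'
  exact ⟨p * p', fun v => by simp [hp, hp']⟩

theorem pow (h : PolyFun t g) (m : ℕ) : PolyFun t fun v => g v ^ m := by
  obtain ⟨p, hp⟩ := h
  exact ⟨p ^ m, fun v => by simp [hp]⟩

theorem sum {κ : Type*} (s : Finset κ) {g : κ → ι → F} (h : ∀ j ∈ s, PolyFun t (g j)) :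
    PolyFun t fun v => ∑ j ∈ s, g j v := by
  choose! p hp using h
  exact ⟨∑ j ∈ s, p j, fun v => by simpa using Finset.sum_congr rfl fun j hj => hp j hj v⟩

theorem prod {κ : Type*} (s : Finset κ) {g : κ → ι → F} (h : ∀ j ∈ s, PolyFun t (g j)) :
    PolyFun t fun v => ∏ j ∈ s, g j v := by
  choose! p hp using h
  exact ⟨∏ j ∈ s, p j, fun v => by simpa using Finset.prod_congr rfl fun j hj => hp j hj v⟩

/-- Used to pass from polynomials in the blinding coordinates to polynomials in all unknowns. -/
theorem comp {σ' ι' : Type*} {t' : ι' → σ' → F} {f : ι' → ι} (h : PolyFun t g)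
    (hf : ∀ s, PolyFun t' fun v => t (f v) s) : PolyFun t' fun v => g (f v) := by
  obtain ⟨p, hp⟩ := h
  choose q hq using hf
  refine ⟨aeval q p, fun v => ?_⟩
  have hs : (fun s => eval (t' v) (q s)) = t (f v) := funext fun s => hq s v
  change eval (t' v) (aeval q p) = g (f v)
  rw [← hp, ← hs, ← aeval_eq_eval, ← aeval_eq_eval, ← aeval_bind₁]
  rfl

end PolyFun

/-! ### Frobenius -/

section Frob

variable {k F : Type*} [Field k] [Fintype k] [Field F] [Algebra k F]

theorem frob_apply (a : ℕ) (x : F) : frob k a x = x ^ (Fintype.card k ^ a) := by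
  have h : ∀ (a : ℕ) (x : F), ((FiniteField.frobeniusAlgHom k F) ^ a : F →ₐ[k] F) x
      = x ^ (Fintype.card k ^ a) := by
    intro a
    induction a with
    | zero => intro x; simp
    | succ a ih =>
      intro x
      rw [pow_succ, AlgHom.mul_apply, ih, FiniteField.coe_frobeniusAlgHom, ← pow_mul, pow_succ,
        mul_comm]
  exact h a x

theorem frob_frob (a b : ℕ) (x : F) : frob k a (frob k b x) = frob k (a + b) x := by
  simp only [frob_apply, ← pow_mul, ← pow_add, add_comm a b]

end Frob

/-! ### Polynomials of bounded degree -/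

section Degree

variable {F : Type*} [Field F]

theorem totalDegree_aeval_le_mul {σ τ : Type*} (f : σ → MvPolynomial τ F) {m : ℕ}
    (hf : ∀ i, (f i).totalDegree ≤ m) (P : MvPolynomial σ F) :
    (aeval f P).totalDegree ≤ m * P.totalDegree := by
  rw [aeval_def, eval₂_eq]
  refine totalDegree_finsetSum_le fun e he => (totalDegree_mul _ _).trans ?_
  rw [algebraMap_eq, totalDegree_C, zero_add]
  refine (totalDegree_finsetProd _ _).trans ?_
  calc ∑ i ∈ e.support, (f i ^ e i).totalDegree ≤ ∑ i ∈ e.support, m * e i :=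
        Finset.sum_le_sum fun i _ => (totalDegree_pow _ _).trans (by
          rw [mul_comm]; exact Nat.mul_le_mul_right _ (hf i))
    _ = m * e.sum fun _ x => x := by rw [← Finset.mul_sum]; rfl
    _ ≤ m * P.totalDegree := Nat.mul_le_mul_left _ (le_totalDegree he)

variable {σ : Type} [Fintype σ] {D : ℕ}

theorem Mono.exp_injective : Function.Injective (Mono.exp : Mono σ D → σ →₀ ℕ) := by
  intro e e' h
  apply Subtype.ext
  funext s
  exact Fin.ext (DFunLike.congr_fun h s)

theorem Mono.exists_exp {m : σ →₀ ℕ} (hm : ∑ s, m s ≤ D) : ∃ e : Mono σ D, e.exp = m := by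
  have h : ∀ s, m s < D + 1 := fun s =>
    Nat.lt_succ_of_le ((Finset.single_le_sum (f := m) (fun _ _ => Nat.zero_le _)
      (Finset.mem_univ s)).trans hm)
  exact ⟨⟨fun s => ⟨m s, h s⟩, hm⟩, by ext s; rfl⟩

variable [DecidableEq σ]

theorem coeff_polyOf (c : Mono σ D → F) (e : Mono σ D) : coeff e.exp (polyOf c) = c e := by
  simp only [polyOf, coeff_sum, coeff_monomial]
  rw [Finset.sum_eq_single e]
  · simp
  · intro e' _ h
    rw [if_neg fun h' => h (Mono.exp_injective h')]
  · simp

theorem totalDegree_polyOf_le (c : Mono σ D → F) : (polyOf c).totalDegree ≤ D := by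
  refine totalDegree_finsetSum_le fun e _ => (totalDegree_monomial_le _ _).trans ?_
  rw [Finsupp.sum_fintype _ _ (by simp)]
  exact e.2

/-- Makes coefficient vectors and polynomials of bounded degree interchangeable. -/
theorem polyOf_coeff {P : MvPolynomial σ F} (hP : P.totalDegree ≤ D) :
    polyOf (fun e : Mono σ D => coeff e.exp P) = P := by
  ext m
  by_cases hm : ∑ s, m s ≤ D
  · obtain ⟨e, rfl⟩ := Mono.exists_exp hm
    rw [coeff_polyOf]
  · have key : ∀ Q : MvPolynomial σ F, Q.totalDegree ≤ D → coeff m Q = 0 := by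
      intro Q hQ
      refine coeff_eq_zero_of_totalDegree_lt (lt_of_le_of_lt hQ ?_)
      rw [← Finsupp.sum_fintype m (fun _ x => x) (by simp), Finsupp.sum] at hm
      omega
    rw [key _ (totalDegree_polyOf_le _), key _ hP]

theorem eval₂_polyOf {R : Type*} [CommRing R] (φ : F →+* R) (x : σ → R) (c : Mono σ D → F) :
    eval₂ φ x (polyOf c) = ∑ e, φ (c e) * ∏ s, x s ^ (e.1 s : ℕ) := by
  simp only [polyOf, eval₂_sum, eval₂_monomial]
  refine Finset.sum_congr rfl fun e _ => ?_
  rw [Finsupp.prod_fintype _ _ (by simp)]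
  rfl

theorem polyOf_add (c c' : Mono σ D → F) : polyOf (fun e => c e + c' e) = polyOf c + polyOf c' := by
  simp [polyOf, Finset.sum_add_distrib]

theorem polyOf_smul (a : F) (c : Mono σ D → F) : polyOf (fun e => a * c e) = C a * polyOf c := by
  simp [polyOf, Finset.mul_sum, C_mul_monomial]

/-- A monomial of degree at most `D` is obtained by filling `D` slots with a variable or with
nothing, so there are no more of them than functions from `Fin D` to `Option σ`. -/
theorem card_mono_le : Fintype.card (Mono σ D) ≤ (Fintype.card σ + 1) ^ D := by
  classical
  have hs : Function.Surjective (fun g : Fin D → Option σ =>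
      (⟨fun s => ⟨(Finset.univ.filter fun i => g i = some s).card,
          Nat.lt_succ_of_le ((Finset.card_le_univ _).trans (by simp))⟩, by
        rw [← Finset.card_biUnion]
        · exact (Finset.card_le_univ _).trans (by simp)
        · intro s _ s' _ h
          simp only [Function.onFun, Finset.disjoint_left, Finset.mem_filter]
          rintro i ⟨_, hi⟩ ⟨_, hi'⟩
          exact h (Option.some_injective _ (hi.symm.trans hi'))⟩ : Mono σ D)) := by
    intro e
    -- Preimage of an exponent vector: its factors, counted with multiplicity, are placed
    -- injectively into the `D` slots, and the remaining slots stay empty.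
    have hcard : Fintype.card (Σ s, Fin (e.1 s : ℕ)) ≤ Fintype.card (Fin D) := by
      simpa using e.2
    obtain ⟨f⟩ := Function.Embedding.nonempty_of_card_le hcard
    refine ⟨fun i => if h : ∃ z, f z = i then some h.choose.1 else none, ?_⟩
    apply Subtype.ext
    funext s
    apply Fin.ext
    have : (Finset.univ.filter fun i => (if h : ∃ z, f z = i then some h.choose.1 else none)
        = some s) = Finset.univ.map ((Function.Embedding.sigmaMk s).trans f) := by
      ext i
      simp only [Finset.mem_filter, Finset.mem_univ, true_and, Finset.mem_map,
        Function.Embedding.trans_apply]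
      constructor
      · intro hi
        split_ifs at hi with h
        have hs := Option.some_injective _ hi
        have hz := h.choose_spec
        revert hs hz
        generalize h.choose = z
        rintro rfl hz
        exact ⟨z.2, hz⟩
      · rintro ⟨j, rfl⟩
        have h : ∃ z, f z = f ((Function.Embedding.sigmaMk s) j) := ⟨_, rfl⟩
        rw [dif_pos h, f.injective h.choose_spec]
        rfl
    simp only [this, Finset.card_map, Finset.card_univ, Fintype.card_fin]
  simpa using Fintype.card_le_of_surjective _ hs

end Degree

/-! ### Descent and composition -/

section Compose

variable {n d : ℕ} {F : Type*} [Field F]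

theorem totalDegree_desc_le (θ : Fin d → F) (P : MvPolynomial (Var n) F) :
    (desc θ P).totalDegree ≤ P.totalDegree := by
  exact (totalDegree_aeval_le_mul (m := 1) (fun s : Var n => ∑ j, C (θ j) * X (s, j))
    (fun s => totalDegree_finsetSum_le fun j _ =>
      (totalDegree_mul _ _).trans (by simp)) P).trans_eq (one_mul _)

/-- A preimage of a point under the descent substitution. -/
theorem exists_descent_point {θ : Fin d → F} (hθ : ∃ j, θ j ≠ 0) (x : Var n → F) :
    ∃ y : DVar n d → F, ∀ P, eval y (desc θ P) = eval x P := by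
  obtain ⟨j, hj⟩ := hθ
  -- One nonzero θ_j suffices: all of x_s is put into the coordinate belonging to it.
  refine ⟨fun sj => if sj.2 = j then x sj.1 / θ j else 0, fun P => ?_⟩
  induction P using MvPolynomial.induction_on with
  | C a => simp [desc]
  | add P Q hP hQ => simp [hP, hQ]
  | mul_X P s hP =>
    rw [map_mul, map_mul, hP, map_mul]
    simp [desc, mul_div_cancel₀ _ hj]

/-- Over an infinite field polynomials are functions, and every point is reached by the
substitution. -/
theorem desc_injective [Infinite F] {θ : Fin d → F} (hθ : ∃ j, θ j ≠ 0) :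
    Function.Injective (desc (n := n) θ) := by
  intro P Q h
  refine MvPolynomial.funext fun x => ?_
  obtain ⟨y, hy⟩ := exists_descent_point hθ x
  rw [← hy, ← hy, h]

variable {k : Type*} [Field k] [Fintype k] [Algebra k F]

/-- Both sides are additive and multiplicative in `P`. On constants they agree, and on variables
their equality is the hypothesis that `x` represents the conjugate of `z`. All values on the descent
are computed from values on `V` in this way. -/
theorem eval_map_desc {θ : Fin d → F} {a : ℕ} {x : DVar n d → F} {z : Var n → F}
    (h : ∀ s, ∑ j, x (s, j) * frob k a (θ j) = frob k a (z s)) (P : MvPolynomial (Var n) F) :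
    eval x (map (frob k a) (desc θ P)) = frob k a (eval z P) := by
  induction P using MvPolynomial.induction_on with
  | C a => simp [desc]
  | add P Q hP hQ => simp [hP, hQ]
  | mul_X P s hP =>
    rw [map_mul, map_mul, map_mul, hP, map_mul, map_mul, ← show _ = frob k a (eval z (X s)) from
      (h s).trans (by rw [eval_X])]
    simp [desc, mul_comm]

theorem eval_blockPoly (θ : Fin d → F) (H : Fin n → Fin 2 → MvPolynomial (Var n) F) {R : ℕ}
    (sh : Shape n R) (bs : sh.LVar) (x : Fin R × DVar n d → F) :
    eval x (blockPoly k θ H sh bs) = eval (fun s => x (sh.arg bs.1, s))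
      (map (frob k (sh.twist bs.1)) (desc θ (H (sh.pos bs.1) bs.2))) := by
  rw [blockPoly, eval_rename]
  rfl

theorem eval_compose (θ : Fin d → F) (H : Fin n → Fin 2 → MvPolynomial (Var n) F) {R : ℕ}
    {sh : Shape n R} (P : MvPolynomial sh.LVar F) (x : Fin R × DVar n d → F) :
    eval x (compose k θ H P) = eval (fun bs => eval x (blockPoly k θ H sh bs)) P := by
  rw [compose, ← aeval_eq_eval, ← aeval_eq_eval, aeval_bind₁]

/-- At a point of the descent the blocks are values of the twisted maps at points of `V`. -/
theorem exists_blockPoly_eq {sc : Scene n d F} {R : ℕ} {sh : Shape n R}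
    (ht : ∀ b, sh.twist b < d) {x : Fin R × DVar n d → F} (hx : x ∈ sc.dom k R)
    (b : Fin sh.arity) : ∃ z ∈ sc.V, ∀ (H : Fin n → Fin 2 → MvPolynomial (Var n) F) s,
      eval x (blockPoly k sc.θ H sh (b, s))
        = frob k (sh.twist b) (eval z (H (sh.pos b) s)) := by
  -- The point `z` is determined by argument and twist alone, so it serves both coordinates of the
  -- block and every `H`. The descent controls only the conjugates with exponent below `d`, hence
  -- the bound on the twist.
  obtain ⟨z, hz, h⟩ := hx (sh.arg b) (sh.twist b) (ht b)
  refine ⟨z, hz, fun H s => ?_⟩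
  rw [eval_blockPoly]
  exact eval_map_desc h _

theorem eval_compose_congr {sc : Scene n d F} {R : ℕ} {sh : Shape n R}
    (ht : ∀ b, sh.twist b < d) {H H' : Fin n → Fin 2 → MvPolynomial (Var n) F}
    (hH : SameOn sc.V H H') (P : MvPolynomial sh.LVar F) {x : Fin R × DVar n d → F}
    (hx : x ∈ sc.dom k R) : eval x (compose k sc.θ H P) = eval x (compose k sc.θ H' P) := by
  rw [eval_compose, eval_compose]
  congr 2
  funext bs
  obtain ⟨z, hz, h⟩ := exists_blockPoly_eq ht hx bs.1
  rw [h, h, hH z hz]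

theorem blockVal_congr {V : Set (Var n → F)} {H H' : Fin n → Fin 2 → MvPolynomial (Var n) F}
    (hH : SameOn V H H') {R : ℕ} (sh : Shape n R) {x : Fin R → Var n → F} (hx : ∀ r, x r ∈ V) :
    blockVal k H sh x = blockVal k H' sh x := by
  funext bs
  rw [blockVal, blockVal, hH _ (hx _)]

end Compose

section Vanishing

variable {F σ : Type*} [Field F] {X : Set (σ → F)}

theorem RegularOn.congr {D D' : MvPolynomial σ F} (hD : RegularOn X D)
    (h : ∀ x ∈ X, eval x D' = eval x D) : RegularOn X D' := by
  intro P hP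
  refine hD P fun x hx => ?_
  have := hP x hx
  rwa [map_mul, h x hx, ← map_mul] at this

end Vanishing

/-! ### Local polynomials -/

section Local

variable {F : Type*} [Field F] {n R : ℕ} {sh : Shape n R}

/-- The exponent vector of a monomial of bounded degree in each block. -/
def Shape.BMono.exp (e : sh.BMono) : sh.LVar →₀ ℕ :=
  Finsupp.equivFunOnFinite.symm fun bs => (e.1 bs.1 bs.2 : ℕ)

theorem Shape.BMono.exp_injective :
    Function.Injective (Shape.BMono.exp : sh.BMono → sh.LVar →₀ ℕ) := by
  intro e e' h
  apply Subtype.ext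
  funext b s
  exact Fin.ext (DFunLike.congr_fun h (b, s))

theorem eval_localPoly (c : sh.BMono → F) (z : sh.LVar → F) :
    eval z (localPoly c) = ∑ e : sh.BMono, c e * ∏ b, ∏ s, z (b, s) ^ (e.1 b s : ℕ) := by
  simp only [localPoly, map_sum, eval_monomial]
  refine Finset.sum_congr rfl fun e _ => ?_
  rw [Finsupp.prod_fintype _ _ (by simp), Fintype.prod_prod_type]
  rfl

theorem totalDegree_localPoly_le (c : sh.BMono → F) :
    (localPoly c).totalDegree ≤ ∑ b, sh.deg b := by
  refine totalDegree_finsetSum_le fun e _ => (totalDegree_monomial_le _ _).trans ?_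
  rw [Finsupp.sum_fintype _ _ (by simp), Fintype.sum_prod_type]
  exact Finset.sum_le_sum fun b _ => e.2 b

theorem localPoly_coeff {P : MvPolynomial sh.LVar F}
    (hP : ∀ m ∈ P.support, ∀ b, ∑ s, m (b, s) ≤ sh.deg b) :
    localPoly (fun e : sh.BMono => coeff e.exp P) = P := by
  ext m
  change coeff m (∑ e : sh.BMono, monomial e.exp (coeff e.exp P)) = _
  simp only [coeff_sum, coeff_monomial]
  by_cases hm : m ∈ P.support
  · have h : ∀ b s, m (b, s) < sh.deg b + 1 := fun b s =>
      Nat.lt_succ_of_le ((Finset.single_le_sum (f := fun s => m (b, s))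
        (fun _ _ => Nat.zero_le _) (Finset.mem_univ s)).trans (hP m hm b))
    let e : sh.BMono := ⟨fun b s => ⟨m (b, s), h b s⟩, hP m hm⟩
    have he : e.exp = m := by ext bs; rfl
    rw [Finset.sum_eq_single e]
    · rw [if_pos he, he]
    · intro e' _ h'
      rw [if_neg fun h'' => h' (Shape.BMono.exp_injective (h''.trans he.symm))]
    · simp
  · rw [notMem_support_iff.mp hm]
    refine Finset.sum_eq_zero fun e _ => ?_
    split_ifs with h
    · rw [h, notMem_support_iff.mp hm]
    · rfl

theorem localPoly_add (c c' : sh.BMono → F) :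
    localPoly (fun e => c e + c' e) = localPoly c + localPoly c' := by
  simp [localPoly, Finset.sum_add_distrib]

theorem localPoly_mul (a : F) (c : sh.BMono → F) :
    localPoly (fun e => a * c e) = C a * localPoly c := by
  simp [localPoly, Finset.mul_sum, C_mul_monomial]

/-- The coefficients of a polynomial in the two variables of one block. -/
def blockCoeff (sh : Shape n R) (b : Fin sh.arity) (P : MvPolynomial (Fin 2) F) : sh.BMono → F :=
  fun e => coeff e.exp (rename (Prod.mk b) P)

/-- The renamed polynomial has degree zero in all blocks other than `b`, so only the bound for block
`b` matters. -/
theorem localPoly_blockCoeff {b : Fin sh.arity} {P : MvPolynomial (Fin 2) F}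
    (hP : P.totalDegree ≤ sh.deg b) : localPoly (blockCoeff sh b P) = rename (Prod.mk b) P := by
  refine localPoly_coeff fun m hm b' => ?_
  have hinj : Function.Injective (Prod.mk b : Fin 2 → sh.LVar) := Prod.mk_right_injective b
  classical
  rw [support_rename_of_injective hinj, Finset.mem_image] at hm
  obtain ⟨m', hm', rfl⟩ := hm
  by_cases hb : b' = b
  · subst hb
    simp only [Finsupp.mapDomain_apply hinj]
    rw [← Finsupp.sum_fintype m' (fun _ x => x) (by simp)]
    exact (le_totalDegree hm').trans hP
  · rw [Finset.sum_eq_zero]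
    · exact Nat.zero_le _
    · intro s _
      rw [Finsupp.mapDomain_of_notMem_range]
      rintro ⟨s', hs'⟩
      exact hb (congrArg Prod.fst hs').symm

/-- Supplies a coordinate that really moves when `P` is added to a numerator. -/
theorem blockCoeff_ne_zero {b : Fin sh.arity} {P : MvPolynomial (Fin 2) F}
    (hP : P.totalDegree ≤ sh.deg b) (h0 : P ≠ 0) : ∃ e, blockCoeff sh b P e ≠ 0 := by
  by_contra! h
  have : localPoly (blockCoeff sh b P) = 0 := by simp [localPoly, h]
  rw [localPoly_blockCoeff hP] at this
  exact h0 (rename_injective _ (Prod.mk_right_injective b) (by simpa using this))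

theorem card_bmono_le {A D : ℕ} (hA : sh.arity ≤ A) (hD : ∀ b, sh.deg b ≤ D) :
    Fintype.card sh.BMono ≤ ((D + 1) ^ 2) ^ A := by
  refine (Fintype.card_subtype_le _).trans ?_
  rw [Fintype.card_pi]
  calc ∏ b, Fintype.card (Fin 2 → Fin (sh.deg b + 1)) ≤ ∏ _b : Fin sh.arity, (D + 1) ^ 2 :=
        Finset.prod_le_prod' fun b _ => by
          simpa using Nat.pow_le_pow_left (Nat.succ_le_succ (hD b)) 2
    _ ≤ ((D + 1) ^ 2) ^ A := by
        simpa using Nat.pow_le_pow_right (by positivity) hA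

end Local

/-! ### Basic blinding maps -/

section Params

variable {n : ℕ} {F : Type*} [Field F]

/-- The map `λ_{p_i,q_i}`, over any algebra. -/
def lamMid {R : Type*} [CommRing R] [Algebra F R] (c : ParIdx n → F) (i : Fin n)
    (a : Fin 3 → R) : Fin 3 → R :=
  ![a 0,
    a 1 + (parp c i 0 • 1 + parp c i 1 • a 0 + parp c i 2 • a 0 ^ 2),
    a 2 + (parq c i 0 • 1 + parq c i 1 • a 0 + parq c i 2 • a 1 + parq c i 3 • a 0 ^ 2
      + parq c i 4 • (a 0 * a 1) + parq c i 5 • a 1 ^ 2)]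

theorem lam_eq {R : Type*} [CommRing R] [Algebra F R] (c : ParIdx n → F) (i : Fin n)
    (x : Fin 3 → R) (r : Fin 3) :
    lam c i x r = ∑ t, parB c i r t • lamMid c i (fun r => ∑ t, parA c i r t • x t) t := rfl

/-- `lam` uses only algebra operations with scalars in `F`. Applied to an evaluation, this
identifies the values of `quad3` with those of the map on points. -/
theorem lam_algHom {R S : Type*} [CommRing R] [Algebra F R] [CommRing S] [Algebra F S]
    (f : R →ₐ[F] S) (c : ParIdx n → F) (i : Fin n) (x : Fin 3 → R) (r : Fin 3) :
    f (lam c i x r) = lam c i (fun t => f (x t)) r := by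
  rw [lam_eq, lam_eq, map_sum]
  refine Finset.sum_congr rfl fun t _ => ?_
  rw [map_smul]
  congr 1
  fin_cases t <;> simp [lamMid]

theorem eval_quad3 (c : ParIdx n → F) (i : Fin n) (r : Fin 3) (x : Var n → F) :
    eval x (quad3 c i r) = lam c i (fun t => ∑ s, parδ c (i, t) s * x s) r := by
  rw [quad3, ← aeval_eq_eval]
  exact (lam_algHom (aeval x) c i _ r).trans (by simp)

theorem mulVec_bijective {m : Type*} [Fintype m] [DecidableEq m] {A : Matrix m m F}
    (hA : A.det ≠ 0) : Function.Bijective A.mulVec := by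
  have hu : IsUnit A := (Matrix.isUnit_iff_isUnit_det A).mpr (isUnit_iff_ne_zero.mpr hA)
  exact ⟨Matrix.mulVec_injective_iff_isUnit.mpr hu, Matrix.mulVec_surjective_iff_isUnit.mpr hu⟩

/-- The map is triangular: each coordinate is itself plus a function of the preceding ones, so the
coordinates can be recovered in order. -/
theorem lamMid_bijective (c : ParIdx n → F) (i : Fin n) :
    Function.Bijective (lamMid c i : (Fin 3 → F) → Fin 3 → F) := by
  constructor
  · intro a a' h
    have h0 : a 0 = a' 0 := congrFun h 0
    have h1 := congrFun h 1
    have h2 := congrFun h 2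
    simp only [lamMid, Matrix.cons_val_one, Matrix.cons_val_zero, Matrix.cons_val, h0,
      add_left_inj] at h1 h2
    rw [h1, add_left_inj] at h2
    funext r
    fin_cases r
    exacts [h0, h1, h2]
  · intro b
    let a1 := b 1 - (parp c i 0 • 1 + parp c i 1 • b 0 + parp c i 2 • b 0 ^ 2)
    refine ⟨![b 0, a1, b 2 - (parq c i 0 • 1 + parq c i 1 • b 0 + parq c i 2 • a1
      + parq c i 3 • b 0 ^ 2 + parq c i 4 • (b 0 * a1) + parq c i 5 • a1 ^ 2)], ?_⟩
    funext r
    fin_cases r <;> simp [lamMid, a1]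

theorem lam_bijective {c : ParIdx n → F} (hc : ValidPar c) (i : Fin n) :
    Function.Bijective (lam c i : (Fin 3 → F) → Fin 3 → F) :=
  ((mulVec_bijective (hc.2 i).2.1).comp (lamMid_bijective c i)).comp
    (mulVec_bijective (hc.2 i).1)

/-- The polynomials `F_{ij}` define a bijection of affine space. -/
theorem quad3_bijective {c : ParIdx n → F} (hc : ValidPar c) :
    Function.Bijective fun (x : Var n → F) (i : Fin n) (r : Fin 3) => eval x (quad3 c i r) := by
  have hδ := mulVec_bijective hc.1
  have hq : ∀ (x : Var n → F) i r, eval x (quad3 c i r)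
      = lam c i (fun t => (parδ c).mulVec x (i, t)) r := fun x i r => eval_quad3 c i r x
  constructor
  · intro x x' h
    refine hδ.1 (funext fun it => ?_)
    have hi : lam c it.1 (fun t => (parδ c).mulVec x (it.1, t))
        = lam c it.1 (fun t => (parδ c).mulVec x' (it.1, t)) := by
      funext r
      rw [← hq, ← hq]
      exact congrFun (congrFun h it.1) r
    exact congrFun ((lam_bijective hc it.1).1 hi) it.2
  · intro u
    choose w hw using fun i => (lam_bijective hc i).2 (u i)
    obtain ⟨x, hx⟩ := hδ.2 fun it => w it.1 it.2
    refine ⟨x, funext fun i => funext fun r => ?_⟩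
    change eval x (quad3 c i r) = u i r
    rw [hq, hx, hw]

theorem totalDegree_quad3_le (c : ParIdx n → F) (i : Fin n) (r : Fin 3) :
    (quad3 c i r).totalDegree ≤ 2 := by
  have hadd : ∀ {P Q : MvPolynomial (Var n) F} {m : ℕ}, P.totalDegree ≤ m → Q.totalDegree ≤ m →
      (P + Q).totalDegree ≤ m := fun hP hQ => (totalDegree_add _ _).trans (max_le hP hQ)
  have hsmul : ∀ {P : MvPolynomial (Var n) F} {m : ℕ} (a : F), P.totalDegree ≤ m →
      (a • P).totalDegree ≤ m := fun a hP => (totalDegree_smul_le a _).trans hP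
  let y : Fin 3 → MvPolynomial (Var n) F := fun t =>
    ∑ u, parA c i t u • ∑ s, parδ c (i, u) s • X s
  -- The entries of A_i ∘ δ_i are linear forms, and the remaining part of `lam` is at most quadratic
  -- in them.
  have hy : ∀ t, (y t).totalDegree ≤ 1 := fun t => totalDegree_finsetSum_le fun u _ =>
    hsmul _ (totalDegree_finsetSum_le fun s _ => hsmul _ (totalDegree_X s).le)
  have hy' : ∀ t, (y t).totalDegree ≤ 2 := fun t => (hy t).trans one_le_two
  have hm : ∀ t u, (y t * y u).totalDegree ≤ 2 := fun t u =>
    (totalDegree_mul _ _).trans (Nat.add_le_add (hy t) (hy u))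
  have hs : ∀ t, (y t ^ 2).totalDegree ≤ 2 := fun t => by rw [pow_two]; exact hm t t
  have h1 : (1 : MvPolynomial (Var n) F).totalDegree ≤ 2 := by simp
  refine totalDegree_finsetSum_le fun t _ => hsmul _ ?_
  change (lamMid c i y t).totalDegree ≤ 2
  fin_cases t
  · exact hy' 0
  · exact hadd (hy' 1) (hadd (hadd (hsmul _ h1) (hsmul _ (hy' 0))) (hsmul _ (hs 0)))
  · exact hadd (hy' 2) (hadd (hadd (hadd (hadd (hadd (hsmul _ h1) (hsmul _ (hy' 0)))
      (hsmul _ (hy' 1))) (hsmul _ (hs 0))) (hsmul _ (hm 0 1))) (hsmul _ (hs 1)))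

/-- A semilinear evaluation of the quadratic polynomials is a polynomial in the parameters. -/
theorem polyFun_quad3 (G : MvPolynomial (Var n) F →+* F) {m : ℕ} (hG : ∀ a, G (C a) = a ^ m)
    (i : Fin n) (r : Fin 3) : PolyFun (fun c : ParIdx n → F => c) fun c => G (quad3 c i r) := by
  have hsmul : ∀ (e : ParIdx n) {P : (ParIdx n → F) → MvPolynomial (Var n) F},
      PolyFun (fun c : ParIdx n → F => c) (fun c => G (P c)) →
      PolyFun (fun c : ParIdx n → F => c) fun c => G (c e • P c) := by
    intro e P hP
    -- A parameter leaves `G` as its `m`-th power, so a Frobenius twist does not destroy polynomial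
    -- dependence.
    simp only [smul_eq_C_mul, map_mul, hG]
    exact ((PolyFun.coord (t := fun c : ParIdx n → F => c) e).pow m).mul hP
  have hadd : ∀ {P Q : (ParIdx n → F) → MvPolynomial (Var n) F},
      PolyFun (fun c : ParIdx n → F => c) (fun c => G (P c)) →
      PolyFun (fun c : ParIdx n → F => c) (fun c => G (Q c)) →
      PolyFun (fun c : ParIdx n → F => c) fun c => G (P c + Q c) := by
    intro P Q hP hQ
    simp only [map_add]
    exact hP.add hQ
  have hmul : ∀ {P Q : (ParIdx n → F) → MvPolynomial (Var n) F},
      PolyFun (fun c : ParIdx n → F => c) (fun c => G (P c)) →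
      PolyFun (fun c : ParIdx n → F => c) (fun c => G (Q c)) →
      PolyFun (fun c : ParIdx n → F => c) fun c => G (P c * Q c) := by
    intro P Q hP hQ
    simp only [map_mul]
    exact hP.mul hQ
  have hsum : ∀ {κ : Type} [Fintype κ] {P : κ → (ParIdx n → F) → MvPolynomial (Var n) F},
      (∀ j, PolyFun (fun c : ParIdx n → F => c) fun c => G (P j c)) →
      PolyFun (fun c : ParIdx n → F => c) fun c => G (∑ j, P j c) := by
    intro κ _ P hP
    simp only [map_sum]
    exact PolyFun.sum _ fun j _ => hP j
  have hconst : ∀ P, PolyFun (fun c : ParIdx n → F => c) fun _ => G P := fun P => PolyFun.const _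
  let y : Fin 3 → (ParIdx n → F) → MvPolynomial (Var n) F := fun t c =>
    ∑ u, parA c i t u • ∑ s, parδ c (i, u) s • X s
  have hy : ∀ t, PolyFun (fun c : ParIdx n → F => c) fun c => G (y t c) := fun t =>
    hsum fun u => hsmul _ (hsum fun s => hsmul _ (hconst _))
  have hs : ∀ t, PolyFun (fun c : ParIdx n → F => c) fun c => G (y t c ^ 2) := fun t => by
    simp only [pow_two]
    exact hmul (hy t) (hy t)
  refine hsum (κ := Fin 3) fun t => hsmul _ ?_
  change PolyFun _ fun c => G (lamMid c i (fun t => y t c) t)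
  fin_cases t
  · exact hy 0
  · exact hadd (hy 1) (hadd (hadd (hsmul _ (hconst _)) (hsmul _ (hy 0))) (hsmul _ (hs 0)))
  · exact hadd (hy 2) (hadd (hadd (hadd (hadd (hadd (hsmul _ (hconst _)) (hsmul _ (hy 0)))
      (hsmul _ (hy 1))) (hsmul _ (hs 0))) (hsmul _ (hmul (hy 0) (hy 1)))) (hsmul _ (hs 1)))

/-! ### Scaling of the blinding parameters -/

/-- Scaling of the components of `ρ` by means of the matrices `B_i`. -/
def scalePar (D : Fin n → Fin 2 → Fˣ) (c : ParIdx n → F) : ParIdx n → F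
  | .inr (i, .inr (.inl (r, t'))) =>
      ((![D i 0, D i 1, D i 1] r : Fˣ) : F) * c (.inr (i, .inr (.inl (r, t'))))
  | t => c t

theorem parB_scalePar (D : Fin n → Fin 2 → Fˣ) (c : ParIdx n → F) (i : Fin n) (r t : Fin 3) :
    parB (scalePar D c) i r t = ((![D i 0, D i 1, D i 1] r : Fˣ) : F) * parB c i r t := rfl

theorem quad3_scalePar (D : Fin n → Fin 2 → Fˣ) (c : ParIdx n → F) (i : Fin n) (r : Fin 3) :
    quad3 (scalePar D c) i r = C ((![D i 0, D i 1, D i 1] r : Fˣ) : F) * quad3 c i r := by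
  rw [quad3, quad3, lam_eq, lam_eq, ← smul_eq_C_mul, Finset.smul_sum]
  refine Finset.sum_congr rfl fun t _ => ?_
  rw [parB_scalePar, mul_smul]
  rfl

theorem quad_scalePar (D : Fin n → Fin 2 → Fˣ) (c : ParIdx n → F) (i : Fin n) (s : Fin 2) :
    quad (scalePar D c) i s = C (D i s : F) * quad c i s := by
  rw [quad, quad3_scalePar]
  fin_cases s <;> rfl

theorem validPar_scalePar (D : Fin n → Fin 2 → Fˣ) {c : ParIdx n → F} (hc : ValidPar c) :
    ValidPar (scalePar D c) := by
  refine ⟨hc.1, fun i => ⟨(hc.2 i).1, ?_, (hc.2 i).2.2⟩⟩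
  have h : parB (scalePar D c) i
      = Matrix.diagonal (fun r => ((![D i 0, D i 1, D i 1] r : Fˣ) : F)) * parB c i := by
    ext r t
    rw [Matrix.diagonal_mul, parB_scalePar]
  rw [h, Matrix.det_mul, Matrix.det_diagonal]
  exact mul_ne_zero (Finset.prod_ne_zero_iff.mpr fun r _ => Units.ne_zero _) (hc.2 i).2.1

/-- The second and third rows of `B_i` receive the same factor `D i 1`, so F_{i2} - F_{i3} is only
multiplied by a unit. -/
theorem space_scalePar (D : Fin n → Fin 2 → Fˣ) (c : ParIdx n → F) :
    space (scalePar D c) = space c := by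
  ext x
  refine forall_congr' fun i => ?_
  rw [quad3_scalePar, quad3_scalePar, map_mul, map_mul, eval_C, eval_C]
  exact mul_right_inj' (Units.ne_zero (D i 1))

/-! ### Shears that do not change the blinding map -/

/-- The third row of `A_i` is changed by a multiple of the first one, and the
coefficient of `x` in `q_i` by its negative. -/
def shearPar (c : ParIdx n → F) (t : Fin n → F) : ParIdx n → F
  | .inr (i, .inl (r, u)) =>
      c (.inr (i, .inl (r, u))) + if r = 2 then t i * c (.inr (i, .inl (0, u))) else 0
  | .inr (i, .inr (.inr (.inr r))) =>
      c (.inr (i, .inr (.inr (.inr r)))) - if r = 1 then t i else 0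
  | e => c e

theorem parA_shearPar (c : ParIdx n → F) (t : Fin n → F) (i : Fin n) (r u : Fin 3) :
    parA (shearPar c t) i r u = parA c i r u + if r = 2 then t i * parA c i 0 u else 0 := rfl

theorem parq_shearPar (c : ParIdx n → F) (t : Fin n → F) (i : Fin n) (r : Fin 6) :
    parq (shearPar c t) i r = parq c i r - if r = 1 then t i else 0 := rfl

/-- Only the third coordinate is affected. There the new row of `A_i` contributes an additional `t
i` times the first coordinate, and the linear term of `q_i` loses exactly this. -/
theorem lam_shearPar {R : Type*} [CommRing R] [Algebra F R] (c : ParIdx n → F) (t : Fin n → F)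
    (i : Fin n) (x : Fin 3 → R) : lam (shearPar c t) i x = lam c i x := by
  have h : lamMid (shearPar c t) i (fun r => ∑ u, parA (shearPar c t) i r u • x u)
      = lamMid c i (fun r => ∑ u, parA c i r u • x u) := by
    have hp : parp (shearPar c t) i = parp c i := rfl
    funext r
    fin_cases r
    · simp [lamMid, parA_shearPar]
    · simp [lamMid, parA_shearPar, hp]
    · simp only [lamMid, parA_shearPar, parq_shearPar, hp, Fin.sum_univ_three, Algebra.smul_def]
      simp
      ring_nf
  funext r
  rw [lam_eq, lam_eq, h]
  rfl

theorem quad3_shearPar (c : ParIdx n → F) (t : Fin n → F) (i : Fin n) (r : Fin 3) :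
    quad3 (shearPar c t) i r = quad3 c i r := by
  rw [quad3, lam_shearPar]
  rfl

/-- The shear acts on `A_i` by a row operation of determinant one and leaves the quadratic
coefficients of `q_i` alone. -/
theorem validPar_shearPar {c : ParIdx n → F} (hc : ValidPar c) (t : Fin n → F) :
    ValidPar (shearPar c t) := by
  refine ⟨hc.1, fun i => ⟨?_, (hc.2 i).2.1, (hc.2 i).2.2.1, ?_⟩⟩
  · have h := (hc.2 i).1
    rw [Matrix.det_fin_three] at h ⊢
    simp only [parA_shearPar]
    simp
    convert h using 1
    ring_nf
  · simpa [parq_shearPar] using (hc.2 i).2.2.2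

theorem space_shearPar (c : ParIdx n → F) (t : Fin n → F) : space (shearPar c t) = space c := by
  simp only [space, quad3_shearPar]

/-! ### The differences of the second and third components -/

/-- The polynomial `F_{i2} - F_{i3}`. -/
def quadDiff (c : ParIdx n → F) (i : Fin n) : MvPolynomial (Var n) F :=
  quad3 c i 1 - quad3 c i 2

theorem eval_quadDiff {c : ParIdx n → F} {x : Var n → F} (hx : x ∈ space c) (i : Fin n) :
    eval x (quadDiff c i) = 0 := by
  rw [quadDiff, map_sub, hx i, sub_self]

theorem totalDegree_quadDiff_le (c : ParIdx n → F) (i : Fin n) :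
    (quadDiff c i).totalDegree ≤ 2 :=
  (totalDegree_sub _ _).trans (max_le (totalDegree_quad3_le c i 1) (totalDegree_quad3_le c i 2))

/-- By bijectivity there is a point at which F_{i2} is 1 and every other F_{i'r} is 0. There a
linear relation reduces to its `i`-th coefficient. -/
theorem linearIndependent_quadDiff {c : ParIdx n → F} (hc : ValidPar c) :
    LinearIndependent F (quadDiff c) := by
  rw [Fintype.linearIndependent_iff]
  intro g hg i
  obtain ⟨x, hx⟩ := (quad3_bijective hc).2 fun i' r => if i' = i ∧ r = 1 then 1 else 0
  have h := congrArg (eval x) hg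
  have hx' : ∀ i' r, eval x (quad3 c i' r) = if i' = i ∧ r = 1 then 1 else 0 := fun i' r =>
    congrFun (congrFun hx i') r
  simpa [quadDiff, hx', smul_eval] using h

end Params

/-! ### Decompositions of systems -/

section Polynomials

variable {F σ τ : Type*} [Field F]

theorem eval_aeval_eq_polyMap (φ : σ → MvPolynomial τ F) (t : τ → F) (P : MvPolynomial σ F) :
    eval t (aeval φ P) = eval (polyMap φ t) P := by
  change eval t (bind₁ φ P) = _
  rw [← aeval_eq_eval, ← aeval_eq_eval, aeval_bind₁]
  rfl

/-- A set that contains a retract of affine space has at least the dimension of that space. -/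
theorem le_zdim [Infinite F] [Fintype τ] {V : Set (σ → F)} (φ : σ → MvPolynomial τ F)
    (ψ : τ → MvPolynomial σ F) (hψ : ∀ t, polyMap ψ (polyMap φ t) = t)
    (hV : ∀ t, polyMap φ t ∈ V) : (Fintype.card τ : WithBot ℕ∞) ≤ zdim V := by
  have h0 : ∀ P ∈ vanishingIdeal F V, (aeval φ : _ →ₐ[F] MvPolynomial τ F).toRingHom P = 0 := by
    intro P hP
    refine MvPolynomial.funext fun t => ?_
    change eval t (aeval φ P) = _
    rw [eval_aeval_eq_polyMap, map_zero, ← aeval_eq_eval]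
    exact mem_vanishingIdeal_iff.mp hP _ (hV t)
  -- Pull-back along `φ` factors through the coordinate ring of `V`. The left inverse `ψ` makes it
  -- surjective onto the polynomial ring in `τ`, whose Krull dimension is the number of variables.
  have hsurj : Function.Surjective
      (Ideal.Quotient.lift (vanishingIdeal F V) (aeval φ).toRingHom h0) := by
    intro Q
    refine ⟨Ideal.Quotient.mk _ (aeval ψ Q), MvPolynomial.funext fun t => ?_⟩
    rw [Ideal.Quotient.lift_mk]
    change eval t (aeval φ (aeval ψ Q)) = _
    rw [eval_aeval_eq_polyMap, eval_aeval_eq_polyMap, hψ]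
  refine le_trans ?_ (ringKrullDim_le_of_surjective _ hsurj)
  rw [MvPolynomial.ringKrullDim_of_isNoetherianRing, ringKrullDim_eq_zero_of_field, zero_add,
    Nat.card_eq_fintype_card]

end Polynomials

/-- The properties of a presentation of the blinding maps on which triple confusion rests: scaling
acts, each presentation lies in a family of presentations of the same map that is
parametrized by an affine space, and values depend polynomially on the coordinates. -/
structure Presentation.Lawful (k : Type*) {n d : ℕ} {F : Type*} [Field k] [Fintype k] [Field F]
    [Algebra k F] (sc : Scene n d F) (M : Presentation n F) (τ : Type) : Prop where
  tilde_injective : Function.Injective M.tilde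
  act_one : ∀ c, M.act 1 c = c
  act_mul : ∀ D D' c, M.act (D * D') c = M.act D (M.act D' c)
  act_mem : ∀ D, ∀ c ∈ M.adm, M.act D c ∈ M.adm
  act_maps : ∀ D c i s, M.maps (M.act D c) i s = C (D i s : F) * M.maps c i s
  family : ∀ c ∈ M.adm, ∃ (φ : M.B' → MvPolynomial τ F) (ψ : τ → MvPolynomial M.B' F),
    (∀ t, polyMap ψ (polyMap φ t) = t) ∧ polyMap φ 0 = M.tilde c ∧
    ∀ t, ∃ c' ∈ M.adm, polyMap φ t = M.tilde c' ∧ SameOn sc.W (M.maps c') (M.maps c)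
  totalDegree_maps_le : ∀ c i s, (M.maps c i s).totalDegree ≤ 2
  polyFun_eval : ∀ a x i s, PolyFun M.tilde fun c => frob k a (eval x (M.maps c i s))
  polyFun_eval_desc : ∀ a x i s,
    PolyFun M.tilde fun c => eval x (map (frob k a) (desc sc.θ (M.maps c i s)))

section Systems

variable {n d : ℕ} {F : Type*} [Field F] {Y : SysType n}
variable {k : Type*} [Field k] [Fintype k] [Algebra k F]
variable {sc : Scene n d F} {M : Presentation n F} {S : SemiSys n d F Y}

/-- The common transfer principle for the three kinds of confusion. The conditions see only values
on the descent and on the graphs, and a factor `c i s` common to the numerator of a local map and to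
the output does no harm. Changes of presentation use `c = 1`, scaling uses the twisted diagonal
matrix. -/
theorem IsDecomp.congr {h h' : LocIdx Y → F} {H H' : Fin n → Fin 2 → MvPolynomial (Var n) F}
    (hD : IsDecomp Y k sc S h H)
    (hf : ∀ f b, ∀ x ∈ sc.dom k (Y.fArgs f),
      eval x (compose k sc.θ H' (fLoc Y h' f b)) = eval x (compose k sc.θ H (fLoc Y h f b)))
    (c : Fin n → Fin 2 → F)
    (hm₀ : ∀ q, ∀ xy ∈ S.graph q, ∀ i s,
      eval (blockVal k H' (Y.mShape q i s) xy.1) (mLoc Y h' q i s false)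
        = eval (blockVal k H (Y.mShape q i s) xy.1) (mLoc Y h q i s false))
    (hm₁ : ∀ q, ∀ xy ∈ S.graph q, ∀ i s,
      eval (blockVal k H' (Y.mShape q i s) xy.1) (mLoc Y h' q i s true)
        = c i s * eval (blockVal k H (Y.mShape q i s) xy.1) (mLoc Y h q i s true))
    (ho : ∀ q, ∀ xy ∈ S.graph q, ∀ i s, frob k (Y.outTwist i) (eval xy.2 (H' i s))
        = c i s * frob k (Y.outTwist i) (eval xy.2 (H i s))) :
    IsDecomp Y k sc S h' H' := by
  refine ⟨fun f => ⟨(hD.1 f).1.congr (hf f false), fun x hx => ?_⟩, fun q xy hxy i s => ?_⟩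
  · have := (hD.1 f).2 x hx
    rw [map_sub, map_mul, map_mul] at this ⊢
    rwa [hf f true x hx, hf f false x hx]
  · rw [hm₀ q xy hxy, hm₁ q xy hxy, ho q xy hxy]
    refine ⟨(hD.2 q xy hxy i s).1, ?_⟩
    rw [(hD.2 q xy hxy i s).2]
    ring

/-- Decompositions depend only on the values of the blinding map. -/
theorem IsDecomp.of_sameOn (ht : ∀ f b, (Y.fShape f).twist b < d) (hVW : sc.V ⊆ sc.W)
    (hS : ∀ q, ∀ xy ∈ S.graph q, (∀ r, xy.1 r ∈ sc.V) ∧ xy.2 ∈ sc.W) {h : LocIdx Y → F}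
    {H H' : Fin n → Fin 2 → MvPolynomial (Var n) F} (hD : IsDecomp Y k sc S h H)
    (hH : SameOn sc.W H' H) : IsDecomp Y k sc S h H' := by
  have hV : SameOn sc.V H' H := fun x hx => hH x (hVW hx)
  refine hD.congr (fun f b x hx => eval_compose_congr (ht f) hV _ hx) 1 ?_ ?_ ?_
  · intro q xy hxy i s
    rw [blockVal_congr hV _ (hS q xy hxy).1]
  · intro q xy hxy i s
    rw [blockVal_congr hV _ (hS q xy hxy).1, Pi.one_apply, Pi.one_apply, one_mul]
  · intro q xy hxy i s
    rw [hH _ (hS q xy hxy).2, Pi.one_apply, Pi.one_apply, one_mul]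

/-- A vector of coefficients of numerators. -/
def numCoeffs (g : (f : Y.Fun) → (Y.fShape f).BMono → F)
    (g' : (c : Y.Map × Fin n × Fin 2) → (Y.mShape c.1 c.2.1 c.2.2).BMono → F) : LocIdx Y → F
  | .inl e => if e.2.1 then g e.1 e.2.2 else 0
  | .inr e => if e.2.1 then g' e.1 e.2.2 else 0

/-- Numerators may be changed by local polynomials that vanish on the
image of the blinding map. -/
theorem IsDecomp.add_numCoeffs
    (hS : ∀ q, ∀ xy ∈ S.graph q, (∀ r, xy.1 r ∈ sc.V) ∧ xy.2 ∈ sc.W) {h : LocIdx Y → F}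
    {H : Fin n → Fin 2 → MvPolynomial (Var n) F} (hD : IsDecomp Y k sc S h H)
    {g : (f : Y.Fun) → (Y.fShape f).BMono → F}
    {g' : (c : Y.Map × Fin n × Fin 2) → (Y.mShape c.1 c.2.1 c.2.2).BMono → F}
    (hg : ∀ f, VanishesOn (sc.dom k (Y.fArgs f)) (compose k sc.θ H (localPoly (g f))))
    (hg' : ∀ c : Y.Map × Fin n × Fin 2, ∀ x, (∀ r, x r ∈ sc.V) →
      eval (blockVal k H (Y.mShape c.1 c.2.1 c.2.2) x) (localPoly (g' c)) = 0) (t : F) :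
    IsDecomp Y k sc S (fun e => h e + t * numCoeffs g g' e) H := by
  have h₁ : ∀ f, fLoc Y (fun e => h e + t * numCoeffs g g' e) f true
      = fLoc Y h f true + C t * localPoly (g f) := by
    intro f
    simp [fLoc, numCoeffs, localPoly_add, localPoly_mul]
  have h₀ : ∀ f, fLoc Y (fun e => h e + t * numCoeffs g g' e) f false = fLoc Y h f false := by
    intro f
    simp [fLoc, numCoeffs]
  have h₁' : ∀ q i s, mLoc Y (fun e => h e + t * numCoeffs g g' e) q i s true
      = mLoc Y h q i s true + C t * localPoly (g' (q, i, s)) := by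
    intro q i s
    simp [mLoc, numCoeffs, localPoly_add, localPoly_mul]
  have h₀' : ∀ q i s, mLoc Y (fun e => h e + t * numCoeffs g g' e) q i s false
      = mLoc Y h q i s false := by
    intro q i s
    simp [mLoc, numCoeffs]
  refine hD.congr ?_ 1 ?_ ?_ ?_
  · intro f b x hx
    cases b
    · rw [h₀]
    · have := hg f x hx
      rw [eval_compose] at this
      rw [h₁, eval_compose, eval_compose, map_add, map_mul, this, mul_zero, add_zero]
  · intro q xy _ i s
    rw [h₀']
  · intro q xy hxy i s
    have := hg' (q, i, s) xy.1 (hS q xy hxy).1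
    rw [h₁', map_add, map_mul, this, mul_zero, add_zero, Pi.one_apply, Pi.one_apply, one_mul]
  · intro q xy _ i s
    rw [Pi.one_apply, Pi.one_apply, one_mul]

/-! ### Scaling -/

theorem scaleFactor_one {R : ℕ} (sh : Shape n R) (e : sh.BMono) :
    scaleFactor k (1 : Fin n → Fin 2 → Fˣ) sh e = 1 := by
  simp [scaleFactor]

theorem scaleFactor_mul (D D' : Fin n → Fin 2 → Fˣ) {R : ℕ} (sh : Shape n R) (e : sh.BMono) :
    scaleFactor k (D * D') sh e = scaleFactor k D sh e * scaleFactor k D' sh e := by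
  simp only [scaleFactor, ← Finset.prod_mul_distrib]
  refine Finset.prod_congr rfl fun b _ => Finset.prod_congr rfl fun s _ => ?_
  rw [Pi.mul_apply, Pi.mul_apply, mul_inv, Units.val_mul, map_mul, mul_pow]

/-- The scale factors contain the inverses of the twisted entries of `D`, which cancel against the
scaled arguments monomial by monomial. -/
theorem eval_localPoly_scale (D : Fin n → Fin 2 → Fˣ) {R : ℕ} {sh : Shape n R}
    (c : sh.BMono → F) (z : sh.LVar → F) :
    eval (fun bs => frob k (sh.twist bs.1) (D (sh.pos bs.1) bs.2 : F) * z bs)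
      (localPoly fun e => scaleFactor k D sh e * c e) = eval z (localPoly c) := by
  rw [eval_localPoly, eval_localPoly]
  refine Finset.sum_congr rfl fun e _ => ?_
  rw [mul_comm (scaleFactor k D sh e), mul_assoc, scaleFactor]
  simp only [← Finset.prod_mul_distrib]
  congr 1
  refine Finset.prod_congr rfl fun b _ => Finset.prod_congr rfl fun s _ => ?_
  rw [mul_pow, ← mul_assoc, ← mul_pow, ← map_mul, Units.inv_mul, map_one, one_pow, one_mul]

theorem fLoc_actS (D : Fin n → Fin 2 → Fˣ) (v : LocIdx Y ⊕ M.B → F) (f : Y.Fun) (b : Bool) :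
    fLoc Y (actS Y k M D v ∘ Sum.inl) f b
      = localPoly fun e => scaleFactor k D (Y.fShape f) e * v (.inl (.inl ⟨f, b, e⟩)) := rfl

theorem mLoc_actS_false (D : Fin n → Fin 2 → Fˣ) (v : LocIdx Y ⊕ M.B → F) (q : Y.Map)
    (i : Fin n) (s : Fin 2) : mLoc Y (actS Y k M D v ∘ Sum.inl) q i s false
      = localPoly fun e => scaleFactor k D (Y.mShape q i s) e
          * v (.inl (.inr ⟨(q, i, s), false, e⟩)) := by
  simp [mLoc, actS]

theorem mLoc_actS_true (D : Fin n → Fin 2 → Fˣ) (v : LocIdx Y ⊕ M.B → F) (q : Y.Map)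
    (i : Fin n) (s : Fin 2) : mLoc Y (actS Y k M D v ∘ Sum.inl) q i s true
      = C (frob k (Y.outTwist i) (D i s : F)) * localPoly fun e =>
          scaleFactor k D (Y.mShape q i s) e * v (.inl (.inr ⟨(q, i, s), true, e⟩)) := by
  rw [← localPoly_mul]
  simp [mLoc, actS, mul_assoc]

theorem actS_mem_VS {τ : Type} (hM : M.Lawful k sc τ) (D : Fin n → Fin 2 → Fˣ)
    {v : LocIdx Y ⊕ M.B → F} (hv : v ∈ VS Y k sc M S) : actS Y k M D v ∈ VS Y k sc M S := by
  have hmaps : ∀ i s, mapsS Y M (actS Y k M D v) i s = C (D i s : F) * mapsS Y M v i s :=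
    hM.act_maps D (v ∘ Sum.inr)
  have hblock : ∀ (R : ℕ) (sh : Shape n R) (x : Fin R → Var n → F),
      blockVal k (mapsS Y M (actS Y k M D v)) sh x = fun bs =>
        frob k (sh.twist bs.1) (D (sh.pos bs.1) bs.2 : F) * blockVal k (mapsS Y M v) sh x bs := by
    intro R sh x
    funext bs
    rw [blockVal, hmaps, map_mul, eval_C, map_mul]
    rfl
  -- The coordinate `(i, s)` of τ ∘ ρ ∘ Φ is multiplied by the twisted entry `D i s`. The action
  -- multiplies the numerator of the local map by the same factor, so the equation for Φ persists.
  refine ⟨hM.act_mem D _ hv.1, hv.2.congr ?_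
    (fun i s => frob k (Y.outTwist i) (D i s : F)) ?_ ?_ ?_⟩
  · intro f b x _
    rw [eval_compose, eval_compose]
    have : (fun bs => eval x (blockPoly k sc.θ (mapsS Y M (actS Y k M D v)) (Y.fShape f) bs))
        = fun bs => frob k ((Y.fShape f).twist bs.1) (D ((Y.fShape f).pos bs.1) bs.2 : F)
          * eval x (blockPoly k sc.θ (mapsS Y M v) (Y.fShape f) bs) := by
      funext bs
      rw [eval_blockPoly, eval_blockPoly, hmaps, map_mul, map_mul, map_mul]
      congr 1
      simp [desc]
    rw [this, fLoc_actS, eval_localPoly_scale]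
    rfl
  · intro q xy _ i s
    rw [hblock, mLoc_actS_false, eval_localPoly_scale]
    rfl
  · intro q xy _ i s
    rw [hblock, mLoc_actS_true, map_mul, eval_C, eval_localPoly_scale]
    rfl
  · intro q xy _ i s
    rw [hmaps, map_mul, eval_C, map_mul]

/-! ### Triple confusion -/

/-- The local part is held constant while the blinding part runs through its family. The polynomial
left inverse is recorded since it yields both injectivity and the dimension bound. -/
theorem exists_family {τ : Type} (hM : M.Lawful k sc τ)
    (ht : ∀ f b, (Y.fShape f).twist b < d) (hVW : sc.V ⊆ sc.W)
    (hS : ∀ q, ∀ xy ∈ S.graph q, (∀ r, xy.1 r ∈ sc.V) ∧ xy.2 ∈ sc.W)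
    {v : LocIdx Y ⊕ M.B → F} (hv : v ∈ VS Y k sc M S) :
    ∃ (φ : LocIdx Y ⊕ M.B' → MvPolynomial τ F) (ψ : τ → MvPolynomial (LocIdx Y ⊕ M.B') F),
      (∀ t, polyMap ψ (polyMap φ t) = t) ∧ polyMap φ 0 = tildeS Y M v ∧
      ∀ t, ∃ w ∈ VS Y k sc M S, polyMap φ t = tildeS Y M w ∧
        w ∘ Sum.inl = v ∘ Sum.inl ∧ SameOn sc.W (mapsS Y M w) (mapsS Y M v) := by
  obtain ⟨φ, ψ, hψ, h0, hφ⟩ := hM.family _ hv.1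
  have hpoly : ∀ t, polyMap (Sum.elim (fun e => C (v (.inl e))) φ) t
      = Sum.elim (v ∘ Sum.inl) (polyMap φ t) := by
    intro t
    funext e
    cases e <;> simp [polyMap]
  refine ⟨Sum.elim (fun e => C (v (.inl e))) φ, fun t => rename Sum.inr (ψ t), ?_, ?_, ?_⟩
  · intro t
    funext j
    rw [hpoly, polyMap, eval_rename]
    exact congrFun (hψ t) j
  · rw [hpoly, h0]
    rfl
  · intro t
    obtain ⟨c, hc, hct, hs⟩ := hφ t
    refine ⟨Sum.elim (v ∘ Sum.inl) c, ⟨hc, hv.2.of_sameOn ht hVW hS hs⟩, ?_, rfl, hs⟩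
    rw [hpoly, hct]
    rfl

/-- The line through `v` in the direction `g`. A nonzero entry of `g` lets the parameter be
recovered from the point. -/
theorem exists_line {v : LocIdx Y ⊕ M.B → F} {g : LocIdx Y → F} (hg : ∃ e, g e ≠ 0)
    (hv : ∀ t : F, Sum.elim (fun e => v (.inl e) + t * g e) (v ∘ Sum.inr) ∈ VS Y k sc M S)
    {f : Y.Fun ⊕ (Y.Map × Fin n × Fin 2)} (hf : ∀ e, slotOf Y e ≠ f → g e = 0) :
    ∃ φ : LocIdx Y ⊕ M.B' → MvPolynomial Unit F,
      Function.Injective (polyMap φ) ∧ tildeS Y M v ∈ Set.range (polyMap φ) ∧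
      ∀ t, ∃ w ∈ VS Y k sc M S, polyMap φ t = tildeS Y M w ∧
        w ∘ Sum.inr = v ∘ Sum.inr ∧ ∀ e, slotOf Y e ≠ f → w (.inl e) = v (.inl e) := by
  let φ : LocIdx Y ⊕ M.B' → MvPolynomial Unit F :=
    Sum.elim (fun e => C (v (.inl e)) + X () * C (g e)) fun b => C (M.tilde (v ∘ Sum.inr) b)
  have hφ : ∀ t, polyMap φ t
      = tildeS Y M (Sum.elim (fun e => v (.inl e) + t () * g e) (v ∘ Sum.inr)) := by
    intro t
    funext e
    cases e <;> simp [polyMap, φ, tildeS, Function.comp_def]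
  refine ⟨φ, ?_, ⟨0, ?_⟩, fun t => ⟨_, hv (t ()), hφ t, rfl, ?_⟩⟩
  · intro t t' h
    obtain ⟨e, he⟩ := hg
    have := congrFun h (.inl e)
    rw [hφ, hφ] at this
    funext u
    exact mul_right_cancel₀ he (add_left_cancel this)
  · rw [hφ]
    congr 1
    funext e
    cases e <;> simp
  · intro e he
    simp [hf e he]

theorem localPoly_zero {R : ℕ} {sh : Shape n R} : localPoly (0 : sh.BMono → F) = 0 := by
  simp [localPoly]

theorem eval_rename_block {R : ℕ} {sh : Shape n R} (b : Fin sh.arity)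
    (P : MvPolynomial (Fin 2) F) (z : sh.LVar → F) :
    eval z (rename (Prod.mk b) P) = eval (fun s => z (b, s)) P := by
  rw [eval_rename]
  rfl

-- The degree condition provides a nonzero polynomial that vanishes on the component seen by one
-- block and fits into the degree bound. Its multiples are added to the numerator of `f`, and all
-- other local polynomials stay fixed.
open Classical in
theorem exists_line_fun (ht : ∀ f b, (Y.fShape f).twist b < d)
    (hS : ∀ q, ∀ xy ∈ S.graph q, (∀ r, xy.1 r ∈ sc.V) ∧ xy.2 ∈ sc.W)
    {v : LocIdx Y ⊕ M.B → F} (hv : v ∈ VS Y k sc M S)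
    {f : Y.Fun} (hf : SlotCond Y k sc.V (mapsS Y M v) (.inl f)) :
    ∃ φ : LocIdx Y ⊕ M.B' → MvPolynomial Unit F,
      Function.Injective (polyMap φ) ∧ tildeS Y M v ∈ Set.range (polyMap φ) ∧
      ∀ t, ∃ w ∈ VS Y k sc M S, polyMap φ t = tildeS Y M w ∧
        w ∘ Sum.inr = v ∘ Sum.inr ∧
        ∀ e, slotOf Y e ≠ .inl f → w (.inl e) = v (.inl e) := by
  obtain ⟨b, P, hP0, hPd, hP⟩ := hf
  obtain ⟨e, he⟩ := blockCoeff_ne_zero hPd hP0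
  let g : (f : Y.Fun) → (Y.fShape f).BMono → F :=
    Function.update (fun _ => 0) f (blockCoeff (Y.fShape f) b P)
  refine exists_line (g := numCoeffs g fun _ => 0) ⟨.inl ⟨f, true, e⟩, ?_⟩
    (fun t => ⟨hv.1, hv.2.add_numCoeffs hS ?_ ?_ t⟩) ?_
  · simpa [numCoeffs, g] using he
  · intro f' x hx
    by_cases hff : f' = f
    · subst hff
      obtain ⟨z, hz, h⟩ := exists_blockPoly_eq (ht f') hx b
      simp only [g, Function.update_self]
      rw [localPoly_blockCoeff hPd, eval_compose, eval_rename_block]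
      simp only [h]
      exact hP z hz
    · simp only [g, Function.update_of_ne hff]
      rw [localPoly_zero, eval_compose, map_zero]
  · intro c x _
    rw [localPoly_zero, map_zero]
  · rintro (e | e) he
    · simp only [numCoeffs, g]
      rw [Function.update_of_ne fun h => he (congrArg Sum.inl h)]
      simp
    · simp [numCoeffs]

-- The same for a coordinate of a local map. Its blocks are evaluated at points of `V` themselves
-- and not on the descent, so no bound on the twists enters.
open Classical in
theorem exists_line_map
    (hS : ∀ q, ∀ xy ∈ S.graph q, (∀ r, xy.1 r ∈ sc.V) ∧ xy.2 ∈ sc.W)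
    {v : LocIdx Y ⊕ M.B → F} (hv : v ∈ VS Y k sc M S)
    {c : Y.Map × Fin n × Fin 2} (hf : SlotCond Y k sc.V (mapsS Y M v) (.inr c)) :
    ∃ φ : LocIdx Y ⊕ M.B' → MvPolynomial Unit F,
      Function.Injective (polyMap φ) ∧ tildeS Y M v ∈ Set.range (polyMap φ) ∧
      ∀ t, ∃ w ∈ VS Y k sc M S, polyMap φ t = tildeS Y M w ∧
        w ∘ Sum.inr = v ∘ Sum.inr ∧
        ∀ e, slotOf Y e ≠ .inr c → w (.inl e) = v (.inl e) := by
  obtain ⟨b, P, hP0, hPd, hP⟩ := hf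
  obtain ⟨e, he⟩ := blockCoeff_ne_zero hPd hP0
  let g : (c : Y.Map × Fin n × Fin 2) → (Y.mShape c.1 c.2.1 c.2.2).BMono → F :=
    Function.update (fun _ => 0) c (blockCoeff (Y.mShape c.1 c.2.1 c.2.2) b P)
  refine exists_line (g := numCoeffs (fun _ => 0) g) ⟨.inr ⟨c, true, e⟩, ?_⟩
    (fun t => ⟨hv.1, hv.2.add_numCoeffs hS ?_ ?_ t⟩) ?_
  · simpa [numCoeffs, g] using he
  · intro f x _
    rw [localPoly_zero, eval_compose, map_zero]
  · intro c' x hx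
    by_cases hcc : c' = c
    · subst hcc
      simp only [g, Function.update_self]
      rw [localPoly_blockCoeff hPd, eval_rename_block]
      exact hP (x ((Y.mShape c'.1 c'.2.1 c'.2.2).arg b)) (hx _)
    · simp only [g, Function.update_of_ne hcc]
      rw [localPoly_zero, map_zero]
  · rintro (e | e) he
    · simp [numCoeffs]
    · simp only [numCoeffs, g]
      rw [Function.update_of_ne fun h => he (congrArg Sum.inr h)]
      simp

theorem triplyConfusing {τ : Type} (hM : M.Lawful k sc τ)
    (ht : ∀ f b, (Y.fShape f).twist b < d) (hVW : sc.V ⊆ sc.W)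
    (hS : ∀ q, ∀ xy ∈ S.graph q, (∀ r, xy.1 r ∈ sc.V) ∧ xy.2 ∈ sc.W) :
    TriplyConfusing Y k τ sc M S where
  blinding v hv := by
    obtain ⟨φ, ψ, hψ, h0, hφ⟩ := exists_family hM ht hVW hS hv
    exact ⟨φ, Function.LeftInverse.injective hψ, ⟨0, h0⟩, hφ⟩
  locals v hv f hf := by
    rcases f with f | c
    · exact exists_line_fun ht hS hv hf
    · exact exists_line_map hS hv hf
  act_one v hv := by
    funext e
    rcases e with (e | e) | e
    · exact (congrArg (· * _) (scaleFactor_one _ _)).trans (one_mul _)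
    · simp [actS, scaleFactor_one]
    · exact congrFun (hM.act_one _) e
  act_mul v hv D D' := by
    funext e
    rcases e with (e | e) | e
    · simp only [actS, Sum.elim_inl, scaleFactor_mul, mul_assoc]
    · simp only [actS, Sum.elim_inl, scaleFactor_mul, Pi.mul_apply, Units.val_mul, map_mul]
      split_ifs <;> ring
    · exact congrFun (hM.act_mul D D' _) e
  act_mem v hv D := actS_mem_VS hM D hv
  act_maps v hv D i s := hM.act_maps D _ i s

/-- One decomposition is enough, since its family is a retract of affine space inside the set. -/
theorem le_zdim_VSt [Infinite F] {τ : Type} [Fintype τ] (hM : M.Lawful k sc τ)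
    (ht : ∀ f b, (Y.fShape f).twist b < d) (hVW : sc.V ⊆ sc.W)
    (hS : ∀ q, ∀ xy ∈ S.graph q, (∀ r, xy.1 r ∈ sc.V) ∧ xy.2 ∈ sc.W)
    {v : LocIdx Y ⊕ M.B → F} (hv : v ∈ VS Y k sc M S) :
    (Fintype.card τ : WithBot ℕ∞) ≤ zdim (VSt Y k sc M S) := by
  obtain ⟨φ, ψ, hψ, -, hφ⟩ := exists_family hM ht hVW hS hv
  refine le_zdim φ ψ hψ fun t => ?_
  obtain ⟨w, hw, h, -⟩ := hφ t
  exact ⟨w, hw, h.symm⟩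

theorem hiddenSys_graph_subset (h : LocIdx Y → F)
    (H : Fin n → Fin 2 → MvPolynomial (Var n) F) (q : Y.Map) :
    ∀ xy ∈ (hiddenSys Y k sc h H).graph q, (∀ r, xy.1 r ∈ sc.V) ∧ xy.2 ∈ sc.W :=
  fun _ hxy => ⟨hxy.1, hxy.2.1⟩

/-- Local part and blinding part decompose the system that they determine. -/
theorem isDecomp_hiddenSys {h : LocIdx Y → F} {H : Fin n → Fin 2 → MvPolynomial (Var n) F}
    (hd : ∀ f, RegularOn (sc.dom k (Y.fArgs f)) (compose k sc.θ H (fLoc Y h f false))) :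
    IsDecomp Y k sc (hiddenSys Y k sc h H) h H :=
  ⟨fun f => ⟨hd f, fun x _ => by simp [hiddenSys]⟩, fun _ _ hxy => hxy.2.2⟩

end Systems

/-! ### The two presentations -/

/-! ### Presentation by blinding parameters. -/

section ByParams

variable {n : ℕ} {F : Type*} [Field F]

theorem scalePar_one (c : ParIdx n → F) : scalePar 1 c = c := by
  funext e
  rcases e with e | ⟨i, e | ⟨r, t⟩ | e | e⟩
  · rfl
  · rfl
  · fin_cases r <;> exact one_mul _
  · rfl
  · rfl

theorem scalePar_mul (D D' : Fin n → Fin 2 → Fˣ) (c : ParIdx n → F) :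
    scalePar (D * D') c = scalePar D (scalePar D' c) := by
  funext e
  rcases e with e | ⟨i, e | ⟨r, t⟩ | e | e⟩
  · rfl
  · rfl
  · fin_cases r <;> exact mul_assoc _ _ _
  · rfl
  · rfl

theorem shearPar_zero (c : ParIdx n → F) : shearPar c 0 = c := by
  funext e
  rcases e with e | ⟨i, ⟨r, u⟩ | e | e | r⟩
  · rfl
  · simp [shearPar]
  · rfl
  · rfl
  · simp [shearPar]

/-- The shears, as polynomials. -/
def shearPoly (c : ParIdx n → F) : ParIdx n → MvPolynomial (Fin n) F
  | .inr (i, .inl (r, u)) =>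
      C (c (.inr (i, .inl (r, u)))) + if r = 2 then X i * C (c (.inr (i, .inl (0, u)))) else 0
  | .inr (i, .inr (.inr (.inr r))) =>
      C (c (.inr (i, .inr (.inr (.inr r))))) - if r = 1 then X i else 0
  | e => C (c e)

theorem polyMap_shearPoly (c : ParIdx n → F) (t : Fin n → F) :
    polyMap (shearPoly c) t = shearPar c t := by
  funext e
  rcases e with e | ⟨i, ⟨r, u⟩ | e | e | r⟩
  · exact eval_C _
  · simp only [polyMap, shearPoly, shearPar]
    split_ifs <;> simp
  · exact eval_C _
  · exact eval_C _
  · simp only [polyMap, shearPoly, shearPar]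
    split_ifs <;> simp

/-- Each choice of parameters lies on an affine space of parameters of the same map. -/
theorem params_family {W : Set (Var n → F)} {c : ParIdx n → F} (hc : ValidPar c)
    (hW : space c = W) :
    ∃ (φ : ParIdx n → MvPolynomial (Fin n) F) (ψ : Fin n → MvPolynomial (ParIdx n) F),
      (∀ t, polyMap ψ (polyMap φ t) = t) ∧ polyMap φ 0 = c ∧
      ∀ t, ∃ c' : ParIdx n → F, (ValidPar c' ∧ space c' = W) ∧ polyMap φ t = c' ∧
        SameOn W (quad c') (quad c) := by
  -- The shear parameter is read off from the coefficient of x in `q_i`, which has decreased by `t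
  -- i`.
  refine ⟨shearPoly c, fun i => C (parq c i 1) - X (.inr (i, .inr (.inr (.inr 1)))), ?_, ?_, ?_⟩
  · intro t
    rw [polyMap_shearPoly]
    funext i
    change eval (shearPar c t) _ = _
    rw [map_sub, eval_C, eval_X]
    exact sub_sub_cancel _ _
  · rw [polyMap_shearPoly, shearPar_zero]
  · intro t
    refine ⟨shearPar c t, ⟨validPar_shearPar hc t, (space_shearPar c t).trans hW⟩,
      polyMap_shearPoly c t, fun x _ i s => ?_⟩
    rw [quad, quad3_shearPar]
    rfl

variable {d : ℕ} {k : Type*} [Field k] [Fintype k] [Algebra k F]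

theorem polyFun_quad (a : ℕ) (x : Var n → F) (i : Fin n) (s : Fin 2) :
    PolyFun (fun c : ParIdx n → F => c) fun c => frob k a (eval x (quad c i s)) :=
  polyFun_quad3 ((frob k a).comp (eval x)) (m := Fintype.card k ^ a)
    (fun b => by simp [frob_apply]) i _

theorem polyFun_desc_quad (θ : Fin d → F) (a : ℕ) (x : DVar n d → F) (i : Fin n) (s : Fin 2) :
    PolyFun (fun c : ParIdx n → F => c)
      fun c => eval x (map (frob k a) (desc θ (quad c i s))) :=
  polyFun_quad3 ((eval x).comp ((map (frob k a)).comp (desc θ).toRingHom))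
    (m := Fintype.card k ^ a) (fun b => by simp [frob_apply, desc]) i _

theorem byParams_act (sc : Scene n d F) (D : Fin n → Fin 2 → Fˣ) :
    (byParams sc).act D = scalePar D := by
  funext c e
  rcases e with e | ⟨i, e | ⟨r, t⟩ | e | e⟩ <;> rfl

theorem lawful_byParams (sc : Scene n d F) : (byParams sc).Lawful k sc (Fin n) where
  tilde_injective := fun _ _ h => h
  act_one c := (congrFun (byParams_act sc 1) c).trans (scalePar_one c)
  act_mul D D' c := by
    simp only [byParams_act]
    exact scalePar_mul D D' c
  act_mem D c hc := by
    simp only [byParams_act]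
    exact ⟨validPar_scalePar D hc.1, (space_scalePar D c).trans hc.2⟩
  act_maps D c i s := by
    simp only [byParams_act]
    exact quad_scalePar D c i s
  family c hc := params_family hc.1 hc.2
  totalDegree_maps_le c i s := totalDegree_quad3_le c i _
  polyFun_eval a x i s := polyFun_quad a x i s
  polyFun_eval_desc a x i s := polyFun_desc_quad sc.θ a x i s

end ByParams

/-! ### Presentation by the coefficients of the quadratic polynomials. -/

section ByCoeffs

variable {n d : ℕ} {F : Type*} [Field F] {θ : Fin d → F}

/-- The coefficients of the descents of quadratic polynomials with given coefficients. -/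
def descCoeffs (θ : Fin d → F) (c : BlindIdx n (Var n) → F) : BlindIdx n (DVar n d) → F :=
  fun ise => coeff ise.2.2.exp (desc θ (blindPoly c ise.1 ise.2.1))

/-- Descent does not raise degrees, so the monomials of degree at most 2 record the whole descended
polynomial. -/
theorem polyOf_descCoeffs (c : BlindIdx n (Var n) → F) (i : Fin n) (s : Fin 2) :
    polyOf (fun e => descCoeffs θ c (i, s, e)) = desc θ (blindPoly c i s) :=
  polyOf_coeff (P := desc θ (blindPoly c i s))
    ((totalDegree_desc_le θ _).trans (totalDegree_polyOf_le _))

theorem descCoeffs_injective [Infinite F] (hθ : ∃ j, θ j ≠ 0) :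
    Function.Injective (descCoeffs (n := n) θ) := by
  intro c c' h
  funext e
  obtain ⟨i, s, e⟩ := e
  have h' : blindPoly c i s = blindPoly c' i s := by
    apply desc_injective hθ
    rw [← polyOf_descCoeffs, ← polyOf_descCoeffs, h]
  rw [← coeff_polyOf (fun e => c (i, s, e)) e, ← coeff_polyOf (fun e => c' (i, s, e)) e]
  exact congrArg (coeff e.exp) h'

theorem blindPoly_scale (D : Fin n → Fin 2 → Fˣ) (c : BlindIdx n (Var n) → F) (i : Fin n)
    (s : Fin 2) : blindPoly (fun ise => (D ise.1 ise.2.1 : F) * c ise) i s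
      = C (D i s : F) * blindPoly c i s :=
  polyOf_smul (D i s : F) fun e => c (i, s, e)

theorem isBlinding_scale {W : Set (Var n → F)} {c : BlindIdx n (Var n) → F}
    (hc : IsBlinding W (blindPoly c)) (D : Fin n → Fin 2 → Fˣ) :
    IsBlinding W (blindPoly fun ise => (D ise.1 ise.2.1 : F) * c ise) := by
  obtain ⟨p, hp, hW, hs⟩ := hc
  refine ⟨scalePar D p, validPar_scalePar D hp, (space_scalePar D p).trans hW,
    fun x hx i s => ?_⟩
  rw [quad_scalePar, blindPoly_scale, map_mul, map_mul, hs x hx]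

/-- The coefficients of the descents of linear combinations of the `F_{r2} - F_{r3}`. -/
def diffCoeffs (θ : Fin d → F) (c₀ : ParIdx n → F) : (Fin n → F) →ₗ[F] Mono (DVar n d) 2 → F where
  toFun t e := ∑ r, t r * coeff e.exp (desc θ (quadDiff c₀ r))
  map_add' t t' := by
    funext e
    simp [add_mul, Finset.sum_add_distrib]
  map_smul' a t := by
    funext e
    simp [Finset.mul_sum, mul_assoc]

theorem diffCoeffs_apply (c₀ : ParIdx n → F) (t : Fin n → F) (e : Mono (DVar n d) 2) :
    diffCoeffs θ c₀ t e = ∑ r, t r * coeff e.exp (desc θ (quadDiff c₀ r)) := rfl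

theorem totalDegree_sum_quadDiff_le (c₀ : ParIdx n → F) (t : Fin n → F) :
    (∑ r, t r • quadDiff c₀ r).totalDegree ≤ 2 :=
  totalDegree_finsetSum_le fun r _ =>
    (totalDegree_smul_le _ _).trans (totalDegree_quadDiff_le c₀ r)

theorem coeff_desc_sum_quadDiff (c₀ : ParIdx n → F) (t : Fin n → F) (e : Mono (DVar n d) 2) :
    coeff e.exp (desc θ (∑ r, t r • quadDiff c₀ r)) = diffCoeffs θ c₀ t e := by
  rw [diffCoeffs_apply, map_sum, coeff_sum]
  exact Finset.sum_congr rfl fun r _ => by rw [map_smul, coeff_smul, smul_eq_mul]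

/-- The differences are linearly independent before descent, and descent is injective. -/
theorem ker_diffCoeffs [Infinite F] (hθ : ∃ j, θ j ≠ 0) {c₀ : ParIdx n → F}
    (hc₀ : ValidPar c₀) : LinearMap.ker (diffCoeffs θ c₀) = ⊥ := by
  rw [LinearMap.ker_eq_bot']
  intro t ht
  have h0 : desc θ (∑ r, t r • quadDiff c₀ r) = 0 := by
    rw [← polyOf_coeff ((totalDegree_desc_le θ _).trans (totalDegree_sum_quadDiff_le c₀ t))]
    simp only [coeff_desc_sum_quadDiff, ht]
    simp [polyOf]
  have h1 := desc_injective hθ (h0.trans (map_zero (desc θ)).symm)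
  exact funext (Fintype.linearIndependent_iff.mp (linearIndependent_quadDiff hc₀) t h1)

/-- Multiples of the `F_{r2} - F_{r3}` are added to the quadratic polynomials. -/
def addDiff (c₀ : ParIdx n → F) (c : BlindIdx n (Var n) → F) (t : Fin n × Fin 2 × Fin n → F) :
    BlindIdx n (Var n) → F :=
  fun ise => c ise + coeff ise.2.2.exp (∑ r, t (ise.1, ise.2.1, r) • quadDiff c₀ r)

theorem blindPoly_addDiff (c₀ : ParIdx n → F) (c : BlindIdx n (Var n) → F)
    (t : Fin n × Fin 2 × Fin n → F) (i : Fin n) (s : Fin 2) :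
    blindPoly (addDiff c₀ c t) i s = blindPoly c i s + ∑ r, t (i, s, r) • quadDiff c₀ r := by
  refine (polyOf_add (fun e => c (i, s, e)) fun e =>
    coeff e.exp (∑ r, t (i, s, r) • quadDiff c₀ r)).trans ?_
  rw [polyOf_coeff (totalDegree_sum_quadDiff_le c₀ _)]
  rfl

theorem descCoeffs_addDiff (c₀ : ParIdx n → F) (c : BlindIdx n (Var n) → F)
    (t : Fin n × Fin 2 × Fin n → F) (i : Fin n) (s : Fin 2) (e : Mono (DVar n d) 2) :
    descCoeffs θ (addDiff c₀ c t) (i, s, e)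
      = descCoeffs θ c (i, s, e) + diffCoeffs θ c₀ (fun r => t (i, s, r)) e := by
  rw [← coeff_desc_sum_quadDiff, descCoeffs, blindPoly_addDiff, map_add, coeff_add]
  rfl

theorem sameOn_addDiff (c₀ : ParIdx n → F) (c : BlindIdx n (Var n) → F)
    (t : Fin n × Fin 2 × Fin n → F) :
    SameOn (space c₀) (blindPoly (addDiff c₀ c t)) (blindPoly c) := by
  intro x hx i s
  rw [blindPoly_addDiff, map_add, map_sum, Finset.sum_eq_zero, add_zero]
  intro r _
  rw [smul_eval, eval_quadDiff hx, mul_zero]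

/-- Each tuple of quadratic polynomials lies on an affine space of tuples that define the same
blinding map. -/
theorem coeffs_family [Infinite F] (hθ : ∃ j, θ j ≠ 0) {c₀ : ParIdx n → F}
    (hc₀ : ValidPar c₀) {W : Set (Var n → F)} (hW : space c₀ = W)
    {c : BlindIdx n (Var n) → F} (hc : IsBlinding W (blindPoly c)) :
    ∃ (φ : BlindIdx n (DVar n d) → MvPolynomial (Fin n × Fin 2 × Fin n) F)
      (ψ : Fin n × Fin 2 × Fin n → MvPolynomial (BlindIdx n (DVar n d)) F),
      (∀ t, polyMap ψ (polyMap φ t) = t) ∧ polyMap φ 0 = descCoeffs θ c ∧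
      ∀ t, ∃ c' : BlindIdx n (Var n) → F, IsBlinding W (blindPoly c') ∧
        polyMap φ t = descCoeffs θ c' ∧ SameOn W (blindPoly c') (blindPoly c) := by
  subst hW
  -- A linear left inverse of the injective map `diffCoeffs`. Expanded in the standard basis of the
  -- coefficient space, it gives the polynomial left inverse `ψ`, for all pairs `(i, s)` separately;
  -- this accounts for 2n times `n` parameters.
  obtain ⟨g, hg⟩ := (diffCoeffs θ c₀).exists_leftInverse_of_injective (ker_diffCoeffs hθ hc₀)
  let φ : BlindIdx n (DVar n d) → MvPolynomial (Fin n × Fin 2 × Fin n) F := fun ise =>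
    C (descCoeffs θ c ise)
      + ∑ r, X (ise.1, ise.2.1, r) * C (coeff ise.2.2.exp (desc θ (quadDiff c₀ r)))
  have hφ : ∀ t, polyMap φ t = descCoeffs θ (addDiff c₀ c t) := by
    intro t
    funext ise
    obtain ⟨i, s, e⟩ := ise
    rw [descCoeffs_addDiff, diffCoeffs_apply]
    simp [polyMap, φ]
  refine ⟨φ, fun isr => ∑ e, (X (isr.1, isr.2.1, e) - C (descCoeffs θ c (isr.1, isr.2.1, e)))
    * C (g (fun e' => if e = e' then 1 else 0) isr.2.2), ?_, ?_, ?_⟩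
  · intro t
    funext isr
    obtain ⟨i, s, r⟩ := isr
    have h1 := congrFun (LinearMap.congr_fun hg fun r => t (i, s, r)) r
    rw [LinearMap.comp_apply, LinearMap.pi_apply_eq_sum_univ g, Finset.sum_apply] at h1
    refine Eq.trans ?_ h1
    rw [hφ]
    change eval _ (∑ e, _) = _
    rw [map_sum]
    refine Finset.sum_congr rfl fun e _ => ?_
    rw [map_mul, map_sub, eval_X, eval_C, eval_C, descCoeffs_addDiff, add_sub_cancel_left]
    rfl
  · rw [hφ]
    congr 1
    funext ise
    simp [addDiff]
  · intro t
    have hs := sameOn_addDiff c₀ c t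
    -- Being a blinding map depends only on the values on `W`, so the blinding parameters for `c`
    -- also serve for the changed tuple.
    obtain ⟨p, hp, hpW, hps⟩ := hc
    exact ⟨addDiff c₀ c t, ⟨p, hp, hpW, fun x hx i s => (hs x hx i s).trans (hps x hx i s)⟩,
      hφ t, hs⟩

variable {k : Type*} [Field k] [Fintype k] [Algebra k F]

/-- Frobenius raises the descended coefficients to a fixed power, which is a polynomial operation on
them. -/
theorem polyFun_desc_blindPoly (a : ℕ) (x : DVar n d → F) (i : Fin n) (s : Fin 2) :
    PolyFun (descCoeffs (n := n) θ)
      fun c => eval x (map (frob k a) (desc θ (blindPoly c i s))) := by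
  have h : ∀ c : BlindIdx n (Var n) → F, eval x (map (frob k a) (desc θ (blindPoly c i s)))
      = ∑ e, descCoeffs θ c (i, s, e) ^ (Fintype.card k ^ a) * ∏ u, x u ^ (e.1 u : ℕ) := by
    intro c
    rw [eval_map, ← polyOf_descCoeffs, eval₂_polyOf]
    simp only [frob_apply]
  simp only [h]
  exact PolyFun.sum _ fun e _ => ((PolyFun.coord (t := descCoeffs θ) (i, s, e)).pow _).mul
    (PolyFun.const _)

/-- A value of H_{ij} is a value of its descent at a preimage of the point, hence polynomial in the
descended coefficients although the original ones are no longer coordinates. -/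
theorem polyFun_blindPoly (hθ : ∃ j, θ j ≠ 0) (a : ℕ) (x : Var n → F) (i : Fin n) (s : Fin 2) :
    PolyFun (descCoeffs (n := n) θ) fun c => frob k a (eval x (blindPoly c i s)) := by
  obtain ⟨y, hy⟩ := exists_descent_point (n := n) hθ x
  have h : ∀ c : BlindIdx n (Var n) → F, frob k a (eval x (blindPoly c i s))
      = eval y (map (frob k 0) (desc θ (blindPoly c i s))) ^ (Fintype.card k ^ a) := by
    intro c
    have h0 : frob k 0 = RingHom.id F := RingHom.ext fun z => by simp [frob_apply]
    rw [frob_apply, h0, map_id, ← hy]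
  simp only [h]
  exact (polyFun_desc_blindPoly 0 y i s).pow _

theorem lawful_byCoeffs [Infinite F] {sc : Scene n d F} (hθ : ∃ j, sc.θ j ≠ 0)
    {c₀ : ParIdx n → F} (hc₀ : ValidPar c₀) (hW : space c₀ = sc.W) :
    (byCoeffs sc).Lawful k sc (Fin n × Fin 2 × Fin n) where
  tilde_injective := descCoeffs_injective hθ
  act_one _ := funext fun _ => one_mul _
  act_mul _ _ _ := funext fun _ => mul_assoc _ _ _
  act_mem D _ hc := isBlinding_scale hc D
  act_maps D c i s := blindPoly_scale D c i s
  family _ hc := coeffs_family hθ hc₀ hW hc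
  totalDegree_maps_le _ _ _ := totalDegree_polyOf_le _
  polyFun_eval a x i s := polyFun_blindPoly hθ a x i s
  polyFun_eval_desc a x i s := polyFun_desc_blindPoly a x i s

end ByCoeffs

/-! ### The secret data -/

theorem totalDegree_map_le {R S σ : Type*} [CommSemiring R] [CommSemiring S] (f : R →+* S)
    (P : MvPolynomial σ R) : (map f P).totalDegree ≤ P.totalDegree :=
  Finset.sup_mono (support_map_subset _ _)

theorem ValidPar.map {n : ℕ} {K F : Type*} [Field K] [Field F] (f : K →+* F) {c : ParIdx n → K}
    (hc : ValidPar c) : ValidPar fun t => f (c t) := by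
  have hdet : ∀ {m : Type} [Fintype m] [DecidableEq m] (A : Matrix m m K), A.det ≠ 0 →
      (A.map f).det ≠ 0 := by
    intro m _ _ A hA
    rw [← RingHom.mapMatrix_apply, ← RingHom.map_det]
    exact (map_ne_zero f).mpr hA
  refine ⟨hdet _ hc.1, fun i => ⟨hdet _ (hc.2 i).1, hdet _ (hc.2 i).2.1,
    (map_ne_zero f).mpr (hc.2 i).2.2.1, ?_⟩⟩
  exact (hc.2 i).2.2.2.imp (map_ne_zero f).mpr (Or.imp (map_ne_zero f).mpr (map_ne_zero f).mpr)

/-- The order of `K` is q^d. Therefore twists matter only modulo `d` for equations over `K`. -/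
theorem frob_mul_algebraMap {k K F : Type*} [Field k] [Fintype k] [Field K] [Fintype K]
    [Algebra k K] [Field F] [Algebra K F] [Algebra k F] {d : ℕ} (θ : Module.Basis (Fin d) k K)
    (e : ℕ) (x : K) :
    frob k (d * e) (algebraMap K F x) = algebraMap K F x := by
  have hcard : Fintype.card K = Fintype.card k ^ d := by
    rw [Module.card_fintype θ, Fintype.card_fin]
  rw [frob_apply, ← map_pow, pow_mul, ← hcard, FiniteField.pow_card_pow]

namespace Setup

variable {k K : Type*} [Field k] [Fintype k] [Field K] [Algebra k K]
variable {Kbar : Type*} [Field Kbar] [Algebra K Kbar] [DecidableEq Kbar] {n N d : ℕ}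

/-! ### The disguised curves E_i and their points. -/

section Points

variable (T : Setup k K Kbar n N d)

/-- The equation of the curve `E_i`, multiplied by the product of the coordinates. -/
def curvePoly (i : Fin n) : MvPolynomial (Fin 2) K :=
  let L := C (T.A i 1 1) * X 1 - C (T.A i 0 1) * X 0
  let M := C (T.A i 0 0) * X 0 - C (T.A i 1 0) * X 1
  let w := X 0 * X 1
  C (T.A i).det * w * M ^ 2
    - (L ^ 3 + C (T.E.a₄ * (T.A i).det ^ 2) * w ^ 2 * L + C (T.E.a₆ * (T.A i).det ^ 3) * w ^ 3)

/-- On the coordinate axes `w` vanishes and only the cube of `L` remains. The coefficients of `L`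
form, up to sign, a column of the invertible matrix `A_i`, so one of the two axes detects it. -/
theorem curvePoly_ne_zero (i : Fin n) : T.curvePoly i ≠ 0 := by
  intro h
  by_cases hA : T.A i 1 1 = 0
  · have h0 := congrArg (eval ![1, 0]) h
    simp [curvePoly, hA] at h0
    have := T.A_det i
    rw [Matrix.det_fin_two, hA, h0] at this
    simp at this
  · have h0 := congrArg (eval ![0, 1]) h
    simp [curvePoly, hA] at h0

/-- The terms w M², L³, w² L, w³ have degrees at most 4, 3, 5, 6. -/
theorem totalDegree_curvePoly_le (i : Fin n) : (T.curvePoly i).totalDegree ≤ 6 := by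
  have hlin : ∀ (a b : K) (s t : Fin 2),
      (C a * X s - C b * X t : MvPolynomial (Fin 2) K).totalDegree ≤ 1 := by
    intro a b s t
    refine (totalDegree_sub _ _).trans (max_le ?_ ?_) <;>
      exact (totalDegree_mul _ _).trans (by simp)
  have hw : (X 0 * X 1 : MvPolynomial (Fin 2) K).totalDegree ≤ 2 :=
    (totalDegree_mul _ _).trans (by simp)
  have hpow : ∀ {P : MvPolynomial (Fin 2) K} {a : ℕ} (m : ℕ), P.totalDegree ≤ a →
      (P ^ m).totalDegree ≤ m * a := fun m hP =>
    (totalDegree_pow _ m).trans (Nat.mul_le_mul_left m hP)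
  have hmul : ∀ {P Q : MvPolynomial (Fin 2) K} {a b c : ℕ}, P.totalDegree ≤ a →
      Q.totalDegree ≤ b → a + b ≤ c → (P * Q).totalDegree ≤ c := fun hP hQ h =>
    (totalDegree_mul _ _).trans ((Nat.add_le_add hP hQ).trans h)
  have hC : ∀ a : K, (C a : MvPolynomial (Fin 2) K).totalDegree ≤ 0 := fun a => by simp
  refine (totalDegree_sub _ _).trans (max_le ?_ ((totalDegree_add _ _).trans (max_le
    ((totalDegree_add _ _).trans (max_le ?_ ?_)) ?_)))
  · exact hmul (hmul (hC _) hw le_rfl) (hpow 2 (hlin _ _ _ _)) (by norm_num)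
  · exact (hpow 3 (hlin _ _ _ _)).trans (by norm_num)
  · exact hmul (hmul (hC _) (hpow 2 hw) le_rfl) (hlin _ _ _ _) (by norm_num)
  · exact hmul (hC _) (hpow 3 hw) (by norm_num)

variable {T}

/-- Cramer's rule for the matrix `A_i`. -/
theorem IsCoord.solve {i : Fin n} {z : Fin 2 → Kbar} {x y : Kbar} (h : T.IsCoord i z x y) :
    algebraMap K Kbar (T.A i).det * x
        = algebraMap K Kbar (T.A i 1 1) * (z 0)⁻¹ - algebraMap K Kbar (T.A i 0 1) * (z 1)⁻¹ ∧
      algebraMap K Kbar (T.A i).det * y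
        = algebraMap K Kbar (T.A i 0 0) * (z 1)⁻¹ - algebraMap K Kbar (T.A i 1 0) * (z 0)⁻¹ := by
  rw [← (h.2 0).2, ← (h.2 1).2, Matrix.det_fin_two, map_sub, map_mul, map_mul]
  constructor <;> ring

theorem IsCoord.eval_curvePoly {i : Fin n} {z : Fin 2 → Kbar} {x y : Kbar}
    (h : T.IsCoord i z x y) : eval z (map (algebraMap K Kbar) (T.curvePoly i)) = 0 := by
  obtain ⟨hx, hy⟩ := h.solve
  have h0 := (h.2 0).1
  have h1 := (h.2 1).1
  set D := algebraMap K Kbar (T.A i).det with hD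
  have hL : algebraMap K Kbar (T.A i 1 1) * z 1 - algebraMap K Kbar (T.A i 0 1) * z 0
      = D * x * (z 0 * z 1) := by
    rw [hx]
    field_simp
  have hM : algebraMap K Kbar (T.A i 0 0) * z 0 - algebraMap K Kbar (T.A i 1 0) * z 1
      = D * y * (z 0 * z 1) := by
    rw [hy]
    field_simp
  have hE := (WeierstrassCurve.Affine.equation_iff _ _).mp h.1
  simp only [WeierstrassCurve.map_a₁, WeierstrassCurve.map_a₂, WeierstrassCurve.map_a₃,
    WeierstrassCurve.map_a₄, WeierstrassCurve.map_a₆, T.short.1, T.short.2.1, T.short.2.2,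
    map_zero, zero_mul, add_zero] at hE
  simp only [curvePoly, map_sub, map_add, map_mul, map_pow, map_C, map_X, eval_C, eval_X]
  rw [hL, hM, ← hD]
  -- With L = D x w and M = D y w, where w is the product of the coordinates, `curvePoly` is the
  -- Weierstrass equation multiplied by D³ w³.
  linear_combination D ^ 3 * (z 0 * z 1) ^ 3 * hE

theorem IsPt.eval_curvePoly {i : Fin n} {z : Fin 2 → Kbar} {P : T.Pt} (h : T.IsPt i z P) :
    eval z (map (algebraMap K Kbar) (T.curvePoly i)) = 0 := by
  obtain ⟨x, y, -, -, hc⟩ := h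
  exact hc.eval_curvePoly

theorem IsPt.unique {i : Fin n} {z : Fin 2 → Kbar} {P P' : T.Pt} (h : T.IsPt i z P)
    (h' : T.IsPt i z P') : P = P' := by
  obtain ⟨x, y, hp, rfl, hc⟩ := h
  obtain ⟨x', y', hp', rfl, hc'⟩ := h'
  have hD : algebraMap K Kbar (T.A i).det ≠ 0 := (map_ne_zero _).mpr (T.A_det i)
  have hx : x = x' := mul_left_cancel₀ hD (hc.solve.1.trans hc'.solve.1.symm)
  have hy : y = y' := mul_left_cancel₀ hD (hc.solve.2.trans hc'.solve.2.symm)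
  subst hx hy
  rfl

theorem IsPt.coord_unique {i : Fin n} {z z' : Fin 2 → Kbar} {P : T.Pt} (h : T.IsPt i z P)
    (h' : T.IsPt i z' P) : z = z' := by
  obtain ⟨x, y, hp, rfl, hc⟩ := h
  obtain ⟨x', y', hp', he, hc'⟩ := h'
  rw [WeierstrassCurve.Affine.Point.some.injEq] at he
  obtain ⟨rfl, rfl⟩ := he
  funext s
  exact inv_injective ((hc.2 s).2.symm.trans (hc'.2 s).2)

end Points

variable (T : Setup k K Kbar n N d)

theorem validPar_parBar : ValidPar T.parBar := T.par_valid.map (algebraMap K Kbar)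

theorem mapShape_twist (rows : Fin N → Fin n → Fin 2 → Fin n) (r : Fin n) (tw : Fin n → ℕ)
    (D : MapIx N → ℕ) (q : MapIx N) (b : Fin (mapShape rows r tw D q).arity) :
    (mapShape rows r tw D q).twist b = tw ((mapShape rows r tw D q).pos b) ∧
      (mapShape rows r tw D q).deg b = D q := by
  cases q <;> exact ⟨rfl, rfl⟩

theorem mapShape_arity_pos (rows : Fin N → Fin n → Fin 2 → Fin n) (r : Fin n) (tw : Fin n → ℕ)
    (D : MapIx N → ℕ) (q : MapIx N) : 0 < (mapShape rows r tw D q).arity := by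
  cases q
  exacts [Nat.two_pos, Nat.one_pos, Nat.two_pos]

theorem pairShape_twist (i : Fin n) (a : ℕ) (p : PairIx) (b : Fin (pairShape i a p).arity) :
    (pairShape i a p).twist b = a ∧ (pairShape i a p).pos b = i := by
  cases p <;> exact ⟨rfl, rfl⟩

/-- The last block, of degree 2, has no room for the equation of the curve, but the first one does.
-/
theorem exists_pairShape_deg (i : Fin n) (a : ℕ) (p : PairIx) :
    ∃ b, 6 ≤ (pairShape i a p).deg b := by
  cases p
  · exact ⟨(0 : Fin 3), le_rfl⟩
  · exact ⟨(0 : Fin 2), by change 6 ≤ 10; norm_num⟩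

theorem twist_lt (f : T.type.Fun) (b : Fin (T.type.fShape f).arity) :
    (T.type.fShape f).twist b < d := by
  rcases f with ⟨q, i, j⟩ | ⟨p, i⟩
  · refine (mapShape_twist _ _ _ _ q b).1.trans_lt (Nat.mod_lt _ ?_)
    exact (T.a j.1).pos
  · exact (pairShape_twist i _ p b).1.trans_lt (T.a i).isLt

variable [Algebra k Kbar]

variable {T} in
theorem IsHatPt.unique {x : Var n → Kbar} {P P' : Fin n → T.Pt} (h : T.IsHatPt x P)
    (h' : T.IsHatPt x P') : P = P' :=
  funext fun i => (h.2 i).unique (h'.2 i)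

-- On `W` the third components repeat the second ones, so the value of `ρ` determines all F_{ij} and
-- thereby the point.
variable {T} in
theorem IsHatPt.point_unique {x x' : Var n → Kbar} {P : Fin n → T.Pt} (h : T.IsHatPt x P)
    (h' : T.IsHatPt x' P) : x = x' := by
  have h2 : ∀ i s, eval x (quad T.parBar i s) = eval x' (quad T.parBar i s) := fun i s =>
    (frob k (T.a i)).injective (congrFun ((h.2 i).coord_unique (h'.2 i)) s)
  refine (quad3_bijective T.validPar_parBar).1 (funext fun i => funext fun r => ?_)
  change eval x (quad3 T.parBar i r) = eval x' (quad3 T.parBar i r)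
  have h02 := h.1 i
  have h02' := h'.1 i
  fin_cases r
  · exact h2 i 0
  · exact h2 i 1
  · exact h02.symm.trans ((h2 i 1).trans h02')

theorem V_subset_W : T.scene.V ⊆ T.scene.W := by
  rintro x ⟨P, hP⟩
  exact hP.1

theorem exists_θ_ne_zero (hn : 1 ≤ n) : ∃ j, T.scene.θ j ≠ 0 :=
  ⟨T.a ⟨0, hn⟩, (map_ne_zero _).mpr (T.θ.ne_zero _)⟩

/-! ### The degree condition for the secret blinding map -/

/-- If twist and position of a block match up to a multiple of `d` and a common shift, a
conjugate of the equation of the curve vanishes on the block. -/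
theorem degreeCond_of_twist [Fintype K] {R : ℕ} {sh : Shape n R} {b : Fin sh.arity} {c e : ℕ}
    (htw : sh.twist b + d * e = T.a (sh.pos b) + c) (hdeg : 6 ≤ sh.deg b) :
    DegreeCond k T.scene.V (quad T.parBar) sh b := by
  set Q := map (algebraMap K Kbar) (T.curvePoly (sh.pos b)) with hQ
  refine ⟨map (frob k c) Q, ?_, ?_, ?_⟩
  · rw [hQ, Ne, map_eq_zero_iff _ (map_injective _ (frob k (F := Kbar) c).injective),
      map_eq_zero_iff _ (map_injective _ (algebraMap K Kbar).injective)]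
    exact T.curvePoly_ne_zero _
  · exact (totalDegree_map_le _ _).trans ((totalDegree_map_le _ _).trans
      ((T.totalDegree_curvePoly_le _).trans hdeg))
  · rintro x ⟨P, hP⟩
    have hev : ∀ (a : ℕ) (z : Fin 2 → Kbar) (P : MvPolynomial (Fin 2) Kbar),
        eval (fun s => frob k a (z s)) (map (frob k a) P) = frob k a (eval z P) := fun a z P => by
      rw [eval_map]
      exact (eval₂_comp_left (frob k a) (RingHom.id Kbar) z P).symm
    -- The coefficients of the conjugated equation still come from `K`, so the Frobenius power with
    -- exponent d·e fixes them.
    have hfix : map (frob k (d * e)) (map (frob k c) Q) = map (frob k c) Q := by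
      rw [hQ, map_map, map_map, map_map]
      refine congrArg (fun g => map g (T.curvePoly _)) (RingHom.ext fun y => ?_)
      change frob k (d * e) (frob k c (algebraMap K Kbar y)) = frob k c (algebraMap K Kbar y)
      rw [frob_frob, add_comm, ← frob_frob, frob_mul_algebraMap T.θ]
    have h1 := congrArg (frob k c) (hP.2 (sh.pos b)).eval_curvePoly
    rw [← hev, map_zero, ← hQ] at h1
    -- The equation is known for the coordinates twisted by a_p + c, where p is the position of the
    -- block. This exponent differs from the twist of the block by d·e, which injectivity of
    -- Frobenius removes.
    apply (frob k (F := Kbar) (d * e)).injective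
    rw [← hev, hfix, map_zero]
    refine Eq.trans (congrArg (fun z => eval z (map (frob k c) Q)) (funext fun s => ?_)) h1
    rw [frob_frob, frob_frob, add_comm, htw, add_comm]

theorem slotCond [Fintype K] (f : T.type.Fun ⊕ (T.type.Map × Fin n × Fin 2)) :
    SlotCond T.type k T.scene.V (quad T.parBar) f := by
  rcases f with (⟨q, i, j⟩ | ⟨p, i⟩) | ⟨q, i, s⟩
  · let b : Fin (mapShape T.rows j.1 (fun p => ((T.a p : ℕ) + d - T.a j.1) % d) sumDeg q).arity :=
      ⟨0, mapShape_arity_pos _ _ _ _ q⟩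
    obtain ⟨h, hd⟩ := mapShape_twist T.rows j.1 (fun p => ((T.a p : ℕ) + d - T.a j.1) % d)
      sumDeg q b
    -- The twist is the remainder of a_p + d - a_r modulo `d`, with r the component of v_j. Hence
    -- the shift is d - a_r and `e` is the quotient of the division.
    refine ⟨b, T.degreeCond_of_twist (c := d - T.a j.1)
      (e := ((T.a ((mapShape T.rows j.1 (fun p => ((T.a p : ℕ) + d - T.a j.1) % d)
        sumDeg q).pos b) : ℕ) + d - T.a j.1) / d) ?_ ?_⟩
    · refine (congrArg (· + _) h).trans ((Nat.mod_add_div _ _).trans ?_)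
      exact Nat.add_sub_assoc (T.a j.1).isLt.le _
    · refine le_of_le_of_eq ?_ hd.symm
      cases q <;> simp [sumDeg, mapDeg]
  · obtain ⟨b, hb⟩ := exists_pairShape_deg i (T.a i : ℕ) p
    obtain ⟨h, hp⟩ := pairShape_twist i (T.a i : ℕ) p b
    refine ⟨b, T.degreeCond_of_twist (c := 0) (e := 0) ?_ hb⟩
    exact h.trans (congrArg (fun i => (T.a i : ℕ)) hp).symm
  · let b : Fin (mapShape T.rows i (fun p => (T.a p : ℕ)) mapDeg q).arity :=
      ⟨0, mapShape_arity_pos _ _ _ _ q⟩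
    obtain ⟨h, hd⟩ := mapShape_twist T.rows i (fun p => (T.a p : ℕ)) mapDeg q b
    refine ⟨b, T.degreeCond_of_twist (c := 0) (e := 0) h ?_⟩
    refine le_of_le_of_eq ?_ hd.symm
    cases q <;> simp [mapDeg]

end Setup

namespace Spec

variable {k K : Type*} [Field k] [Fintype k] [Field K] [Algebra k K]
variable {Kbar : Type*} [Field Kbar] [Algebra K Kbar] [Algebra k Kbar] [DecidableEq Kbar]
variable {n N d : ℕ} (T : Spec k K Kbar n N d) {M : Presentation n Kbar}

/-! ### The secret data are a solution -/

/-- Each generator contains a conjugate of some F_{i2} - F_{i3}. At a point of the descent its value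
is a conjugate of a value on `V`, which lies in `W`. -/
theorem ambiv_vanishesOn (R e : ℕ) {P : MvPolynomial (Fin R × DVar n d) Kbar}
    (hP : P ∈ T.ambiv (k := k) R e) : VanishesOn (T.scene.dom k R) P := by
  intro x hx
  induction hP using Submodule.span_induction with
  | mem P hP =>
    obtain ⟨m, r, a, i, -, rfl⟩ := hP
    obtain ⟨z, hz, h⟩ := hx r a a.isLt
    rw [map_mul, eval_rename]
    change _ * eval (fun s => x (r, s)) _ = 0
    rw [eval_map_desc h, ← quadDiff, eval_quadDiff (T.V_subset_W hz), map_zero, mul_zero]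
  | zero => simp
  | add P Q _ _ hP hQ => rw [map_add, hP, hQ, add_zero]
  | smul a P _ hP => rw [smul_eval, hP, mul_zero]

theorem eval_pub (f : T.type.Fun) (b : Bool) {x : Fin (T.type.fArgs f) × DVar n d → Kbar}
    (hx : x ∈ T.scene.dom k (T.type.fArgs f)) :
    eval x (T.pub f b) = eval x (T.raw T.loc (quad T.parBar) T.lin f b) := by
  have := T.ambiv_vanishesOn _ _ (T.pub_spec f b) x hx
  rwa [map_sub, sub_eq_zero] at this

/-- On the descent published and masked polynomials have equal values, so the conditions on
fractions become trivial. Those on evaluations are instances of `map_spec`. -/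
theorem secret_mem {c : M.B → Kbar} (hc : c ∈ M.adm) (hmaps : M.maps c = quad T.parBar) :
    ∃ v ∈ T.VT M, T.IsSecret M v := by
  let v : T.Unk M → Kbar := Sum.elim (Sum.elim T.loc c) T.lin
  have hv : T.mapsOf M v = quad T.parBar := hmaps
  refine ⟨v, ⟨⟨hc, ?_, T.lin_den, ?_⟩, ?_⟩, rfl, rfl, hv⟩
  · rw [hv]
    exact T.loc_den
  · intro q x y h
    rw [hv]
    exact h.2.2
  · rintro (f | ⟨⟨⟨q, x, y⟩, h⟩, i, s⟩)
    · intro z hz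
      change eval z (T.raw T.loc (T.mapsOf M v) T.lin f true * T.pub f false
        - T.pub f true * T.raw T.loc (T.mapsOf M v) T.lin f false) = 0
      rw [hv, map_sub, map_mul, map_mul, T.eval_pub f _ hz, T.eval_pub f _ hz, sub_self]
    · obtain ⟨-, ⟨P, Q, hP, hQ, hPQ⟩, -⟩ := h
      change eval (blockVal k (T.mapsOf M v) _ _) (mLoc T.type T.loc q i s true)
        = eval (blockVal k (T.mapsOf M v) _ _) (mLoc T.type T.loc q i s false)
          * frob k (T.a i : ℕ) (eval _ (T.mapsOf M v i s))
      rw [hv]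
      refine T.map_spec q i s _ _ (Q i)
        (fun t => frob k (T.a i) (eval (fun u => algebraMap K Kbar (y u)) (quad T.parBar i t)))
        (fun b => ?_) (hPQ i s) (hQ.2 i)
      have h1 := (hP ((T.type.mShape q i s).arg b)).2 ((T.type.mShape q i s).pos b)
      have htw : (T.type.mShape q i s).twist b = T.a ((T.type.mShape q i s).pos b) :=
        (Setup.mapShape_twist T.rows i (fun p => (T.a p : ℕ)) mapDeg q b).1
      rw [← htw] at h1
      exact h1

/-! ### Solutions and the systems that they determine -/

theorem hatPt_mem_V {x : Var n → Kbar} {P : Fin n → T.Pt} (h : T.IsHatPt x P) :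
    x ∈ T.scene.V := ⟨P, h⟩

/-- A solution is a decomposition of the system that it determines. -/
theorem mem_VS_sysOf {v : T.Unk M → Kbar} (hv : T.Meaningful M v) :
    v ∘ Sum.inl ∈ VS T.type k T.scene M (T.sysOf M v) :=
  ⟨hv.1, isDecomp_hiddenSys hv.2.1⟩

theorem rawSum_true (h : LocIdx T.type → Kbar) (H : Fin n → Fin 2 → MvPolynomial (Var n) Kbar)
    (l : Setup.LinIdx n N (Var n) → Kbar) (q : MapIx N) (i j : Var n) :
    T.rawSum h H l q i j true =
      T.hidSum h H q i j true * (T.sumForm l q i j 1 * T.sumForm l q i (Setup.nxt j) 1)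
        + T.hidSum h H q i j false
          * (T.sumForm l q i j 0 * T.sumForm l q i (Setup.nxt j) 1
            - T.sumForm l q i (Setup.nxt j) 0 * T.sumForm l q i j 1) := by
  rw [Setup.rawSum]
  ring

/-- The masked fraction is an affine-linear function of the hidden one; numerator and denominator
have this shape with forms that do not depend on the hidden function. -/
theorem exists_raw_eq (l : Setup.LinIdx n N (Var n) → Kbar) (f : T.type.Fun) :
    ∃ A B C : MvPolynomial (Fin (T.type.fArgs f) × DVar n d) Kbar,
      ∀ (h : LocIdx T.type → Kbar) (H : Fin n → Fin 2 → MvPolynomial (Var n) Kbar),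
        T.raw h H l f true = compose k T.scene.θ H (fLoc T.type h f true) * A
          + compose k T.scene.θ H (fLoc T.type h f false) * B ∧
        T.raw h H l f false = compose k T.scene.θ H (fLoc T.type h f false) * C := by
  rcases f with ⟨q, i, j⟩ | ⟨p, i⟩
  · let A : MvPolynomial (Fin (mapArgs q) × DVar n d) Kbar :=
      T.sumForm l q i j 1 * T.sumForm l q i (Setup.nxt j) 1
    let B : MvPolynomial (Fin (mapArgs q) × DVar n d) Kbar :=
      T.sumForm l q i j 0 * T.sumForm l q i (Setup.nxt j) 1
        - T.sumForm l q i (Setup.nxt j) 0 * T.sumForm l q i j 1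
    exact ⟨A, B, A, fun h H => ⟨T.rawSum_true h H l q i j, mul_assoc _ _ _⟩⟩
  · exact ⟨T.prodForm l p i, 0, T.prodForm l p (finRotate n i), fun h H =>
      ⟨((add_zero _).symm.trans (congrArg (_ + ·) (mul_zero _).symm)), rfl⟩⟩

/-- The published evaluations lie on the graphs of the maps that a solution determines. -/
theorem isEval_mem_graph {v : T.Unk M → Kbar} (hv : v ∈ T.VT M) {q : MapIx N}
    {x : Fin (mapArgs q) → Var n → K} {y : Var n → K} (h : T.IsEval q x y) :
    ((fun r s => algebraMap K Kbar (x r s)), fun s => algebraMap K Kbar (y s))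
      ∈ (T.sysOf M v).graph q := by
  obtain ⟨P, Q, hP, hQ, -⟩ := h.2.1
  exact ⟨fun r => T.hatPt_mem_V (hP r), hQ.1,
    fun i s => ⟨hv.1.2.2.2 q x y h i s, hv.2 (.inr (⟨⟨q, x, y⟩, h⟩, i, s))⟩⟩

/-- A decomposition of the system that a solution determines gives a solution,
with the same linear forms. -/
theorem mem_VT_of_mem_VS {v : T.Unk M → Kbar} (hv : v ∈ T.VT M)
    {w : LocIdx T.type ⊕ M.B → Kbar} (hw : w ∈ VS T.type k T.scene M (T.sysOf M v)) :
    Sum.elim w (v ∘ Sum.inr) ∈ T.VT M := by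
  refine ⟨⟨hw.1, fun f => (hw.2.1 f).1, hv.1.2.2.1, fun q x y h i s =>
    (hw.2.2 q _ (T.isEval_mem_graph hv h) i s).1⟩, ?_⟩
  rintro (f | ⟨⟨⟨q, x, y⟩, h⟩, i, s⟩)
  · obtain ⟨A, B, C, hraw⟩ := T.exists_raw_eq (v ∘ Sum.inr) f
    obtain ⟨hv1, hv0⟩ := hraw (T.locOf M v) (T.mapsOf M v)
    obtain ⟨hw1, hw0⟩ := hraw (w ∘ Sum.inl) (mapsS T.type M w)
    -- It suffices to prove the equation after multiplication by the denominator of the hidden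
    -- function of `v`, which is not a zero divisor.
    apply hv.1.2.1 f
    intro z hz
    have h1 := hv.2 (.inl f) z hz
    have h2 := (hw.2.1 f).2 z hz
    change eval z ((T.raw (w ∘ Sum.inl) (mapsS T.type M w) (v ∘ Sum.inr) f true * T.pub f false
      - T.pub f true * T.raw (w ∘ Sum.inl) (mapsS T.type M w) (v ∘ Sum.inr) f false) * _) = 0
    rw [hw1, hw0]
    rw [hv1, hv0] at h1
    change eval z (_ * compose k T.scene.θ (T.mapsOf M v) (fLoc T.type (T.locOf M v) f false)
      - compose k T.scene.θ (T.mapsOf M v) (fLoc T.type (T.locOf M v) f true) * _) = 0 at h2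
    simp only [map_sub, map_add, map_mul] at h1 h2 ⊢
    -- With `h1` the condition for `v` and `h2` the equality of the two hidden fractions, the masks
    -- `A`, `B`, `C` agree for `v` and `w`, and `B` and `C` cancel after cross-multiplication.
    linear_combination eval z (compose k T.scene.θ (mapsS T.type M w)
      (fLoc T.type (w ∘ Sum.inl) f false)) * h1 + eval z A * eval z (T.pub f false) * h2
  · exact (hw.2.2 q _ (T.isEval_mem_graph hv h) i s).2

/-- Decompositions are completed by the linear forms of `v`, which are constants of the morphism. -/
theorem locallyEmbedded {v : T.Unk M → Kbar} (hv : v ∈ T.VT M) :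
    LocallyEmbedded (VSt T.type k T.scene M (T.sysOf M v)) (T.VTt M) (T.tilde M v) := by
  let φ : T.UnkT M → MvPolynomial (LocIdx T.type ⊕ M.B') Kbar :=
    Sum.elim X fun j => C (T.tildeLin (v ∘ Sum.inr) j)
  have hφ : ∀ u, polyMap φ u = Sum.elim u (T.tildeLin (v ∘ Sum.inr)) := by
    intro u
    funext e
    cases e <;> simp [polyMap, φ]
  refine ⟨φ, ?_, ?_, ⟨tildeS T.type M (v ∘ Sum.inl), ⟨_, T.mem_VS_sysOf hv.1, rfl⟩, hφ _⟩⟩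
  · rintro _ ⟨w, hw, rfl⟩
    rw [hφ]
    exact ⟨_, T.mem_VT_of_mem_VS hv hw, rfl⟩
  · intro u _ u' _ h
    rw [hφ, hφ] at h
    funext e
    exact congrFun h (.inl e)

/-- Coefficients of linear forms are recovered by division by one nonzero element of the basis; the
blinding part is handled by `tilde_injective` of the presentation. -/
theorem tilde_injective {τ : Type} (hM : M.Lawful k T.scene τ) (hn : 1 ≤ n) :
    Function.Injective (T.tilde M) := by
  intro v v' h
  funext e
  rcases e with (e | e) | e
  · exact congrFun h (.inl (.inl e))
  · have : M.tilde (fun e => v (.inl (.inr e))) = M.tilde fun e => v' (.inl (.inr e)) :=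
      funext fun b => congrFun h (.inl (.inr b))
    exact congrFun (hM.tilde_injective this) e
  · obtain ⟨j, hj⟩ := T.exists_θ_ne_zero hn
    rcases e with ⟨f, m, r, s⟩ | ⟨f, r, s⟩
    · exact mul_right_cancel₀ hj (congrFun h (.inr (.inl ⟨f, m, r, s, j⟩)))
    · exact mul_right_cancel₀ hj (congrFun h (.inr (.inr ⟨f, r, s, j⟩)))

/-! ### Published evaluations -/

/-- A point of Ê and its tuple of curve points determine each other. Evaluations can therefore be
counted by their arguments. -/
theorem IsEval.unique {T : Spec k K Kbar n N d} {q : MapIx N}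
    {x : Fin (mapArgs q) → Var n → K} {y y' : Var n → K} (h : T.IsEval q x y)
    (h' : T.IsEval q x y') : y = y' := by
  obtain ⟨P, Q, hP, hQ, hPQ⟩ := h.2.1
  obtain ⟨P', Q', hP', hQ', hPQ'⟩ := h'.2.1
  have hPP : P = P' := by
    funext r
    exact Setup.IsHatPt.unique (hP r) (hP' r)
  rw [← hPP] at hPQ'
  have hQQ : Q = Q' := by
    funext i
    rw [(hPQ i 0).2, (hPQ' i 0).2]
  rw [← hQQ] at hQ'
  funext s
  exact (algebraMap K Kbar).injective (congrFun (hQ.point_unique hQ') s)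

/-- A published evaluation is determined by the map and the arguments. -/
def evalArgs (c : {c : (q : MapIx N) × ((Fin (mapArgs q) → Var n → K) × (Var n → K)) //
    T.IsEval c.1 c.2.1 c.2.2}) : (q : MapIx N) × (Fin (mapArgs q) → T.pts) :=
  ⟨c.1.1, fun r => ⟨c.1.2.1 r, c.2.1 r⟩⟩

theorem evalArgs_injective : Function.Injective T.evalArgs := by
  rintro ⟨⟨q, x, y⟩, h⟩ ⟨⟨q', x', y'⟩, h'⟩ he
  obtain ⟨rfl, he⟩ := Sigma.mk.inj_iff.mp he
  have hx : x = x' := funext fun r => congrArg Subtype.val (congrFun (eq_of_heq he) r)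
  subst hx
  obtain rfl := IsEval.unique h h'
  rfl

end Spec

/-! ### Conditions as polynomial equations -/

section Equations

variable {F : Type*} [Field F]

/-- For polynomials of bounded degree, vanishing on a set amounts to vanishing at
finitely many of its points, at most as many as there are monomials. -/
theorem exists_finset_vanishesOn {σ : Type} [Fintype σ] [DecidableEq σ] (X : Set (σ → F))
    (D : ℕ) : ∃ s : Finset (σ → F), s.card ≤ Fintype.card (Mono σ D) ∧
      ∀ P : MvPolynomial σ F, P.totalDegree ≤ D → (VanishesOn X P ↔ ∀ x ∈ s, eval x P = 0) := by
  classical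
  -- A polynomial of degree at most `D` is a linear functional of the vector of monomial values at a
  -- point. It vanishes on `X` once it vanishes at points whose vectors form a basis of the span.
  let ev : (σ → F) → Mono σ D → F := fun x e => ∏ u, x u ^ (e.1 u : ℕ)
  let L : MvPolynomial σ F → (Mono σ D → F) →ₗ[F] F := fun P =>
    ∑ e : Mono σ D, coeff e.exp P • LinearMap.proj e
  have hL : ∀ P : MvPolynomial σ F, P.totalDegree ≤ D → ∀ x, L P (ev x) = eval x P := by
    intro P hP x
    conv_rhs => rw [← polyOf_coeff hP]
    refine Eq.trans ?_ (eval₂_polyOf (RingHom.id F) x _).symm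
    simp [L, ev]
  obtain ⟨t, htX, htc, hts, -⟩ := Submodule.exists_finset_span_eq_linearIndepOn F (ev '' X)
  choose! g hgX hg using htX
  refine ⟨t.image g, ?_, fun P hP => ⟨fun h x hx => ?_, fun h x hx => ?_⟩⟩
  · refine Finset.card_image_le.trans (htc.le.trans ((Submodule.finrank_le _).trans ?_))
    rw [Module.finrank_fintype_fun_eq_card]
  · obtain ⟨w, hw, rfl⟩ := Finset.mem_image.mp hx
    exact h _ (hgX hw)
  · have hker : Submodule.span F (ev '' X) ≤ LinearMap.ker (L P) := by
      rw [← hts, Submodule.span_le]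
      intro w hw
      change L P w = 0
      rw [← hg hw, hL P hP]
      exact h _ (Finset.mem_image_of_mem g hw)
    rw [← hL P hP]
    exact hker (Submodule.subset_span (Set.mem_image_of_mem ev hx))

theorem polyFun_localPoly {σ ι : Type*} {t : ι → σ → F} {n R : ℕ} {sh : Shape n R}
    {c : ι → sh.BMono → F} {z : ι → sh.LVar → F} (hc : ∀ e, PolyFun t fun v => c v e)
    (hz : ∀ bs, PolyFun t fun v => z v bs) :
    PolyFun t fun v => eval (z v) (localPoly (c v)) := by
  simp only [eval_localPoly]
  exact PolyFun.sum _ fun e _ => (hc e).mul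
    (PolyFun.prod _ fun b _ => PolyFun.prod _ fun s _ => (hz (b, s)).pow _)

/-- Each block variable is replaced by a polynomial of degree at most 2, as descent, Frobenius and
renaming do not raise degrees. -/
theorem totalDegree_compose_le {k : Type*} [Field k] [Fintype k] [Algebra k F] {n d : ℕ}
    (θ : Fin d → F) {H : Fin n → Fin 2 → MvPolynomial (Var n) F}
    (hH : ∀ i s, (H i s).totalDegree ≤ 2) {R : ℕ} {sh : Shape n R} (P : MvPolynomial sh.LVar F) :
    (compose k θ H P).totalDegree ≤ 2 * P.totalDegree :=
  totalDegree_aeval_le_mul _ (fun _ => (totalDegree_rename_le _ _).trans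
    ((totalDegree_map_le _ _).trans ((totalDegree_desc_le _ _).trans (hH _ _)))) P

end Equations

/-! ### Degrees of the masked polynomials and their dependence on the unknowns. -/

namespace Spec

variable {k K : Type*} [Field k] [Fintype k] [Field K] [Algebra k K]
variable {Kbar : Type*} [Field Kbar] [Algebra K Kbar] [Algebra k Kbar] [DecidableEq Kbar]
variable {n N d : ℕ} (T : Spec k K Kbar n N d) {M : Presentation n Kbar}

theorem totalDegree_linPoly_le {R : ℕ} (l : Fin R × Var n → Kbar) :
    (T.linPoly l).totalDegree ≤ 1 :=
  totalDegree_finsetSum_le fun _ _ => totalDegree_finsetSum_le fun _ _ =>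
    totalDegree_finsetSum_le fun _ _ => (totalDegree_mul _ _).trans
      (by rw [totalDegree_C, totalDegree_X, zero_add])

/-- Two blocks of degree 8·8 give 128, while doubling has one block of degree 8·14 = 112. -/
theorem sum_deg_mapShape_le (rows : Fin N → Fin n → Fin 2 → Fin n) (r : Fin n) (tw : Fin n → ℕ)
    (q : MapIx N) : ∑ b, (mapShape rows r tw sumDeg q).deg b ≤ 128 := by
  cases q
  · change ∑ _b : Fin 2, 8 * 8 ≤ 128
    simp
  · change ∑ _b : Fin 1, 8 * 14 ≤ 128
    simp
  · change ∑ _b : Fin 2, 8 * 8 ≤ 128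
    simp

theorem sum_deg_pairShape_le (i : Fin n) (a : ℕ) (p : PairIx) :
    ∑ b, (pairShape i a p).deg b ≤ 128 := by
  cases p
  · change ∑ b : Fin 3, (![6, 6, 2] : Fin 3 → ℕ) b ≤ 128
    simp [Fin.sum_univ_three]
  · change ∑ b : Fin 2, (![10, 2] : Fin 2 → ℕ) b ≤ 128
    simp

theorem totalDegree_hidSum_le (h : LocIdx T.type → Kbar)
    {H : Fin n → Fin 2 → MvPolynomial (Var n) Kbar} (hH : ∀ i s, (H i s).totalDegree ≤ 2)
    (q : MapIx N) (i j : Var n) (b : Bool) : (T.hidSum h H q i j b).totalDegree ≤ 256 :=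
  (totalDegree_compose_le _ hH _).trans (Nat.mul_le_mul_left 2
    ((totalDegree_localPoly_le _).trans (sum_deg_mapShape_le _ _ _ q)))

theorem totalDegree_hidProd_le (h : LocIdx T.type → Kbar)
    {H : Fin n → Fin 2 → MvPolynomial (Var n) Kbar} (hH : ∀ i s, (H i s).totalDegree ≤ 2)
    (p : PairIx) (i : Fin n) (b : Bool) : (T.hidProd h H p i b).totalDegree ≤ 256 :=
  (totalDegree_compose_le _ hH _).trans (Nat.mul_le_mul_left 2
    ((totalDegree_localPoly_le _).trans (sum_deg_pairShape_le _ _ p)))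

/-- Hidden polynomials have degree at most 2·128, and a masked term of a sum has two linear forms as
further factors. -/
theorem totalDegree_raw_le (h : LocIdx T.type → Kbar)
    {H : Fin n → Fin 2 → MvPolynomial (Var n) Kbar} (hH : ∀ i s, (H i s).totalDegree ≤ 2)
    (l : Setup.LinIdx n N (Var n) → Kbar) (f : T.type.Fun) (b : Bool) :
    (T.raw h H l f b).totalDegree ≤ 258 := by
  have hmul : ∀ {σ : Type} {P Q : MvPolynomial σ Kbar} {a b : ℕ}, P.totalDegree ≤ a →
      Q.totalDegree ≤ b → (P * Q).totalDegree ≤ a + b := fun hP hQ =>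
    (totalDegree_mul _ _).trans (Nat.add_le_add hP hQ)
  rcases f with ⟨q, i, j⟩ | ⟨p, i⟩
  · have hf := fun b => T.totalDegree_hidSum_le h hH q i j b
    have hl : ∀ j m, (T.sumForm l q i j m).totalDegree ≤ 1 := fun j m =>
      T.totalDegree_linPoly_le _
    cases b
    · exact hmul (hmul (hf _) (hl _ _)) (hl _ _)
    · refine (totalDegree_sub _ _).trans (max_le ((totalDegree_add _ _).trans (max_le ?_ ?_)) ?_)
      · exact hmul (hmul (hf _) (hl _ _)) (hl _ _)
      · exact (hmul (hmul (hl _ _) (hf _)) (hl _ _)).trans (by norm_num)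
      · exact (hmul (hmul (hl _ _) (hf _)) (hl _ _)).trans (by norm_num)
  · have hf := fun b => T.totalDegree_hidProd_le h hH p i b
    have hl : ∀ i, (T.prodForm l p i).totalDegree ≤ 1 := fun i => T.totalDegree_linPoly_le _
    cases b
    · exact (hmul (hf _) (hl _)).trans (by norm_num)
    · exact (hmul (hf _) (hl _)).trans (by norm_num)

theorem totalDegree_ambiv_le {R e : ℕ} {P : MvPolynomial (Fin R × DVar n d) Kbar}
    (hP : P ∈ T.ambiv (k := k) R e) : P.totalDegree ≤ e := by
  rw [← mem_restrictTotalDegree]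
  refine Submodule.span_le.mpr ?_ hP
  rintro _ ⟨m, r, a, i, hm, rfl⟩
  rw [SetLike.mem_coe, mem_restrictTotalDegree]
  refine (totalDegree_mul _ _).trans (le_trans (Nat.add_le_add ?_ ?_) hm)
  · exact totalDegree_monomial_le _ _
  · exact (totalDegree_rename_le _ _).trans ((totalDegree_map_le _ _).trans
      ((totalDegree_desc_le _ _).trans (totalDegree_quadDiff_le _ _)))

/-- The bound 258 for the masked polynomial, plus the extra degree allowed in the ideal of
ambivalence. -/
theorem totalDegree_pub_le (f : T.type.Fun) (b : Bool) : (T.pub f b).totalDegree ≤ 260 := by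
  have hraw := T.totalDegree_raw_le T.loc (fun i s => totalDegree_quad3_le T.parBar i s.castSucc)
    T.lin f b
  have hextra : T.extra f ≤ 2 := by
    rcases f with f | f
    exacts [le_rfl, one_le_two]
  have hdiff := T.totalDegree_ambiv_le (T.pub_spec f b)
  rw [← sub_add_cancel (T.pub f b) (T.raw T.loc (quad T.parBar) T.lin f b)]
  exact (totalDegree_add _ _).trans (max_le
    (hdiff.trans (Nat.add_le_add hraw hextra)) (hraw.trans (by norm_num)))

variable (M) in
theorem polyFun_loc (e : LocIdx T.type) : PolyFun (T.tilde M) fun v => T.locOf M v e :=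
  PolyFun.coord (t := T.tilde M) (.inl (.inl e))

theorem polyFun_of_tilde {g : (M.B → Kbar) → Kbar} (hg : PolyFun M.tilde g) :
    PolyFun (T.tilde M) fun v => g fun e => v (.inl (.inr e)) :=
  hg.comp (f := fun (v : T.Unk M → Kbar) e => v (.inl (.inr e))) fun s =>
    PolyFun.coord (t := T.tilde M) (.inl (.inr s))

-- The coefficients of the descended form, products of an unknown and a basis element, are exactly
-- the coordinates introduced by `tildeLin`.
variable (M) in
theorem polyFun_sumForm (q : MapIx N) (i j : Var n) (m : Fin 2)
    (x : Fin (mapArgs q) × DVar n d → Kbar) :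
    PolyFun (T.tilde M) fun v => eval x (T.sumForm (v ∘ Sum.inr) q i j m) := by
  simp only [Setup.sumForm, Setup.linPoly, map_sum, map_mul, eval_C, eval_X]
  exact PolyFun.sum _ fun r _ => PolyFun.sum _ fun s _ => PolyFun.sum _ fun u _ =>
    (PolyFun.coord (t := T.tilde M) (.inr (.inl ⟨(q, i, j), m, r, s, u⟩))).mul (PolyFun.const _)

variable (M) in
theorem polyFun_prodForm (p : PairIx) (i : Fin n) (x : Fin (pairArgs p) × DVar n d → Kbar) :
    PolyFun (T.tilde M) fun v => eval x (T.prodForm (v ∘ Sum.inr) p i) := by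
  simp only [Setup.prodForm, Setup.linPoly, map_sum, map_mul, eval_C, eval_X]
  exact PolyFun.sum _ fun r _ => PolyFun.sum _ fun s _ => PolyFun.sum _ fun u _ =>
    (PolyFun.coord (t := T.tilde M) (.inr (.inr ⟨(p, i), r, s, u⟩))).mul (PolyFun.const _)

variable {τ : Type} (hM : M.Lawful k T.scene τ)

include hM

/-- At a fixed point the blocks are polynomials in the blinding coordinates, and a local polynomial
is polynomial in its coefficients and its arguments. -/
theorem polyFun_compose (f : T.type.Fun) (b : Bool)
    (x : Fin (T.type.fArgs f) × DVar n d → Kbar) :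
    PolyFun (T.tilde M) fun v =>
      eval x (compose k T.scene.θ (T.mapsOf M v) (fLoc T.type (T.locOf M v) f b)) := by
  simp only [eval_compose, eval_blockPoly]
  exact polyFun_localPoly (fun e => T.polyFun_loc M (.inl ⟨f, b, e⟩))
    fun bs => T.polyFun_of_tilde (hM.polyFun_eval_desc _ _ _ _)

theorem polyFun_rawSum (q : MapIx N) (i j : Var n) (b : Bool)
    (x : Fin (mapArgs q) × DVar n d → Kbar) :
    PolyFun (T.tilde M) fun v =>
      eval x (T.rawSum (T.locOf M v) (T.mapsOf M v) (v ∘ Sum.inr) q i j b) := by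
  have hf : ∀ b, PolyFun (T.tilde M) fun v =>
      eval x (T.hidSum (T.locOf M v) (T.mapsOf M v) q i j b) := fun b =>
    T.polyFun_compose hM (.inl (q, i, j)) b x
  have hl := fun j m => T.polyFun_sumForm M q i j m x
  cases b
  · simp only [Setup.rawSum, map_mul]
    exact ((hf _).mul (hl _ _)).mul (hl _ _)
  · simp only [Setup.rawSum, map_sub, map_add, map_mul]
    exact ((((hf _).mul (hl _ _)).mul (hl _ _)).add (((hl _ _).mul (hf _)).mul (hl _ _))).sub
      (((hl _ _).mul (hf _)).mul (hl _ _))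

theorem polyFun_rawProd (p : PairIx) (i : Fin n) (b : Bool)
    (x : Fin (pairArgs p) × DVar n d → Kbar) :
    PolyFun (T.tilde M) fun v =>
      eval x (T.rawProd (T.locOf M v) (T.mapsOf M v) (v ∘ Sum.inr) p i b) := by
  have hf : ∀ b, PolyFun (T.tilde M) fun v =>
      eval x (T.hidProd (T.locOf M v) (T.mapsOf M v) p i b) := fun b =>
    T.polyFun_compose hM (.inr (p, i)) b x
  have hl := fun i => T.polyFun_prodForm M p i x
  cases b
  · simp only [Setup.rawProd, map_mul]
    exact (hf _).mul (hl _)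
  · simp only [Setup.rawProd, map_mul]
    exact (hf _).mul (hl _)

theorem polyFun_raw (f : T.type.Fun) (b : Bool) (x : Fin (T.type.fArgs f) × DVar n d → Kbar) :
    PolyFun (T.tilde M) fun v =>
      eval x (T.raw (T.locOf M v) (T.mapsOf M v) (v ∘ Sum.inr) f b) := by
  rcases f with f | f
  · exact T.polyFun_rawSum hM f.1 f.2.1 f.2.2 b x
  · exact T.polyFun_rawProd hM f.1 f.2 b x

/-- After clearing denominators the degree is at most 258 + 260 = 518. One equation results for each
of the finitely many test points, which do not depend on the unknowns. -/
theorem exists_equations_fun (f : T.type.Fun) :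
    ∃ Eqs : Finset (MvPolynomial (T.UnkT M) Kbar),
      Eqs.card ≤ Fintype.card (Mono (Fin (T.type.fArgs f) × DVar n d) 518) ∧
      ∀ v, T.Cond M v (.inl f) ↔ ∀ P ∈ Eqs, eval (T.tilde M v) P = 0 := by
  classical
  obtain ⟨s, hs, hX⟩ := exists_finset_vanishesOn (T.scene.dom k (T.type.fArgs f)) 518
  have hp : ∀ x, PolyFun (T.tilde M) fun v =>
      eval x (T.raw (T.locOf M v) (T.mapsOf M v) (v ∘ Sum.inr) f true * T.pub f false
        - T.pub f true * T.raw (T.locOf M v) (T.mapsOf M v) (v ∘ Sum.inr) f false) := by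
    intro x
    simp only [map_sub, map_mul]
    exact ((T.polyFun_raw hM f true x).mul (PolyFun.const _)).sub
      ((PolyFun.const _).mul (T.polyFun_raw hM f false x))
  choose p hp using hp
  refine ⟨s.image p, Finset.card_image_le.trans hs, fun v => ?_⟩
  have hH : ∀ i s, (T.mapsOf M v i s).totalDegree ≤ 2 := hM.totalDegree_maps_le _
  have hdeg := fun b => T.totalDegree_raw_le (T.locOf M v) hH (v ∘ Sum.inr) f b
  refine (hX _ ((totalDegree_sub _ _).trans (max_le ?_ ?_))).trans ?_
  · exact (totalDegree_mul _ _).trans (Nat.add_le_add (hdeg _) (T.totalDegree_pub_le f _))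
  · refine (totalDegree_mul _ _).trans ?_
    rw [add_comm]
    exact Nat.add_le_add (hdeg _) (T.totalDegree_pub_le f _)
  · simp only [Finset.forall_mem_image, hp]

theorem exists_equation_map (c : {c : (q : MapIx N) × ((Fin (mapArgs q) → Var n → K)
      × (Var n → K)) // T.IsEval c.1 c.2.1 c.2.2}) (i : Fin n) (s : Fin 2) :
    ∃ P : MvPolynomial (T.UnkT M) Kbar,
      ∀ v, T.Cond M v (.inr (c, i, s)) ↔ eval (T.tilde M v) P = 0 := by
  have hloc : ∀ b, PolyFun (T.tilde M) fun v =>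
      eval (blockVal k (T.mapsOf M v) (T.type.mShape c.1.1 i s)
        fun r s => algebraMap K Kbar (c.1.2.1 r s))
        (mLoc T.type (T.locOf M v) c.1.1 i s b) := fun b =>
    polyFun_localPoly (fun e => T.polyFun_loc M (.inr ⟨(c.1.1, i, s), b, e⟩))
      fun bs => T.polyFun_of_tilde (hM.polyFun_eval _ _ _ _)
  obtain ⟨P, hP⟩ := (hloc true).sub ((hloc false).mul (T.polyFun_of_tilde
    (hM.polyFun_eval (T.a i : ℕ) (fun t => algebraMap K Kbar (c.1.2.2 t)) i s)))
  refine ⟨P, fun v => ?_⟩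
  rw [hP]
  exact sub_eq_zero.symm

end Spec

/-! ### Polynomial bounds -/

/-- `g` is bounded by a polynomial in `n`, for parameters in the range of the theorem. -/
def PolyBdd (C₀ : ℕ) (g : ℕ → ℕ → ℕ → ℕ → ℕ) : Prop :=
  ∃ C : ℕ, ∀ n N d p, 1 ≤ n → N ≤ C₀ * n ^ 2 → d ≤ C₀ * n → p ≤ C₀ * n ^ C₀ →
    g n N d p ≤ C * n ^ C

namespace PolyBdd

variable {C₀ : ℕ} {g g' : ℕ → ℕ → ℕ → ℕ → ℕ}

/-- One constant has to serve as factor and as exponent; for positive `n` the sum of both does. -/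
theorem of_le (a b : ℕ) (h : ∀ n N d p, 1 ≤ n → N ≤ C₀ * n ^ 2 → d ≤ C₀ * n → p ≤ C₀ * n ^ C₀ →
    g n N d p ≤ a * n ^ b) : PolyBdd C₀ g :=
  ⟨a + b, fun n N d p hn hN hd hp => (h n N d p hn hN hd hp).trans
    (Nat.mul_le_mul (Nat.le_add_right a b) (Nat.pow_le_pow_right hn (Nat.le_add_left b a)))⟩

theorem const (c : ℕ) : PolyBdd C₀ fun _ _ _ _ => c :=
  of_le c 0 fun _ _ _ _ _ _ _ _ => by simp

theorem fst : PolyBdd C₀ fun n _ _ _ => n := of_le 1 1 fun _ _ _ _ _ _ _ _ => by simp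

theorem snd : PolyBdd C₀ fun _ N _ _ => N := of_le C₀ 2 fun _ _ _ _ _ h _ _ => h

theorem thd : PolyBdd C₀ fun _ _ d _ => d := of_le C₀ 1 fun _ _ _ _ _ _ h _ => by simpa using h

theorem fth : PolyBdd C₀ fun _ _ _ p => p := of_le C₀ C₀ fun _ _ _ _ _ _ _ h => h

theorem add (h : PolyBdd C₀ g) (h' : PolyBdd C₀ g') :
    PolyBdd C₀ fun n N d p => g n N d p + g' n N d p := by
  obtain ⟨C, hC⟩ := h
  obtain ⟨C', hC'⟩ := h'
  refine ⟨C + C', fun n N d p hn hN hd hp => ?_⟩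
  rw [add_mul]
  exact Nat.add_le_add
    ((hC n N d p hn hN hd hp).trans (Nat.mul_le_mul_left _
      (Nat.pow_le_pow_right hn (Nat.le_add_right _ _))))
    ((hC' n N d p hn hN hd hp).trans (Nat.mul_le_mul_left _
      (Nat.pow_le_pow_right hn (Nat.le_add_left _ _))))

theorem mul (h : PolyBdd C₀ g) (h' : PolyBdd C₀ g') :
    PolyBdd C₀ fun n N d p => g n N d p * g' n N d p := by
  obtain ⟨C, hC⟩ := h
  obtain ⟨C', hC'⟩ := h'
  refine of_le (C * C') (C + C') fun n N d p hn hN hd hp => ?_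
  rw [pow_add, mul_mul_mul_comm]
  exact Nat.mul_le_mul (hC n N d p hn hN hd hp) (hC' n N d p hn hN hd hp)

theorem pow (h : PolyBdd C₀ g) (m : ℕ) : PolyBdd C₀ fun n N d p => g n N d p ^ m := by
  induction m with
  | zero => simpa using const 1
  | succ m ih =>
    simp only [pow_succ]
    exact ih.mul h

end PolyBdd

/-- A bound for the number of local functions. -/
def funBound (n N : ℕ) : ℕ := (N + 2) * (n * 3 * (n * 3)) + 2 * n

/-- A bound for the number of coefficients of a local polynomial. -/
def monoBound : ℕ := ((112 + 1) ^ 2) ^ 3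

/-- A bound for the number of coefficients of all local functions. -/
def locBound (n N : ℕ) : ℕ :=
  funBound n N * (2 * monoBound) + (N + 2) * (n * 2) * (2 * monoBound)

/-- A bound for the number of coefficients of the descents of the linear forms. -/
def linBound (n N d : ℕ) : ℕ :=
  (N + 2) * (n * 3 * (n * 3)) * (2 * (2 * (n * 3 * d))) + 2 * n * (3 * (n * 3 * d))

/-- A bound for the number of conditions. -/
def condBound (n N p : ℕ) : ℕ := funBound n N + (N + 2) * p ^ 2 * (n * 2)

/-- A bound for the number of equations to which a condition amounts. -/
def eqBound (n d : ℕ) : ℕ := (3 * (n * 3 * d) + 1) ^ 518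

/-- A bound for the number of coefficients of the descents of the `H_{ij}`. -/
def coeffsBound (n d : ℕ) : ℕ := n * (2 * (n * 3 * d + 1) ^ 2)

/-- The number of blinding parameters. -/
def paramsBound (n : ℕ) : ℕ := n * 3 * (n * 3) + n * (3 * 3 + (3 * 3 + (3 + 6)))

/-- A common bound for all these numbers. -/
def totalBound (n N d p : ℕ) : ℕ :=
  locBound n N + coeffsBound n d + paramsBound n + linBound n N d + condBound n N p
    + eqBound n d + 1

theorem polyBdd_totalBound (C₀ : ℕ) : PolyBdd C₀ totalBound := by
  have n : PolyBdd C₀ fun n _ _ _ => n := .fst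
  have N2 : PolyBdd C₀ fun _ N _ _ => N + 2 := .add .snd (.const 2)
  have d : PolyBdd C₀ fun _ _ d _ => d := .thd
  have p : PolyBdd C₀ fun _ _ _ p => p := .fth
  have n3 : PolyBdd C₀ fun n _ _ _ => n * 3 := n.mul (.const 3)
  have nd : PolyBdd C₀ fun n _ d _ => n * 3 * d := n3.mul d
  have s : PolyBdd C₀ fun n N _ _ => (N + 2) * (n * 3 * (n * 3)) := N2.mul (n3.mul n3)
  have n2 : PolyBdd C₀ fun n _ _ _ => 2 * n := (PolyBdd.const 2).mul n
  have f : PolyBdd C₀ fun n N _ _ => funBound n N := s.add n2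
  have m : PolyBdd C₀ fun n N _ _ => 2 * monoBound := .const _
  have loc : PolyBdd C₀ fun n N _ _ => locBound n N :=
    (f.mul m).add ((N2.mul (n.mul (.const 2))).mul m)
  have lin : PolyBdd C₀ fun n N d _ => linBound n N d :=
    (s.mul ((PolyBdd.const 2).mul ((PolyBdd.const 2).mul nd))).add
      (n2.mul ((PolyBdd.const 3).mul nd))
  have cond : PolyBdd C₀ fun n N _ p => condBound n N p :=
    f.add ((N2.mul (p.pow 2)).mul (n.mul (.const 2)))
  have eq : PolyBdd C₀ fun n _ d _ => eqBound n d :=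
    (((PolyBdd.const 3).mul nd).add (.const 1)).pow 518
  have coeffs : PolyBdd C₀ fun n _ d _ => coeffsBound n d :=
    n.mul ((PolyBdd.const 2).mul ((nd.add (.const 1)).pow 2))
  have params : PolyBdd C₀ fun n _ _ _ => paramsBound n := (n3.mul n3).add (n.mul (.const _))
  exact (((((loc.add coeffs).add params).add lin).add cond).add eq).add (.const 1)

/-! ### Counting -/

theorem card_mapIx_le (N : ℕ) : Fintype.card (MapIx N) ≤ N + 2 := by
  have h : Function.Injective (fun q : MapIx N => match q with
      | .add => (Sum.inr 0 : Fin N ⊕ Fin 2)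
      | .dbl => Sum.inr 1
      | .phi t => Sum.inl t) := by
    rintro (_ | _ | t) (_ | _ | t') h <;> simp_all
  simpa using Fintype.card_le_of_injective _ h

theorem card_pairIx : Fintype.card PairIx = 2 := rfl

theorem mapArgs_le {N : ℕ} (q : MapIx N) : mapArgs q ≤ 2 := by
  cases q <;> simp [mapArgs]

theorem pairArgs_le (p : PairIx) : pairArgs p ≤ 3 := by
  cases p <;> simp [pairArgs]

theorem card_sigma_le {ι : Type} [Fintype ι] {κ : ι → Type} [∀ i, Fintype (κ i)] {a b : ℕ}
    (ha : Fintype.card ι ≤ a) (hb : ∀ i, Fintype.card (κ i) ≤ b) :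
    Fintype.card (Σ i, κ i) ≤ a * b := by
  rw [Fintype.card_sigma]
  calc ∑ i, Fintype.card (κ i) ≤ ∑ _i : ι, b := Finset.sum_le_sum fun i _ => hb i
    _ = Fintype.card ι * b := by simp
    _ ≤ a * b := Nat.mul_le_mul_right _ ha

/-- The largest block degree is 8·14 = 112, which occurs for the doubling map. -/
theorem card_mapShape_bmono_le {n N : ℕ} (rows : Fin N → Fin n → Fin 2 → Fin n) (r : Fin n)
    (tw : Fin n → ℕ) (D : MapIx N → ℕ) (hD : ∀ q, D q ≤ 112) (q : MapIx N) :
    Fintype.card (mapShape rows r tw D q).BMono ≤ monoBound := by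
  refine card_bmono_le ?_ fun b => (Setup.mapShape_twist rows r tw D q b).2.trans_le (hD q)
  cases q <;> simp [mapShape]

theorem card_pairShape_bmono_le {n : ℕ} (i : Fin n) (a : ℕ) (p : PairIx) :
    Fintype.card (pairShape i a p).BMono ≤ monoBound := by
  refine card_bmono_le ?_ ?_
  · cases p <;> simp [pairShape]
  · cases p
    · change ∀ b : Fin 3, (![6, 6, 2] : Fin 3 → ℕ) b ≤ 112
      decide
    · change ∀ b : Fin 2, (![10, 2] : Fin 2 → ℕ) b ≤ 112
      decide

/-- Each numerator has at least the coefficient of the constant monomial. -/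
theorem card_fun_le_card_locIdx {n : ℕ} (Y : SysType n) :
    Fintype.card Y.Fun ≤ Fintype.card (LocIdx Y) :=
  Fintype.card_le_of_injective
    (fun f => .inl ⟨f, true, ⟨fun _ _ => 0, fun b => by simp⟩⟩) fun _ _ h =>
      congrArg Sigma.fst (Sum.inl_injective h)

/-- The coefficients of the quadratic polynomials given by blinding parameters. -/
def quadCoeffs {n : ℕ} {F : Type*} [Field F] (c : ParIdx n → F) : BlindIdx n (Var n) → F :=
  fun ise => coeff ise.2.2.exp (quad c ise.1 ise.2.1)

theorem blindPoly_quadCoeffs {n : ℕ} {F : Type*} [Field F] (c : ParIdx n → F) :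
    blindPoly (quadCoeffs c) = quad c := by
  funext i s
  exact polyOf_coeff (P := quad c i s) (totalDegree_quad3_le c i s.castSucc)

namespace Spec

variable {k K : Type*} [Field k] [Fintype k] [Field K] [Algebra k K]
variable {Kbar : Type*} [Field Kbar] [Algebra K Kbar] [Algebra k Kbar] [DecidableEq Kbar]
variable {n N d : ℕ} (T : Spec k K Kbar n N d)

theorem card_fun_le : Fintype.card T.type.Fun ≤ funBound n N := by
  have h : Fintype.card T.type.Fun
      = Fintype.card ((MapIx N × Var n × Var n) ⊕ (PairIx × Fin n)) :=
    Fintype.card_congr (Equiv.refl _)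
  rw [h, Fintype.card_sum, Fintype.card_prod, Fintype.card_prod, Fintype.card_prod,
    Fintype.card_prod, Fintype.card_fin, Fintype.card_fin, card_pairIx, funBound]
  exact Nat.add_le_add_right (Nat.mul_le_mul_right _ (card_mapIx_le N)) _

theorem card_locIdx_le : Fintype.card (LocIdx T.type) ≤ locBound n N := by
  rw [Fintype.card_sum]
  refine Nat.add_le_add (card_sigma_le T.card_fun_le ?_) (card_sigma_le ?_ ?_)
  · intro f
    rw [Fintype.card_prod, Fintype.card_bool]
    refine Nat.mul_le_mul_left _ ?_
    rcases f with ⟨q, i, j⟩ | ⟨p, i⟩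
    · exact card_mapShape_bmono_le _ _ _ sumDeg (fun q => by cases q <;> simp [sumDeg, mapDeg]) q
    · exact card_pairShape_bmono_le _ _ p
  · have h : Fintype.card (T.type.Map × Fin n × Fin 2) = Fintype.card (MapIx N × Fin n × Fin 2) :=
      Fintype.card_congr (Equiv.refl _)
    rw [h, Fintype.card_prod, Fintype.card_prod, Fintype.card_fin, Fintype.card_fin]
    exact Nat.mul_le_mul_right _ (card_mapIx_le N)
  · rintro ⟨q, i, s⟩
    rw [Fintype.card_prod, Fintype.card_bool]
    exact Nat.mul_le_mul_left _ (card_mapShape_bmono_le _ _ _ mapDeg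
      (fun q => by cases q <;> simp [mapDeg]) q)

theorem card_linIdx_le : Fintype.card (Setup.LinIdx n N (DVar n d)) ≤ linBound n N d := by
  rw [Fintype.card_sum]
  refine Nat.add_le_add (card_sigma_le ?_ ?_) (card_sigma_le ?_ ?_)
  · rw [Fintype.card_prod, Fintype.card_prod, Fintype.card_prod, Fintype.card_fin,
      Fintype.card_fin]
    exact Nat.mul_le_mul_right _ (card_mapIx_le N)
  · intro f
    simp only [Fintype.card_prod, Fintype.card_fin]
    exact Nat.mul_le_mul_left _ (Nat.mul_le_mul_right _ (mapArgs_le _))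
  · rw [Fintype.card_prod, card_pairIx, Fintype.card_fin]
  · intro f
    simp only [Fintype.card_prod, Fintype.card_fin]
    exact Nat.mul_le_mul_right _ (pairArgs_le _)

theorem card_blindIdx_le : Fintype.card (BlindIdx n (DVar n d)) ≤ coeffsBound n d := by
  simp only [Fintype.card_prod, Fintype.card_fin, coeffsBound]
  refine Nat.mul_le_mul_left _ (Nat.mul_le_mul_left _ (card_mono_le.trans_eq ?_))
  simp only [Fintype.card_prod, Fintype.card_fin]

theorem card_parIdx : Fintype.card (ParIdx n) = paramsBound n := by
  simp only [Fintype.card_prod, Fintype.card_sum, Fintype.card_fin, paramsBound]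

/-- The addition map alone has enough terms: those for the first coordinate in each group of three
are already n² in number. -/
theorem sq_le_card_fun : n ^ 2 ≤ Fintype.card T.type.Fun := by
  have h : Fintype.card T.type.Fun
      = Fintype.card ((MapIx N × Var n × Var n) ⊕ (PairIx × Fin n)) :=
    Fintype.card_congr (Equiv.refl _)
  let e : Fin n × Fin n → (MapIx N × Var n × Var n) ⊕ (PairIx × Fin n) := fun ij =>
    .inl (.add, (ij.1, 0), (ij.2, 0))
  have he : Function.Injective e := by
    rintro ⟨i, j⟩ ⟨i', j'⟩ h
    have h2 := Sum.inl_injective h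
    simp only [Prod.mk.injEq, true_and, and_true] at h2
    rw [h2.1, h2.2]
  rw [h]
  simpa [pow_two] using Fintype.card_le_of_injective e he

theorem finite_condIx : Finite T.CondIx := by
  have : Finite {c : (q : MapIx N) × ((Fin (mapArgs q) → Var n → K) × (Var n → K)) //
    T.IsEval c.1 c.2.1 c.2.2} := Finite.of_injective _ T.evalArgs_injective
  infer_instance

theorem card_condIx_le : Nat.card T.CondIx ≤ condBound n N T.pts.card := by
  have : Finite {c : (q : MapIx N) × ((Fin (mapArgs q) → Var n → K) × (Var n → K)) //
    T.IsEval c.1 c.2.1 c.2.2} := Finite.of_injective _ T.evalArgs_injective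
  -- With at least one public point, tuples of one or two arguments are bounded alike by the square
  -- of the number of points.
  have hpts : 1 ≤ T.pts.card := Finset.card_pos.mpr ⟨_, T.αhat_mem⟩
  have hargs : Fintype.card ((q : MapIx N) × (Fin (mapArgs q) → T.pts))
      ≤ (N + 2) * T.pts.card ^ 2 := by
    rw [Fintype.card_sigma]
    calc ∑ q : MapIx N, Fintype.card (Fin (mapArgs q) → T.pts)
        ≤ ∑ _q : MapIx N, T.pts.card ^ 2 := Finset.sum_le_sum fun q _ => by
          rw [Fintype.card_fun, Fintype.card_coe, Fintype.card_fin]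
          exact Nat.pow_le_pow_right hpts (mapArgs_le q)
      _ ≤ (N + 2) * T.pts.card ^ 2 := by
          rw [Finset.sum_const, smul_eq_mul]
          exact Nat.mul_le_mul_right _ (card_mapIx_le N)
  rw [Nat.card_sum, Nat.card_prod, Nat.card_eq_fintype_card (α := T.type.Fun),
    Nat.card_eq_fintype_card (α := Fin n × Fin 2), Fintype.card_prod, Fintype.card_fin,
    Fintype.card_fin, condBound]
  refine Nat.add_le_add T.card_fun_le (Nat.mul_le_mul_right _ (le_trans ?_ hargs))
  rw [← Nat.card_eq_fintype_card]
  exact Nat.card_le_card_of_injective _ T.evalArgs_injective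

theorem card_mono_fun_le (f : T.type.Fun) :
    Fintype.card (Mono (Fin (T.type.fArgs f) × DVar n d) 518) ≤ eqBound n d := by
  have h : Fintype.card (Fin (T.type.fArgs f) × DVar n d) ≤ 3 * (n * 3 * d) := by
    rw [Fintype.card_prod, Fintype.card_prod, Fintype.card_prod, Fintype.card_fin,
      Fintype.card_fin, Fintype.card_fin, Fintype.card_fin]
    refine Nat.mul_le_mul_right _ ?_
    rcases f with f | f
    · exact (mapArgs_le f.1).trans (by norm_num)
    · exact pairArgs_le f.1
  rw [eqBound]
  refine card_mono_le.trans ?_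
  gcongr

/-! ### The main theorem -/

variable {M : Presentation n Kbar} {τ : Type}

theorem triplyConfusing_sysOf (hM : M.Lawful k T.scene τ) (v : T.Unk M → Kbar) :
    TriplyConfusing T.type k τ T.scene M (T.sysOf M v) :=
  triplyConfusing hM T.twist_lt T.V_subset_W (hiddenSys_graph_subset _ _)

/-- Everything specific to a presentation enters through `Lawful`, the presentation `c` of the
secret map and the number of coordinates. -/
theorem secure [Infinite Kbar] [Fintype K] [Fintype τ] (hM : M.Lawful k T.scene τ) (hn : 1 ≤ n)
    {c : M.B → Kbar} (hc : c ∈ M.adm) (hmaps : M.maps c = quad T.parBar)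
    (hB : Fintype.card M.B' ≤ coeffsBound n d + paramsBound n) {C : ℕ}
    (hC : totalBound n N d T.pts.card ≤ C * n ^ C) : T.Secure M τ C := by
  have hdim : ∀ v ∈ T.VT M, (Fintype.card τ : WithBot ℕ∞)
      ≤ zdim (VSt T.type k T.scene M (T.sysOf M v)) := fun v hv =>
    le_zdim_VSt hM T.twist_lt T.V_subset_W (hiddenSys_graph_subset _ _) (T.mem_VS_sysOf hv.1)
  obtain ⟨v₀, hv₀, hsec⟩ := T.secret_mem hc hmaps
  -- The hidden system is the one determined by the secret solution, so its properties are instances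
  -- of those valid around every solution.
  have hS₀ : T.sysOf M v₀ = T.S₀ := by
    rw [sysOf, S₀, hsec.1, hsec.2.2]
  refine ⟨T.tilde_injective hM hn, ?_, ?_, ⟨T.finite_condIx, ?_⟩, ?_, ⟨v₀, hv₀, hsec⟩,
    hS₀ ▸ T.triplyConfusing_sysOf hM v₀, T.slotCond, hS₀ ▸ hdim v₀ hv₀,
    fun v hv => ⟨T.triplyConfusing_sysOf hM v, hdim v hv, T.locallyEmbedded hv⟩⟩
  · rw [Fintype.card_sum, Fintype.card_sum, add_assoc]
    exact T.sq_le_card_fun.trans ((card_fun_le_card_locIdx _).trans (Nat.le_add_right _ _))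
  · refine le_trans ?_ hC
    rw [Fintype.card_sum, Fintype.card_sum, totalBound]
    have h1 := T.card_locIdx_le
    have h2 := card_linIdx_le (n := n) (N := N) (d := d)
    omega
  · refine le_trans (T.card_condIx_le.trans ?_) hC
    rw [totalBound]
    omega
  · have he : eqBound n d + 1 ≤ C * n ^ C := by
      refine le_trans ?_ hC
      rw [totalBound]
      omega
    rintro (f | ⟨c, i, s⟩)
    · obtain ⟨Eqs, hcard, h⟩ := T.exists_equations_fun hM f
      exact ⟨Eqs, hcard.trans ((T.card_mono_fun_le f).trans ((Nat.le_succ _).trans he)),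
        fun v _ => h v⟩
    · obtain ⟨P, h⟩ := T.exists_equation_map hM c i s
      refine ⟨{P}, ?_, fun v _ => ?_⟩
      · rw [Finset.card_singleton]
        exact (Nat.le_add_left _ _).trans he
      · rw [h]
        simp

theorem secure_byParams [Infinite Kbar] [Fintype K] (hn : 1 ≤ n) {C : ℕ}
    (hC : totalBound n N d T.pts.card ≤ C * n ^ C) : T.Secure (byParams T.scene) (Fin n) C := by
  have hB : Fintype.card (byParams T.scene).B' = Fintype.card (ParIdx n) :=
    Fintype.card_congr (Equiv.refl _)
  refine T.secure (lawful_byParams T.scene) hn (c := T.parBar) ⟨T.validPar_parBar, rfl⟩ rfl ?_ hC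
  rw [hB, card_parIdx]
  exact Nat.le_add_left _ _

theorem secure_byCoeffs [Infinite Kbar] [Fintype K] (hn : 1 ≤ n) {C : ℕ}
    (hC : totalBound n N d T.pts.card ≤ C * n ^ C) :
    T.Secure (byCoeffs T.scene) (Fin n × Fin 2 × Fin n) C := by
  have hB : Fintype.card (byCoeffs T.scene).B' = Fintype.card (BlindIdx n (DVar n d)) :=
    Fintype.card_congr (Equiv.refl _)
  have hc : blindPoly (quadCoeffs T.parBar) = quad T.parBar := blindPoly_quadCoeffs _
  have hadm : IsBlinding T.scene.W (blindPoly (quadCoeffs T.parBar)) :=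
    ⟨T.parBar, T.validPar_parBar, rfl, fun x _ i s => by rw [hc]⟩
  refine T.secure (lawful_byCoeffs (T.exists_θ_ne_zero hn) T.validPar_parBar rfl) hn
    (c := quadCoeffs T.parBar) hadm hc ?_ hC
  rw [hB]
  exact card_blindIdx_le.trans (Nat.le_add_right _ _)

end Spec

end Blinding

end

theorem mainTheorem1 (C₀ : ℕ) :
    ∃ C : ℕ, ∀ (k K Kbar : Type*)
      [Field k] [Fintype k] [Field K] [Fintype K] [Algebra k K]
      [Field Kbar] [Algebra K Kbar] [Algebra k Kbar] [IsScalarTower k K Kbar]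
      [IsAlgClosure K Kbar] [DecidableEq Kbar]
      (n N d : ℕ) (T : Blinding.Spec k K Kbar n N d),
      1 ≤ n → N ≤ C₀ * n ^ 2 → d ≤ C₀ * n → T.pts.card ≤ C₀ * n ^ C₀ →
        T.Secure (Blinding.byCoeffs T.scene) (Fin n × Fin 2 × Fin n) C ∧
        T.Secure (Blinding.byParams T.scene) (Fin n) C := by
  -- All numbers to be bounded depend only on `n`, `N`, `d` and the number of public points, so the
  -- constant can be chosen before the fields.
  obtain ⟨C, hC⟩ := Blinding.polyBdd_totalBound C₀
  refine ⟨C, fun k K Kbar _ _ _ _ _ _ _ _ _ _ _ n N d T hn hN hd hp => ?_⟩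
  have : IsAlgClosed Kbar := IsAlgClosure.isAlgClosed K
  -- Needed to identify polynomials with functions, in `desc_injective` and in `le_zdim`.
  have : Infinite Kbar := IsAlgClosed.instInfinite
  have hbound := hC n N d T.pts.card hn hN hd hp
  exact ⟨T.secure_byCoeffs hn hbound, T.secure_byParams hn hbound⟩
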